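/- **Conventions.** A function $g:(0,\infty)\to[0,\infty)$ is completely monotone if it is $C^\infty$ and $(-1)^n g^{(n)}(z)\ge 0$ for all $z>0$ and all integers $n\ge 0$; $g^{(j)}(0):=\lim_{z\to0+}g^{(j)}(z)$. Let $\mathcal B_2$ be the set of bounded completely monotone $g$ with $g(0)=1$, $g'(0)=-1$, $g''(0)<\infty$, and let $\mathcal B_{2,\infty}$ be the set of $g\in\mathcal B_2$ with $\int_1^\infty g(s)s^{-1}\,ds<\infty$. For $\alpha\in[0,1]$ and $g\in\mathcal B_{2,\infty}$ put $$c_\alpha[g]=\frac1{\Gamma(2-\alpha)}\int_0^\infty\frac{g(z)-e^{-z}}{z^{1+\alpha}}\,dz .$$ Let $X$ be a complex Banach space and let $-A$ be the generator of a sectorially bounded holomorphic $C_0$-semigroup $(e^{-tA})_{t\ge0}$ on $X$, i.e. for some $\theta\in(0,\pi/2]$ the semigroup extends holomorphically to the sector $\{|\arg\lambda|<\theta\}$ and the extension is bounded and strongly continuous on $\{|\arg\lambda|\le\xi\}\cup\{0\}$ for every $0<\xi<\theta$. If $f(z)=\int_{[0,\infty)}e^{-zs}\,\mu(ds)$ for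 $z>0$ with a bounded complex Borel measure $\mu$ on $[0,\infty)$, then $f(A)x:=\int_{[0,\infty)}e^{-sA}x\,\mu(ds)$ (Hille–Phillips calculus). For $\beta\ge0$ the fractional power $A^\beta$ is defined by the extended Hille–Phillips calculus: $x\in\operatorname{dom}(A^\beta)$ and $A^\beta x=y$ if and only if $e_\beta(A)y=h_\beta(A)x$, where $e_\beta(z)=(1+z)^{-\beta}$ and $h_\beta(z)=z^\beta(1+z)^{-\beta}$. Put $M_\beta:=\sup_{t>0}\|t^\beta A^\beta e^{-tA}\|$. Finally $g_n(z):=g(z/n)^n$, and $g^n(tA/n)$ denotes $g_n(tA)$, where $-tA$ generates $(e^{-stA})_{s\ge0}$. **Theorem.** (1) Let $A$ be as above, $g\in\mathcal B_{2,\infty}$ and $\alpha\in[0,1]$. Then $A^{2-\alpha}e^{-tA}$ is defined on all of $X$ for every $t>0$, $M_{2-\alpha}<\infty$, the integral defining $c_\alpha[g]$ converges absolutely, and for all $x\in\operatorname{dom}(A^\alpha)$ $$\|g(A)x-e^{-A}x\|\le M_{2-\alpha}\,c_\alpha[g]\,\|A^\alpha x\| ,$$ and, more generally, for all integers $n\ge1$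 and all $t>0$, $$\|g^n(tA/n)x-e^{-tA}x\|\le M_{2-\alpha}\,c_\alpha[g_n]\,t^\alpha\,\|A^\alpha x\| .$$ (2) Let $g\in\mathcal B_2\cap L^k(0,\infty)$ for some integer $k\ge1$. Then there is a constant $C(g)>0$, depending only on $g$ and $k$ (and not on $X$, $A$, $\alpha$, $n$, $t$, $x$), such that for all $X$ and $A$ as above, all $\alpha\in[0,1]$, all integers $n\ge1$, all $t>0$ and all $x\in\operatorname{dom}(A^\alpha)$ $$\|g^n(tA/n)x-e^{-tA}x\|\le M_{2-\alpha}\,\frac{g''(0)-1}{2n}\Bigl(1+\frac{C(g)}{n}\Bigr)t^\alpha\,\|A^\alpha x\| .$$ -/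

import Mathlib

open MeasureTheory Set Filter Topology
open scoped NNReal ENNReal ContDiff

universe u

noncomputable section

/-! ### Completely monotone functions -/

/-- `g` is completely monotone on `(0, ∞)`; the values of `g` outside `(0, ∞)` are irrelevant. -/
def IsCM (g : ℝ → ℝ) : Prop :=
  ContDiffOn ℝ ∞ g (Ioi 0) ∧ ∀ (n : ℕ) (z : ℝ), 0 < z → 0 ≤ (-1 : ℝ) ^ n * iteratedDeriv n g z

/-- The bounded completely monotone functions. -/
def IsBM (g : ℝ → ℝ) : Prop :=
  IsCM g ∧ ∃ C : ℝ, ∀ z : ℝ, 0 < z → g z ≤ C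

/-- The class `B₁`: bounded completely monotone, `g(0+) = 1` and `g'(0+) = -1`. -/
def ClassB1 (g : ℝ → ℝ) : Prop :=
  IsBM g ∧ Tendsto g (𝓝[>] 0) (𝓝 1) ∧ Tendsto (deriv g) (𝓝[>] 0) (𝓝 (-1))

/-- The class `B₂`: functions in `B₁` with a finite limit `g''(0+)`. -/
def ClassB2 (g : ℝ → ℝ) : Prop :=
  ClassB1 g ∧ ∃ c : ℝ, Tendsto (iteratedDeriv 2 g) (𝓝[>] 0) (𝓝 c)

/-- The class `B_{2,∞}`: functions in `B₂` with `∫₁^∞ g(s) / s ds < ∞`. -/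
def ClassB2Inf (g : ℝ → ℝ) : Prop :=
  ClassB2 g ∧ IntegrableOn (fun s : ℝ => g s / s) (Ioi 1)

/-- `g''(0) = lim_{z → 0+} g''(z)`; the limit exists for `g` in `B₂`. -/
def secondDerivZero (g : ℝ → ℝ) : ℝ :=
  limUnder (𝓝[>] (0 : ℝ)) (iteratedDeriv 2 g)

/-- `Δ_β^g(z) = (g(z) - e^{-z}) / z^β`. -/
def deltaFun (β : ℝ) (g : ℝ → ℝ) (z : ℝ) : ℝ :=
  (g z - Real.exp (-z)) / z ^ β

/-- `c_α[g] = Γ(2 - α)⁻¹ ∫₀^∞ Δ_{1+α}^g(z) dz`. -/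
def cFun (α : ℝ) (g : ℝ → ℝ) : ℝ :=
  (Real.Gamma (2 - α))⁻¹ * ∫ z in Ioi (0 : ℝ), deltaFun (1 + α) g z

/-- `g_n(z) = g(z / n) ^ n`. -/
def scaledPow (g : ℝ → ℝ) (n : ℕ) (z : ℝ) : ℝ :=
  g (z / n) ^ n

/-! ### Semigroups and their generators -/

/-- The open sector `{λ : |arg λ| < θ}`, which does not contain `0`. -/
def openSector (θ : ℝ) : Set ℂ :=
  {z | z ≠ 0 ∧ |z.arg| < θ}

section Semigroup

variable {X : Type*} [NormedAddCommGroup X] [NormedSpace ℂ X]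

/-- `T` is a `C₀`-semigroup of bounded operators on `X`. -/
structure IsC0Semigroup (T : ℝ≥0 → X →L[ℂ] X) : Prop where
  map_zero : T 0 = 1
  map_add : ∀ s t : ℝ≥0, T (s + t) = T s * T t
  strong_cont : ∀ x : X, Continuous fun t : ℝ≥0 => T t x

/-- `-A` is the generator of `T`: `x ∈ dom A` and `A x = y` if and only if
`(x - T(h) x) / h → y` as `h → 0+`. -/
def IsNegGenerator (A : X →ₗ.[ℂ] X) (T : ℝ≥0 → X →L[ℂ] X) : Prop :=
  ∀ x y : X, (x, y) ∈ A.graph ↔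
    Tendsto (fun h : ℝ≥0 => (((h : ℝ) : ℂ)⁻¹) • (x - T h x)) (𝓝[>] 0) (𝓝 y)

/-- `T` extends holomorphically to a sector of some angle `θ ∈ (0, π/2]`, and the extension is
bounded and strongly continuous on the closure of each smaller sector. -/
def HasSectoriallyBoundedExtension (T : ℝ≥0 → X →L[ℂ] X) : Prop :=
  ∃ θ : ℝ, 0 < θ ∧ θ ≤ Real.pi / 2 ∧ ∃ S : ℂ → X →L[ℂ] X,
    (∀ t : ℝ≥0, S ((t : ℝ) : ℂ) = T t) ∧
    DifferentiableOn ℂ S (openSector θ) ∧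
    ∀ ξ : ℝ, 0 < ξ → ξ < θ →
      (∃ C : ℝ, ∀ z ∈ closure (openSector ξ), ‖S z‖ ≤ C) ∧
      ∀ x : X, ContinuousOn (fun z => S z x) (closure (openSector ξ))

/-- `-A` is the generator of the sectorially bounded holomorphic `C₀`-semigroup `T`, that is,
`T t = e^{-tA}`. -/
structure GeneratesSectoriallyBoundedHolomorphic
    (A : X →ₗ.[ℂ] X) (T : ℝ≥0 → X →L[ℂ] X) : Prop where
  semigroup : IsC0Semigroup T
  generator : IsNegGenerator A T
  holomorphic : HasSectoriallyBoundedExtension T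

/-- The semigroup `s ↦ e^{-s(tA)}` generated by `-tA`, where `T s = e^{-sA}`. -/
def scaleSemigroup (T : ℝ≥0 → X →L[ℂ] X) (t : ℝ≥0) : ℝ≥0 → X →L[ℂ] X :=
  fun s => T (t * s)

/-! ### The Hille-Phillips functional calculus -/

/-- `f` is on `(0, ∞)` the Laplace transform of the bounded complex Borel measure `h dν` on
`[0, ∞)`. Every bounded complex measure `μ` has this form, with `ν = |μ|`. Such an `f` extends in
one way to the Laplace transform of a bounded measure on the right half-plane, and the measure
`h dν` is determined by `f`, so the restriction to `(0, ∞)` loses nothing. -/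
def IsLaplaceRep (f : ℝ → ℂ) (p : Measure ℝ≥0 × (ℝ≥0 → ℂ)) : Prop :=
  IsFiniteMeasure p.1 ∧ Integrable p.2 p.1 ∧
    ∀ z : ℝ, 0 < z → f z = ∫ s : ℝ≥0, (Real.exp (-(z * s)) : ℂ) * p.2 s ∂p.1

open Classical in
/-- `f(A) x = ∫ e^{-sA} x μ(ds)` if `f` is the Laplace transform of the bounded measure `μ`, where
`T s = e^{-sA}` is bounded (and `0` if there is no such `μ`). -/
def hpCalc (T : ℝ≥0 → X →L[ℂ] X) (f : ℝ → ℂ) (x : X) : X :=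
  if h : ∃ p, IsLaplaceRep f p then
    ∫ s : ℝ≥0, (Classical.choose h).2 s • T s x ∂(Classical.choose h).1
  else 0

/-- `x ∈ dom (A^β)` and `A^β x = y`, for `β ≥ 0`, in the extended Hille-Phillips calculus with the
regularizer `e(z) = (1 + z)^{-β}`: `y = e(A)⁻¹ (e f)(A) x`, where `f(z) = z^β`, that is,
`e(A) y = (e f)(A) x` (the operator `e(A) = (1 + A)^{-β}` is injective). -/
def IsFracPow (T : ℝ≥0 → X →L[ℂ] X) (β : ℝ) (x y : X) : Prop :=
  hpCalc T (fun z => (((1 + z) ^ (-β) : ℝ) : ℂ)) y =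
    hpCalc T (fun z => (((1 + z) ^ (-β) * z ^ β : ℝ) : ℂ)) x

/-- The numbers `‖t^β A^β e^{-tA} x‖` with `t > 0` and `‖x‖ ≤ 1`. -/
def fracNormSet (T : ℝ≥0 → X →L[ℂ] X) (β : ℝ) : Set ℝ :=
  {r | ∃ (t : ℝ≥0) (x y : X), 0 < t ∧ ‖x‖ ≤ 1 ∧ IsFracPow T β (T t x) y ∧
    r = (t : ℝ) ^ β * ‖y‖}

/-- `M_β = sup_{t > 0} ‖t^β A^β e^{-tA}‖`. -/
def fracBound (T : ℝ≥0 → X →L[ℂ] X) (β : ℝ) : ℝ :=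
  sSup (fracNormSet T β)

/-- `M_β` is a genuine finite supremum of operator norms: `A^β e^{-tA}` is defined on all of `X`
for all `t > 0`, and the supremum is finite. -/
def FracBoundFinite (T : ℝ≥0 → X →L[ℂ] X) (β : ℝ) : Prop :=
  (∀ t : ℝ≥0, 0 < t → ∀ x : X, ∃! y : X, IsFracPow T β (T t x) y) ∧ BddAbove (fracNormSet T β)

end Semigroup

end

noncomputable section

/-! ### Bernstein's theorem -/

lemma IsCM.contDiffAt {g : ℝ → ℝ} (hg : IsCM g) {z : ℝ} (hz : 0 < z) (n : ℕ) :
    ContDiffAt ℝ n g z :=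
  ((hg.1 z hz).contDiffAt (Ioi_mem_nhds hz)).of_le (mod_cast le_top)

lemma IsCM.iteratedDerivWithin_eq {g : ℝ → ℝ} (hg : IsCM g) {a b x : ℝ} (ha : 0 < a) (hab : a < b)
    (hx : x ∈ Icc a b) (n : ℕ) :
    iteratedDerivWithin n g (Icc a b) x = iteratedDeriv n g x :=
  iteratedDerivWithin_eq_iteratedDeriv (uniqueDiffOn_Icc hab)
    (hg.contDiffAt (ha.trans_le hx.1) n) hx

lemma IsCM.continuousOn_iteratedDeriv {g : ℝ → ℝ} (hg : IsCM g) {a b : ℝ} (ha : 0 < a)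
    (hab : a < b) (n : ℕ) : ContinuousOn (iteratedDeriv n g) (Icc a b) := by
  have h1 : ContDiffOn ℝ n g (Icc a b) := fun x hx =>
    (hg.contDiffAt (ha.trans_le hx.1) n).contDiffWithinAt
  have h2 := h1.continuousOn_iteratedDerivWithin le_rfl (uniqueDiffOn_Icc hab)
  exact h2.congr fun x hx => (hg.iteratedDerivWithin_eq ha hab hx n).symm

/-- The remainder of the Taylor expansion at `R` of a completely monotone function. -/
def cmRemainder (g : ℝ → ℝ) (R : ℝ) (n : ℕ) (z : ℝ) : ℝ :=
  ∫ t in z..R, (t - z) ^ n / n.factorial * ((-1) ^ (n + 1) * iteratedDeriv (n + 1) g t)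

/-- The weights of the Taylor expansion at `R` of a completely monotone function. -/
def cmWeight (g : ℝ → ℝ) (R : ℝ) (k : ℕ) : ℝ :=
  R ^ k / k.factorial * ((-1) ^ k * iteratedDeriv k g R)

lemma IsCM.cmWeight_nonneg {g : ℝ → ℝ} (hg : IsCM g) {R : ℝ} (hR : 0 < R) (k : ℕ) :
    0 ≤ cmWeight g R k :=
  mul_nonneg (by positivity) (hg.2 k R hR)

lemma IsCM.taylor {g : ℝ → ℝ} (hg : IsCM g) {z R : ℝ} (hz : 0 < z) (hR : z < R) (n : ℕ) :
    g z = ∑ k ∈ Finset.range (n + 1), cmWeight g R k * (1 - z / R) ^ k + cmRemainder g R n z := by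
  have hu : uIcc R z = Icc z R := uIcc_of_ge hR.le
  have h1 : ContDiffOn ℝ (n + 1 : ℕ) g (uIcc R z) := by
    rw [hu]
    exact fun x hx => (hg.contDiffAt (hz.trans_le hx.1) _).contDiffWithinAt
  have h2 := taylor_integral_remainder h1
  rw [taylor_within_apply, hu] at h2
  have hR0 : R ≠ 0 := (hz.trans hR).ne'
  have h3 : ∑ k ∈ Finset.range (n + 1),
      (((k.factorial : ℝ)⁻¹ * (z - R) ^ k) • iteratedDerivWithin k g (Icc z R) R)
      = ∑ k ∈ Finset.range (n + 1), cmWeight g R k * (1 - z / R) ^ k := by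
    refine Finset.sum_congr rfl fun k _ => ?_
    rw [hg.iteratedDerivWithin_eq hz hR (right_mem_Icc.2 hR.le), cmWeight, smul_eq_mul]
    have : (z - R) ^ k = R ^ k * ((-1) ^ k * (1 - z / R) ^ k) := by
      rw [← mul_pow, ← mul_pow]
      congr 1
      field_simp
      ring
    rw [this]
    ring
  have h4 : ∫ t in R..z, ((z - t) ^ n / (n.factorial : ℝ)) •
      iteratedDerivWithin (n + 1) g (Icc z R) t = cmRemainder g R n z := by
    rw [cmRemainder, intervalIntegral.integral_symm, ← intervalIntegral.integral_neg]
    refine intervalIntegral.integral_congr fun t ht => ?_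
    rw [uIcc_of_le hR.le] at ht
    simp only [smul_eq_mul]
    rw [hg.iteratedDerivWithin_eq hz hR ht, ← neg_sub t z, neg_pow (t - z)]
    ring
  rw [h3, h4] at h2
  linarith

lemma IsCM.cmRemainder_integrable {g : ℝ → ℝ} (hg : IsCM g) {a z R : ℝ} (ha : 0 < a) (hz : a ≤ z)
    (hR : z < R) (w : ℝ) (n : ℕ) : IntervalIntegrable (fun t => (t - w) ^ n / n.factorial *
      ((-1) ^ (n + 1) * iteratedDeriv (n + 1) g t)) volume z R := by
  apply ContinuousOn.intervalIntegrable
  rw [uIcc_of_le hR.le]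
  have := hg.continuousOn_iteratedDeriv (ha.trans_le hz) hR (n + 1)
  fun_prop

lemma IsCM.cmRemainder_nonneg {g : ℝ → ℝ} (hg : IsCM g) {z R : ℝ} (hz : 0 < z) (hR : z < R)
    (n : ℕ) : 0 ≤ cmRemainder g R n z := by
  refine intervalIntegral.integral_nonneg hR.le fun t ht => ?_
  exact mul_nonneg (div_nonneg (pow_nonneg (by linarith [ht.1]) _) (by positivity))
    (hg.2 _ t (hz.trans_le ht.1))

lemma IsCM.cmRemainder_le {g : ℝ → ℝ} (hg : IsCM g) {w z R : ℝ} (hw : 0 < w) (hwz : w < z)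
    (hR : z < R) (n : ℕ) :
    cmRemainder g R n z ≤ ((R - z) / (R - w)) ^ n * cmRemainder g R n w := by
  have hpos : 0 < R - w := by linarith
  have hnn : ∀ t, w ≤ t → 0 ≤ (-1 : ℝ) ^ (n + 1) * iteratedDeriv (n + 1) g t :=
    fun t ht => hg.2 _ t (hw.trans_le ht)
  have h1 : cmRemainder g R n z ≤ ∫ t in z..R, ((R - z) / (R - w)) ^ n *
      ((t - w) ^ n / n.factorial * ((-1) ^ (n + 1) * iteratedDeriv (n + 1) g t)) := by
    refine intervalIntegral.integral_mono_on hR.le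
      (hg.cmRemainder_integrable hw hwz.le hR z n)
      ((hg.cmRemainder_integrable hw hwz.le hR w n).const_mul _) fun t ht => ?_
    rw [← mul_assoc (((R - z) / (R - w)) ^ n), ← mul_div_assoc, ← mul_pow]
    refine mul_le_mul_of_nonneg_right ?_ (hnn t (hwz.le.trans ht.1))
    refine div_le_div_of_nonneg_right (pow_le_pow_left₀ (by linarith [ht.1]) ?_ n) (by positivity)
    rw [div_mul_eq_mul_div, le_div_iff₀ hpos]
    nlinarith [ht.1, ht.2]
  refine h1.trans ?_
  rw [intervalIntegral.integral_const_mul]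
  refine mul_le_mul_of_nonneg_left ?_ (pow_nonneg (div_nonneg (by linarith) hpos.le) _)
  rw [cmRemainder]
  refine intervalIntegral.integral_mono_interval hwz.le hR.le le_rfl ?_
    (hg.cmRemainder_integrable hw le_rfl (hwz.trans hR) w n)
  refine (ae_restrict_iff' measurableSet_Ioc).2 (Eventually.of_forall fun t ht => ?_)
  exact mul_nonneg (div_nonneg (pow_nonneg (by linarith [ht.1]) _) (by positivity))
    (hnn t ht.1.le)

lemma IsCM.sum_cmWeight_le {g : ℝ → ℝ} (hg : IsCM g) {z R : ℝ} (hz : 0 < z) (hR : z < R) (n : ℕ) :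
    ∑ k ∈ Finset.range n, cmWeight g R k * (1 - z / R) ^ k ≤ g z := by
  have h0 : 0 ≤ 1 - z / R := by
    rw [sub_nonneg, div_le_one (hz.trans hR)]; exact hR.le
  have h := hg.taylor hz hR n
  rw [Finset.sum_range_succ] at h
  have := hg.cmRemainder_nonneg hz hR n
  have := mul_nonneg (hg.cmWeight_nonneg (hz.trans hR) n) (pow_nonneg h0 n)
  linarith

/-- A completely monotone function is the sum of its Taylor series at every point `R`, on
`(0, R)`. -/
lemma IsCM.hasSum_cmWeight {g : ℝ → ℝ} (hg : IsCM g) {z R : ℝ} (hz : 0 < z) (hR : z < R) :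
    HasSum (fun k => cmWeight g R k * (1 - z / R) ^ k) (g z) := by
  have hR0 := hz.trans hR
  have h0 : 0 ≤ 1 - z / R := by
    rw [sub_nonneg, div_le_one (hz.trans hR)]; exact hR.le
  rw [hasSum_iff_tendsto_nat_of_nonneg
    (fun k => mul_nonneg (hg.cmWeight_nonneg hR0 k) (pow_nonneg h0 k)), ← tendsto_add_atTop_iff_nat 1]
  have hw : 0 < z / 2 := by positivity
  set q := (R - z) / (R - z / 2) with hq
  have hq0 : 0 ≤ q := div_nonneg (by linarith) (by linarith)
  have hq1 : q < 1 := by rw [hq, div_lt_one (by linarith)]; linarith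
  have hrem : Tendsto (fun n => cmRemainder g R n z) atTop (𝓝 0) := by
    have h1 : Tendsto (fun n : ℕ => q ^ n * g (z / 2)) atTop (𝓝 0) := by
      simpa using (tendsto_pow_atTop_nhds_zero_of_lt_one hq0 hq1).mul_const (g (z / 2))
    refine squeeze_zero (fun n => hg.cmRemainder_nonneg hz hR n) (fun n => ?_) h1
    refine (hg.cmRemainder_le hw (by linarith) hR n).trans
      (mul_le_mul_of_nonneg_left ?_ (pow_nonneg hq0 n))
    have h2 := hg.taylor hw (by linarith : z / 2 < R) n
    have h3 : 0 ≤ 1 - z / 2 / R := by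
      rw [sub_nonneg, div_le_one hR0]; linarith
    have := Finset.sum_nonneg (s := Finset.range (n + 1)) fun k _ =>
      mul_nonneg (hg.cmWeight_nonneg hR0 k) (pow_nonneg h3 k)
    linarith
  have h4 : (fun n => ∑ k ∈ Finset.range (n + 1), cmWeight g R k * (1 - z / R) ^ k)
      = fun n => g z - cmRemainder g R n z := by
    funext n
    rw [hg.taylor hz hR n]; ring
  rw [h4]
  simpa using hrem.const_sub (g z)

lemma IsCM.hasSum_cmWeight_one {g : ℝ → ℝ} (hg : IsCM g) (h1 : Tendsto g (𝓝[>] 0) (𝓝 1)) {R : ℝ}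
    (hR : 0 < R) : HasSum (cmWeight g R) 1 := by
  have hev : ∀ᶠ z in 𝓝[>] (0 : ℝ), 0 < z ∧ z < R := by
    filter_upwards [Ioo_mem_nhdsGT hR] with z hz using hz
  have hle : ∀ n, ∑ k ∈ Finset.range n, cmWeight g R k ≤ 1 := by
    intro n
    have hl : Tendsto (fun z => ∑ k ∈ Finset.range n, cmWeight g R k * (1 - z / R) ^ k) (𝓝[>] 0)
        (𝓝 (∑ k ∈ Finset.range n, cmWeight g R k * (1 - 0 / R) ^ k)) := by
      refine Tendsto.mono_left (Continuous.tendsto ?_ 0) nhdsWithin_le_nhds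
      fun_prop
    simp only [zero_div, sub_zero, one_pow, mul_one] at hl
    exact le_of_tendsto_of_tendsto hl h1 (hev.mono fun z hz => hg.sum_cmWeight_le hz.1 hz.2 n)
  have hnn := hg.cmWeight_nonneg hR
  have hs : Summable (cmWeight g R) := summable_of_sum_range_le hnn hle
  have hle1 : ∑' k, cmWeight g R k ≤ 1 := hs.tsum_le_of_sum_range_le hle
  have hge : 1 ≤ ∑' k, cmWeight g R k := by
    refine le_of_tendsto h1 (hev.mono fun z hz => ?_)
    have h := hg.hasSum_cmWeight hz.1 hz.2
    rw [← h.tsum_eq]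
    refine h.summable.tsum_le_tsum (fun k => ?_) hs
    have h2 : 0 ≤ 1 - z / R := by rw [sub_nonneg, div_le_one hR]; exact hz.2.le
    have h3 : 1 - z / R ≤ 1 := by have := div_nonneg hz.1.le hR.le; linarith
    exact mul_le_of_le_one_right (hnn k) (pow_le_one₀ h2 h3)
  exact (le_antisymm hle1 hge) ▸ hs.hasSum

lemma abs_exp_neg_sub_one_sub_pow_le {x : ℝ} (h0 : 0 ≤ x) (h1 : x ≤ 1) (k : ℕ) :
    |Real.exp (-(k * x)) - (1 - x) ^ k| ≤ 3 * x := by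
  rcases k with _ | k
  · simpa using h0
  have he : Real.exp (-(((k + 1 : ℕ) : ℝ) * x)) = Real.exp (-x) ^ (k + 1) := by
    rw [← Real.exp_nat_mul]; congr 1; ring
  rw [he]
  have hb : 1 - x ≤ Real.exp (-x) := by linarith [Real.add_one_le_exp (-x)]
  refine (abs_pow_sub_pow_le _ _ _).trans ?_
  rw [abs_of_nonneg (Real.exp_pos _).le, abs_of_nonneg (by linarith : 0 ≤ 1 - x), max_eq_left hb]
  have h2 : |Real.exp (-x) - (1 - x)| ≤ x ^ 2 := by
    have := Real.abs_exp_sub_one_sub_id_le (x := -x) (by rwa [abs_neg, abs_of_nonneg h0])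
    rw [neg_sq] at this
    convert this using 2
    ring
  have h3 : ((k + 1 : ℕ) : ℝ) * x * Real.exp (-x) ^ (k + 1) ≤ 1 := by
    rw [← he, Real.exp_neg, ← div_eq_mul_inv, div_le_one (Real.exp_pos _)]
    linarith [Real.add_one_le_exp (((k + 1 : ℕ) : ℝ) * x)]
  have h4 : Real.exp x ≤ 3 :=
    (Real.exp_le_exp.2 h1).trans (Real.exp_one_lt_d9.le.trans (by norm_num))
  have h5 : Real.exp (-x) ^ k = Real.exp x * Real.exp (-x) ^ (k + 1) := by
    rw [pow_succ, mul_left_comm, ← Real.exp_add, add_neg_cancel, Real.exp_zero, mul_one]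
  calc |Real.exp (-x) - (1 - x)| * ((k + 1 : ℕ) : ℝ) * Real.exp (-x) ^ (k + 1 - 1)
      ≤ x ^ 2 * ((k + 1 : ℕ) : ℝ) * Real.exp (-x) ^ (k + 1 - 1) := by gcongr
    _ = Real.exp x * (x * (((k + 1 : ℕ) : ℝ) * x * Real.exp (-x) ^ (k + 1))) := by
        rw [Nat.add_sub_cancel, h5]; ring
    _ ≤ 3 * (x * 1) := by gcongr
    _ = 3 * x := by ring

/-- The law with mass `cmWeight g R k` at `e^{-k/R}`. -/
lemma IsCM.exists_approx {g : ℝ → ℝ} (hg : IsCM g) (h1 : Tendsto g (𝓝[>] 0) (𝓝 1)) {R : ℝ}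
    (hR : 0 < R) : ∃ ρ : ProbabilityMeasure unitInterval, ∀ z, 0 < z → z < R →
      |∫ y, (y : ℝ) ^ z ∂(ρ : Measure unitInterval) - g z| ≤ 3 * (z / R) := by
  have hs := hg.hasSum_cmWeight_one h1 hR
  have hnn := hg.cmWeight_nonneg hR
  have hs' : HasSum (fun k => ENNReal.ofReal (cmWeight g R k)) 1 := by
    rw [← ENNReal.ofReal_one, ← hs.tsum_eq, ENNReal.ofReal_tsum_of_nonneg hnn hs.summable]
    exact ENNReal.summable.hasSum
  let p : PMF ℕ := ⟨_, hs'⟩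
  let e : ℕ → unitInterval := fun k => ⟨Real.exp (-(k / R)), (Real.exp_pos _).le,
    Real.exp_le_one_iff.2 (neg_nonpos.2 (by positivity))⟩
  have he : Measurable e := measurable_from_top
  refine ⟨⟨p.toMeasure.map e, Measure.isProbabilityMeasure_map he.aemeasurable⟩, fun z hz hzR => ?_⟩
  have hcont : Continuous fun y : unitInterval => (y : ℝ) ^ z :=
    continuous_subtype_val.rpow_const fun _ => Or.inr hz.le
  have hmap : ∫ y, (y : ℝ) ^ z ∂(p.toMeasure.map e) = ∫ k, (e k : ℝ) ^ z ∂p.toMeasure :=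
    integral_map he.aemeasurable hcont.aestronglyMeasurable
  have hez : ∀ k : ℕ, (e k : ℝ) ^ z = Real.exp (-(k * (z / R))) := by
    intro k
    change Real.exp _ ^ z = _
    rw [← Real.exp_mul]; congr 1; ring
  have hint : Integrable (fun k => (e k : ℝ) ^ z) p.toMeasure := by
    refine Integrable.of_bound measurable_from_top.aestronglyMeasurable 1
      (Eventually.of_forall fun k => ?_)
    rw [hez, Real.norm_of_nonneg (Real.exp_pos _).le]
    exact Real.exp_le_one_iff.2 (neg_nonpos.2 (by positivity))
  change |∫ y, (y : ℝ) ^ z ∂(p.toMeasure.map e) - g z| ≤ _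
  rw [hmap, PMF.integral_eq_tsum p _ hint]
  have hpk : ∀ k, (p k).toReal = cmWeight g R k := fun k => ENNReal.toReal_ofReal (hnn k)
  simp only [hpk, hez, smul_eq_mul]
  have hx0 : 0 ≤ z / R := by positivity
  have hx1 : z / R ≤ 1 := (div_le_one hR).2 hzR.le
  have hsum1 : Summable fun k : ℕ => cmWeight g R k * Real.exp (-(k * (z / R))) :=
    Summable.of_nonneg_of_le (fun k => mul_nonneg (hnn k) (Real.exp_pos _).le)
      (fun k => mul_le_of_le_one_right (hnn k)
        (Real.exp_le_one_iff.2 (neg_nonpos.2 (by positivity)))) hs.summable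
  have hsum2 := hg.hasSum_cmWeight hz hzR
  rw [← hsum2.tsum_eq, ← hsum1.tsum_sub hsum2.summable, ← Real.norm_eq_abs]
  have h3 : HasSum (fun k => cmWeight g R k * (3 * (z / R))) (3 * (z / R)) := by
    simpa using hs.mul_right (3 * (z / R))
  refine tsum_of_norm_bounded h3 fun k => ?_
  rw [← mul_sub, norm_mul, Real.norm_of_nonneg (hnn k), Real.norm_eq_abs]
  exact mul_le_mul_of_nonneg_left (abs_exp_neg_sub_one_sub_pow_le hx0 hx1 k) (hnn k)

lemma IsCM.exists_unitInterval {g : ℝ → ℝ} (hg : IsCM g) (h1 : Tendsto g (𝓝[>] 0) (𝓝 1)) :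
    ∃ ρ : ProbabilityMeasure unitInterval, ∀ z, 0 < z →
      ∫ y, (y : ℝ) ^ z ∂(ρ : Measure unitInterval) = g z := by
  choose ρ hρ using fun m : ℕ => hg.exists_approx h1 (by positivity : (0 : ℝ) < m + 1)
  obtain ⟨ρ', hρ'⟩ := exists_clusterPt_of_compactSpace (map ρ atTop)
  obtain ⟨U, hU, hlim⟩ := mapClusterPt_iff_ultrafilter.1 (show MapClusterPt ρ' atTop ρ from hρ')
  refine ⟨ρ', fun z hz => ?_⟩
  let f : BoundedContinuousFunction unitInterval ℝ := BoundedContinuousFunction.mkOfCompact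
    ⟨fun y => (y : ℝ) ^ z, continuous_subtype_val.rpow_const fun _ => Or.inr hz.le⟩
  have h2 := ProbabilityMeasure.tendsto_iff_forall_integral_tendsto.1 hlim f
  refine tendsto_nhds_unique h2 (Tendsto.mono_left ?_ hU)
  have h3 : Tendsto (fun m : ℕ => 3 * (z / ((m : ℝ) + 1))) atTop (𝓝 0) := by
    simpa using ((tendsto_natCast_atTop_atTop.atTop_add
      (tendsto_const_nhds (x := (1 : ℝ)))).const_div_atTop z).const_mul 3
  refine tendsto_iff_norm_sub_tendsto_zero.2
    (squeeze_zero' (Eventually.of_forall fun _ => norm_nonneg _) ?_ h3)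
  filter_upwards [eventually_gt_atTop ⌈z⌉₊] with m hm
  have hzm : z < (m : ℝ) + 1 := ((Nat.le_ceil z).trans (Nat.cast_le.2 hm.le)).trans_lt (lt_add_one _)
  exact hρ m z hz hzm

/-- Bernstein's theorem: a completely monotone function with `g(0+) = 1` is the Laplace transform
of a probability measure. -/
theorem IsCM.exists_laplace {g : ℝ → ℝ} (hg : IsCM g) (h1 : Tendsto g (𝓝[>] 0) (𝓝 1)) :
    ∃ ν : Measure ℝ≥0, IsProbabilityMeasure ν ∧
      ∀ z : ℝ, 0 < z → g z = ∫ s : ℝ≥0, Real.exp (-(z * s)) ∂ν := by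
  obtain ⟨ρ, hρ⟩ := hg.exists_unitInterval h1
  let e : unitInterval → ℝ≥0 := fun y => (-Real.log y).toNNReal
  have he : Measurable e := by fun_prop
  have hint : ∀ z : ℝ, 0 < z → Integrable (fun y : unitInterval => (y : ℝ) ^ z)
      (ρ : Measure unitInterval) := fun z hz => by
    refine Integrable.of_bound (Continuous.aestronglyMeasurable
      (continuous_subtype_val.rpow_const fun _ => Or.inr hz.le)) 1 (Eventually.of_forall fun y => ?_)
    rw [Real.norm_of_nonneg (Real.rpow_nonneg y.2.1 z)]
    exact Real.rpow_le_one y.2.1 y.2.2 hz.le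
  have hne : ∀ᵐ y ∂(ρ : Measure unitInterval), y ≠ 0 := by
    have h2 : ∀ z : ℝ, 0 < z → g z ≤ (ρ : Measure unitInterval).real {0}ᶜ := by
      intro z hz
      rw [← hρ z hz, ← integral_indicator_one (measurableSet_singleton (0 : unitInterval)).compl]
      refine integral_mono (hint z hz)
        ((integrable_const (1 : ℝ)).indicator (measurableSet_singleton _).compl) fun y => ?_
      by_cases hy : y = 0
      · simp [hy, Real.zero_rpow hz.ne']
      · simpa [hy] using Real.rpow_le_one y.2.1 y.2.2 hz.le
    have h3 : 1 ≤ (ρ : Measure unitInterval).real {0}ᶜ :=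
      le_of_tendsto h1 (eventually_nhdsWithin_of_forall h2)
    have h4 : (ρ : Measure unitInterval) {0}ᶜ = 1 :=
      le_antisymm prob_le_one <| by
        rw [← ENNReal.ofReal_one, ← ofReal_measureReal]
        exact ENNReal.ofReal_le_ofReal h3
    exact (mem_ae_iff_prob_eq_one (measurableSet_singleton _).compl).2 h4
  refine ⟨(ρ : Measure unitInterval).map e, Measure.isProbabilityMeasure_map he.aemeasurable,
    fun z hz => ?_⟩
  rw [integral_map he.aemeasurable (by fun_prop), ← hρ z hz]
  refine integral_congr_ae (hne.mono fun y hy => ?_)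
  have hy0 : 0 < (y : ℝ) := lt_of_le_of_ne y.2.1 fun h => hy (Subtype.ext h.symm)
  have : 0 ≤ -Real.log y := neg_nonneg.2 (Real.log_nonpos y.2.1 y.2.2)
  simp only [e]
  rw [Real.coe_toNNReal _ this, Real.rpow_def_of_pos hy0]
  congr 1
  ring

/-! ### Laplace transforms of finite measures on `[0, ∞)` -/

/-- The Laplace transform of a measure on `[0, ∞)`. -/
def laplace (μ : Measure ℝ≥0) (z : ℝ) : ℝ :=
  ∫ s : ℝ≥0, Real.exp (-(z * s)) ∂μ

lemma integrable_of_continuous_of_bound {E : Type*} [NormedAddCommGroup E] (μ : Measure ℝ≥0)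
    [IsFiniteMeasure μ] {φ : ℝ≥0 → E} (hφ : Continuous φ) {K : ℝ} (hK : ∀ s, ‖φ s‖ ≤ K) :
    Integrable φ μ :=
  Integrable.of_bound hφ.aestronglyMeasurable K (Eventually.of_forall hK)

lemma norm_exp_neg_mul_le {z : ℝ} (hz : 0 ≤ z) (s : ℝ≥0) : ‖Real.exp (-(z * s))‖ ≤ 1 := by
  rw [Real.norm_of_nonneg (Real.exp_pos _).le]
  exact Real.exp_le_one_iff.2 (neg_nonpos.2 (by positivity))

lemma integrable_exp_neg_mul (μ : Measure ℝ≥0) [IsFiniteMeasure μ] {z : ℝ} (hz : 0 ≤ z) :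
    Integrable (fun s : ℝ≥0 => Real.exp (-(z * s))) μ :=
  integrable_of_continuous_of_bound μ (by fun_prop) (norm_exp_neg_mul_le hz)

lemma tendsto_laplace_zero (μ : Measure ℝ≥0) [IsFiniteMeasure μ] :
    Tendsto (laplace μ) (𝓝[>] 0) (𝓝 (laplace μ 0)) := by
  refine tendsto_integral_filter_of_dominated_convergence (fun _ => 1)
    (Eventually.of_forall fun z => (by fun_prop)) ?_ (integrable_const _) ?_
  · filter_upwards [self_mem_nhdsWithin] with z hz
    exact Eventually.of_forall fun s => norm_exp_neg_mul_le (le_of_lt hz) s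
  · refine Eventually.of_forall fun s => Tendsto.mono_left (Continuous.tendsto ?_ 0)
      nhdsWithin_le_nhds
    fun_prop

lemma Measure.ext_of_laplace {μ ν : Measure ℝ≥0} [IsFiniteMeasure μ] [IsFiniteMeasure ν]
    (h : ∀ z : ℝ, 0 < z → laplace μ z = laplace ν z) : μ = ν := by
  have h0 : laplace μ 0 = laplace ν 0 :=
    tendsto_nhds_unique (f := laplace ν) (l := 𝓝[>] (0 : ℝ))
      ((tendsto_laplace_zero μ).congr' (eventually_nhdsWithin_of_forall h))
      (tendsto_laplace_zero ν)
  let e : BoundedContinuousFunction ℝ≥0 ℝ := BoundedContinuousFunction.ofNormedAddCommGroup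
    (fun s : ℝ≥0 => Real.exp (-(s : ℝ))) (by fun_prop) 1
    (fun s => by simp)
  have hpow : ∀ (k : ℕ) (s : ℝ≥0), (e ^ k) s = Real.exp (-((k : ℝ) * s)) := by
    intro k s
    rw [BoundedContinuousFunction.pow_apply]
    change Real.exp (-(s : ℝ)) ^ k = _
    rw [← Real.exp_nat_mul]; congr 1; ring
  let A : StarSubalgebra ℝ (BoundedContinuousFunction ℝ≥0 ℝ) :=
    { (Polynomial.aeval (R := ℝ) e).range with
      star_mem' := fun {a} ha => by
        have : star a = a := by ext s; simp
        rw [this]; exact ha }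
  refine ext_of_forall_mem_subalgebra_integral_eq_of_polish (𝕜 := ℝ) (A := A) ?_ ?_
  · intro x y hxy
    refine ⟨e, ⟨_, ⟨e, ⟨Polynomial.X, by simp⟩, rfl⟩, rfl⟩, ?_⟩
    intro hexp
    have : Real.exp (-(x : ℝ)) = Real.exp (-(y : ℝ)) := hexp
    exact hxy (NNReal.coe_injective (neg_injective (Real.exp_injective this)))
  · rintro g ⟨p, rfl⟩
    change ∫ s, (Polynomial.aeval e p) s ∂μ = ∫ s, (Polynomial.aeval e p) s ∂ν
    have hint : ∀ (q : BoundedContinuousFunction ℝ≥0 ℝ) (m : Measure ℝ≥0) [IsFiniteMeasure m],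
        Integrable q m := fun q m _ => q.integrable m
    induction p using Polynomial.induction_on' with
    | add p q hp hq =>
      simp only [map_add, BoundedContinuousFunction.add_apply]
      rw [integral_add (hint _ _) (hint _ _), integral_add (hint _ _) (hint _ _), hp, hq]
    | monomial k c =>
      have h1 : ∀ s, (Polynomial.aeval e (Polynomial.monomial k c)) s
          = c * Real.exp (-((k : ℝ) * s)) := by
        intro s
        rw [Polynomial.aeval_monomial, ← hpow, ← Algebra.smul_def]
        simp
      simp only [h1]
      rw [integral_const_mul, integral_const_mul]
      congr 1
      rcases Nat.eq_zero_or_pos k with rfl | hk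
      · simpa [laplace] using h0
      · exact h k (by exact_mod_cast hk)

/-- On `(0, ∞)`, `f` is the difference of the Laplace transforms of the finite measures `μ`
and `ν`. -/
structure IsLaplaceDiff (f : ℝ → ℝ) (μ ν : Measure ℝ≥0) : Prop where
  finite_left : IsFiniteMeasure μ
  finite_right : IsFiniteMeasure ν
  eq : ∀ z : ℝ, 0 < z → f z = laplace μ z - laplace ν z

lemma IsLaplaceDiff.isLaplaceRep {f : ℝ → ℝ} {μ ν : Measure ℝ≥0} (h : IsLaplaceDiff f μ ν) :
    IsLaplaceRep (fun z => (f z : ℂ)) (μ + ν, fun s =>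
      (((μ.rnDeriv (μ + ν) s).toReal - (ν.rnDeriv (μ + ν) s).toReal : ℝ) : ℂ)) := by
  have := h.finite_left
  have := h.finite_right
  have hμ : μ ≪ μ + ν := Measure.AbsolutelyContinuous.add_right (Measure.AbsolutelyContinuous.refl μ) ν
  have hν : ν ≪ μ + ν := by
    rw [add_comm]
    exact Measure.AbsolutelyContinuous.add_right (Measure.AbsolutelyContinuous.refl ν) μ
  refine ⟨inferInstance, (Measure.integrable_toReal_rnDeriv.sub
    Measure.integrable_toReal_rnDeriv).ofReal, fun z hz => ?_⟩
  have hi : ∀ (m : Measure ℝ≥0) [IsFiniteMeasure m], m ≪ μ + ν → Integrable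
      (fun s : ℝ≥0 => (m.rnDeriv (μ + ν) s).toReal * Real.exp (-(z * s))) (μ + ν) := fun m _ hm =>
    (integrable_rnDeriv_smul_iff hm).2 (integrable_exp_neg_mul m hz.le)
  have he : ∀ (m : Measure ℝ≥0) [IsFiniteMeasure m], m ≪ μ + ν →
      ∫ s : ℝ≥0, (m.rnDeriv (μ + ν) s).toReal * Real.exp (-(z * s)) ∂(μ + ν) = laplace m z :=
    fun m _ hm => integral_rnDeriv_smul hm
  change ((f z : ℝ) : ℂ) = _
  rw [h.eq z hz, ← he μ hμ, ← he ν hν, ← integral_sub (hi μ hμ) (hi ν hν), ← integral_complex_ofReal]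
  refine integral_congr_ae (Eventually.of_forall fun s => ?_)
  push_cast
  ring

section Parts

variable {E : Type*} [NormedAddCommGroup E] [NormedSpace ℝ E]

/-- The finite measure `q⁺ dν`. -/
def posPartMeasure (ν : Measure ℝ≥0) (q : ℝ≥0 → ℝ) : Measure ℝ≥0 :=
  ν.withDensity fun s => ENNReal.ofReal (q s)

lemma isFiniteMeasure_posPartMeasure {ν : Measure ℝ≥0} {q : ℝ≥0 → ℝ} (hq : Integrable q ν) :
    IsFiniteMeasure (posPartMeasure ν q) :=
  isFiniteMeasure_withDensity_ofReal hq.2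

lemma integral_smul_eq_sub_posPartMeasure {ν : Measure ℝ≥0} {q : ℝ≥0 → ℝ}
    (hq : Integrable q ν) {φ : ℝ≥0 → E} (hφ : Continuous φ) {K : ℝ} (hK : ∀ s, ‖φ s‖ ≤ K) :
    ∫ s, q s • φ s ∂ν
      = ∫ s, φ s ∂(posPartMeasure ν q) - ∫ s, φ s ∂(posPartMeasure ν (-q)) := by
  have key : ∀ q : ℝ≥0 → ℝ, Integrable q ν → ∫ s, φ s ∂(posPartMeasure ν q)
      = ∫ s, max (q s) 0 • φ s ∂ν := by
    intro q hq
    rw [posPartMeasure, integral_withDensity_eq_integral_toReal_smul₀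
      hq.aestronglyMeasurable.aemeasurable.ennreal_ofReal
      (Eventually.of_forall fun _ => ENNReal.ofReal_lt_top)]
    simp only [ENNReal.toReal_ofReal']
  have hi : ∀ q : ℝ≥0 → ℝ, Integrable q ν → Integrable (fun s => max (q s) 0 • φ s) ν := by
    intro q hq
    exact hq.pos_part.smul_bdd K hφ.aestronglyMeasurable (Eventually.of_forall hK)
  rw [key q hq, key _ hq.neg, ← integral_sub (hi q hq) (hi _ hq.neg)]
  refine integral_congr_ae (Eventually.of_forall fun s => ?_)
  simp only [← sub_smul]
  congr 1
  rcases le_total 0 (q s) with h | h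
  · simp [h]
  · simp [h]

end Parts

section Calculus

variable {X : Type*} [NormedAddCommGroup X] [NormedSpace ℂ X]

lemma IsLaplaceDiff.integral_eq_of_isLaplaceRep {f : ℝ → ℝ} {μ ν : Measure ℝ≥0}
    (h : IsLaplaceDiff f μ ν) {p : Measure ℝ≥0 × (ℝ≥0 → ℂ)}
    (hp : IsLaplaceRep (fun z => (f z : ℂ)) p) {φ : ℝ≥0 → X} (hφ : Continuous φ) {K : ℝ}
    (hK : ∀ s, ‖φ s‖ ≤ K) :
    ∫ s, p.2 s • φ s ∂p.1 = ∫ s, φ s ∂μ - ∫ s, φ s ∂ν := by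
  obtain ⟨m, q⟩ := p
  obtain ⟨hm, hq, heq⟩ := hp
  simp only at hm hq heq ⊢
  have := h.finite_left
  have := h.finite_right
  have hre : Integrable (fun s => (q s).re) m := hq.re
  have him : Integrable (fun s => (q s).im) m := hq.im
  have f1 := isFiniteMeasure_posPartMeasure hre
  have f2 := isFiniteMeasure_posPartMeasure hre.neg
  have f3 := isFiniteMeasure_posPartMeasure him
  have f4 := isFiniteMeasure_posPartMeasure him.neg
  set a := posPartMeasure m fun s => (q s).re
  set a' := posPartMeasure m (-fun s => (q s).re)
  set b := posPartMeasure m fun s => (q s).im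
  set b' := posPartMeasure m (-fun s => (q s).im)
  have hadd : ∀ (m₁ m₂ : Measure ℝ≥0) [IsFiniteMeasure m₁] [IsFiniteMeasure m₂] (z : ℝ), 0 < z →
      laplace (m₁ + m₂) z = laplace m₁ z + laplace m₂ z := fun m₁ m₂ _ _ z hz =>
    integral_add_measure (integrable_exp_neg_mul m₁ hz.le) (integrable_exp_neg_mul m₂ hz.le)
  have hdecomp : ∀ z : ℝ, 0 < z → f z = laplace a z - laplace a' z ∧
      laplace b z - laplace b' z = 0 := by
    intro z hz
    have hc : Continuous fun s : ℝ≥0 => Real.exp (-(z * s)) := by fun_prop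
    have hqi : Integrable (fun s : ℝ≥0 => (Real.exp (-(z * s)) : ℂ) * q s) m := by
      refine hq.bdd_mul (c := 1) (by fun_prop) (Eventually.of_forall fun s => ?_)
      rw [Complex.norm_real]
      exact norm_exp_neg_mul_le hz.le s
    have e1 := integral_smul_eq_sub_posPartMeasure hre hc (norm_exp_neg_mul_le hz.le)
    have e2 := integral_smul_eq_sub_posPartMeasure him hc (norm_exp_neg_mul_le hz.le)
    have h1 := congrArg Complex.re (heq z hz)
    have h2 := congrArg Complex.im (heq z hz)
    have h1' : ∫ s : ℝ≥0, ((Real.exp (-(z * s)) : ℂ) * q s).re ∂m = _ := integral_re hqi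
    have h2' : ∫ s : ℝ≥0, ((Real.exp (-(z * s)) : ℂ) * q s).im ∂m = _ := integral_im hqi
    simp only [RCLike.re_to_complex, RCLike.im_to_complex] at h1' h2'
    rw [← h1'] at h1
    rw [← h2'] at h2
    simp only [Complex.ofReal_re, Complex.ofReal_im, Complex.re_ofReal_mul,
      Complex.im_ofReal_mul] at h1 h2
    simp only [smul_eq_mul, mul_comm _ (Real.exp _)] at e1 e2
    exact ⟨h1.trans e1, (h2.trans e2).symm⟩
  have hab : a + ν = a' + μ := Measure.ext_of_laplace fun z hz => by
    rw [hadd _ _ z hz, hadd _ _ z hz]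
    linarith [h.eq z hz, (hdecomp z hz).1]
  have hbb : b = b' := Measure.ext_of_laplace fun z hz => by
    linarith [(hdecomp z hz).2]
  have hi : ∀ (m₁ : Measure ℝ≥0) [IsFiniteMeasure m₁], Integrable φ m₁ := fun m₁ _ =>
    integrable_of_continuous_of_bound m₁ hφ hK
  have e1 := integral_smul_eq_sub_posPartMeasure hre hφ hK
  have e2 := integral_smul_eq_sub_posPartMeasure him (φ := fun s => Complex.I • φ s)
    (hφ.const_smul _) (K := K) (fun s => by rw [norm_smul]; simpa using hK s)
  have e3 : ∫ s, φ s ∂a + ∫ s, φ s ∂ν = ∫ s, φ s ∂a' + ∫ s, φ s ∂μ := by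
    rw [← integral_add_measure (hi _) (hi _), hab, integral_add_measure (hi _) (hi _)]
  have e4 : ∫ s, (q s).im • (Complex.I • φ s) ∂m = 0 := by
    rw [e2]
    change ∫ s, Complex.I • φ s ∂b - ∫ s, Complex.I • φ s ∂b' = 0
    rw [hbb, sub_self]
  have i1 : Integrable (fun s => (q s).re • φ s) m :=
    hre.smul_bdd K hφ.aestronglyMeasurable (Eventually.of_forall hK)
  have i2 : Integrable (fun s => (q s).im • (Complex.I • φ s)) m :=
    him.smul_bdd K (hφ.const_smul _).aestronglyMeasurable
      (Eventually.of_forall fun s => by rw [norm_smul]; simpa using hK s)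
  have e5 : ∀ s, q s • φ s = (q s).re • φ s + (q s).im • (Complex.I • φ s) := by
    intro s
    conv_lhs => rw [← Complex.re_add_im (q s), add_smul, mul_smul]
    simp only [Complex.coe_smul]
  simp only [e5]
  rw [integral_add i1 i2, e4, add_zero, e1]
  change ∫ s, φ s ∂a - ∫ s, φ s ∂a' = _
  rw [sub_eq_sub_iff_add_eq_add, e3, add_comm]

lemma IsLaplaceDiff.hpCalc_eq {f : ℝ → ℝ} {μ ν : Measure ℝ≥0}
    (h : IsLaplaceDiff f μ ν) {T : ℝ≥0 → X →L[ℂ] X} {K : ℝ} (hK : ∀ s, ‖T s‖ ≤ K)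
    (hT : ∀ x, Continuous fun s => T s x) (x : X) :
    hpCalc T (fun z => (f z : ℂ)) x = ∫ s, T s x ∂μ - ∫ s, T s x ∂ν := by
  have hex : ∃ p, IsLaplaceRep (fun z => (f z : ℂ)) p := ⟨_, h.isLaplaceRep⟩
  rw [hpCalc, dif_pos hex]
  exact h.integral_eq_of_isLaplaceRep (Classical.choose_spec hex) (hT x) (K := K * ‖x‖)
    fun s => (T s).le_of_opNorm_le (hK s) x

end Calculus

/-! ### Completely monotone functions: examples -/

lemma IsCM.mul {f g : ℝ → ℝ} (hf : IsCM f) (hg : IsCM g) : IsCM (fun z => f z * g z) := by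
  refine ⟨hf.1.mul hg.1, fun n z hz => ?_⟩
  have h := iteratedDeriv_mul (hf.contDiffAt hz n) (hg.contDiffAt hz n)
  change 0 ≤ _ * iteratedDeriv n (f * g) z
  rw [h, Finset.mul_sum]
  refine Finset.sum_nonneg fun i hi => ?_
  have hin : i ≤ n := Nat.lt_succ_iff.1 (Finset.mem_range.1 hi)
  have : (-1 : ℝ) ^ n = (-1) ^ i * (-1) ^ (n - i) := by rw [← pow_add, Nat.add_sub_cancel' hin]
  rw [this]
  have := mul_nonneg (mul_nonneg (hf.2 i z hz) (hg.2 (n - i) z hz)) (Nat.cast_nonneg (α := ℝ) (n.choose i))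
  calc (0 : ℝ) ≤ _ := this
    _ = _ := by ring

lemma IsCM.const_mul {f : ℝ → ℝ} (hf : IsCM f) {c : ℝ} (hc : 0 ≤ c) : IsCM (fun z => c * f z) := by
  refine ⟨contDiffOn_const.mul hf.1, fun n z hz => ?_⟩
  rw [iteratedDeriv_const_mul_field]
  have := mul_nonneg hc (hf.2 n z hz)
  linarith

lemma isCM_rpow {c p : ℝ} (hc : 0 ≤ c) (hp : p < 0) : IsCM (fun z => (c + z) ^ p) := by
  refine ⟨fun z hz => ?_, fun n z hz => ?_⟩
  · refine ContDiffAt.contDiffWithinAt (ContDiffAt.comp z (Real.contDiffAt_rpow_const_of_ne ?_)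
      (by fun_prop))
    exact (add_pos_of_nonneg_of_pos hc hz).ne'
  · rw [iteratedDeriv_comp_const_add (f := fun z : ℝ => z ^ p), iteratedDeriv_eq_iterate]
    have hz' : 0 < c + z := add_pos_of_nonneg_of_pos hc hz
    simp only [Real.iter_deriv_rpow_const]
    rw [← mul_assoc, ← ascPochhammer_eval_neg_eq_descPochhammer]
    exact mul_nonneg (ascPochhammer_pos n _ (neg_pos.2 hp)).le (Real.rpow_nonneg hz'.le _)

lemma IsCM.of_hasDerivAt {f φ : ℝ → ℝ} (hφ : IsCM φ) (hf : ∀ z, 0 < z → HasDerivAt f (-φ z) z)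
    (h0 : ∀ z, 0 < z → 0 ≤ f z) : IsCM f := by
  have hd : EqOn (deriv f) (fun z => -φ z) (Ioi 0) := fun z hz => (hf z hz).deriv
  refine ⟨(contDiffOn_infty_iff_deriv_of_isOpen isOpen_Ioi).2
    ⟨fun z hz => (hf z hz).differentiableAt.differentiableWithinAt, hφ.1.neg.congr hd⟩,
    fun n z hz => ?_⟩
  rcases n with _ | n
  · simpa using h0 z hz
  · rw [iteratedDeriv_succ', hd.iteratedDeriv_of_isOpen isOpen_Ioi n hz, iteratedDeriv_fun_neg]
    have := hφ.2 n z hz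
    rw [pow_succ]
    linarith

lemma isCM_one_sub_rpow {β : ℝ} (h0 : 0 < β) (h1 : β < 1) :
    IsCM (fun z => 1 - (1 + z) ^ (-β) * z ^ β) := by
  have hφ : IsCM (fun z => β * ((0 + z) ^ (β - 1) * (1 + z) ^ (-β - 1))) :=
    ((isCM_rpow le_rfl (by linarith)).mul (isCM_rpow zero_le_one (by linarith))).const_mul h0.le
  refine hφ.of_hasDerivAt (fun z hz => ?_) (fun z hz => ?_)
  · have hz1 : 0 < 1 + z := by linarith
    have e1 : HasDerivAt (fun z : ℝ => (1 + z) ^ (-β)) ((-β) * (1 + z) ^ (-β - 1)) z := by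
      simpa using ((hasDerivAt_id z).const_add 1).rpow_const (p := -β) (Or.inl hz1.ne')
    have e2 : HasDerivAt (fun z : ℝ => z ^ β) (β * z ^ (β - 1)) z :=
      Real.hasDerivAt_rpow_const (Or.inl hz.ne')
    refine ((e1.mul e2).const_sub 1).congr_deriv ?_
    have r1 : (1 + z) ^ (-β) = (1 + z) ^ (-β - 1) * (1 + z) := by
      rw [← Real.rpow_add_one hz1.ne']; congr 1; ring
    have r2 : z ^ β = z ^ (β - 1) * z := by
      rw [← Real.rpow_add_one hz.ne']; congr 1; ring
    rw [r1, r2]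
    ring_nf
  · have hz1 : 0 < 1 + z := by linarith
    rw [Real.rpow_neg hz1.le, inv_mul_eq_div, ← Real.div_rpow hz.le hz1.le, sub_nonneg]
    exact Real.rpow_le_one (by positivity) ((div_le_one hz1).2 (by linarith)) h0.le

/-! ### Algebra of Laplace transforms -/

lemma laplace_add (μ ν : Measure ℝ≥0) [IsFiniteMeasure μ] [IsFiniteMeasure ν] {z : ℝ} (hz : 0 ≤ z) :
    laplace (μ + ν) z = laplace μ z + laplace ν z :=
  integral_add_measure (integrable_exp_neg_mul μ hz) (integrable_exp_neg_mul ν hz)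

lemma integral_conv_eq {E : Type*} [NormedAddCommGroup E] [NormedSpace ℝ E] (μ ν : Measure ℝ≥0)
    [IsFiniteMeasure μ] [IsFiniteMeasure ν] {φ : ℝ≥0 → E} (hφ : Continuous φ) {K : ℝ}
    (hK : ∀ s, ‖φ s‖ ≤ K) :
    ∫ s, φ s ∂(Measure.conv μ ν) = ∫ s, ∫ t, φ (s + t) ∂ν ∂μ := by
  rw [Measure.conv, integral_map (by fun_prop) hφ.aestronglyMeasurable, integral_prod]
  exact Integrable.of_bound (hφ.comp continuous_add).aestronglyMeasurable K
    (Eventually.of_forall fun _ => hK _)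

lemma laplace_conv (μ ν : Measure ℝ≥0) [IsFiniteMeasure μ] [IsFiniteMeasure ν] {z : ℝ}
    (hz : 0 ≤ z) : laplace (Measure.conv μ ν) z = laplace μ z * laplace ν z := by
  rw [laplace, integral_conv_eq μ ν (by fun_prop) (norm_exp_neg_mul_le hz), laplace, laplace,
    ← integral_mul_const]
  refine integral_congr_ae (Eventually.of_forall fun s => ?_)
  simp only
  rw [← integral_const_mul]
  refine integral_congr_ae (Eventually.of_forall fun t => ?_)
  simp only
  rw [← Real.exp_add]
  congr 1
  push_cast
  ring

lemma IsLaplaceDiff.mul {f g : ℝ → ℝ} {μ ν μ' ν' : Measure ℝ≥0} (hf : IsLaplaceDiff f μ ν)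
    (hg : IsLaplaceDiff g μ' ν') : IsLaplaceDiff (fun z => f z * g z)
      (Measure.conv μ μ' + Measure.conv ν ν') (Measure.conv μ ν' + Measure.conv ν μ') := by
  have := hf.finite_left
  have := hf.finite_right
  have := hg.finite_left
  have := hg.finite_right
  refine ⟨inferInstance, inferInstance, fun z hz => ?_⟩
  rw [laplace_add _ _ hz.le, laplace_add _ _ hz.le, laplace_conv _ _ hz.le, laplace_conv _ _ hz.le,
    laplace_conv _ _ hz.le, laplace_conv _ _ hz.le, hf.eq z hz, hg.eq z hz]
  ring

lemma integral_map_mul_left {E : Type*} [NormedAddCommGroup E] [NormedSpace ℝ E] (μ : Measure ℝ≥0)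
    (t : ℝ≥0) {φ : ℝ≥0 → E} (hφ : Continuous φ) :
    ∫ s, φ s ∂(μ.map (fun s => t * s)) = ∫ s, φ (t * s) ∂μ :=
  integral_map (by fun_prop) hφ.aestronglyMeasurable

lemma laplace_map_mul_left (μ : Measure ℝ≥0) (t : ℝ≥0) (z : ℝ) :
    laplace (μ.map (fun s => t * s)) z = laplace μ (t * z) := by
  rw [laplace, integral_map_mul_left μ t (by fun_prop), laplace]
  refine integral_congr_ae (Eventually.of_forall fun s => ?_)
  simp only [NNReal.coe_mul]
  congr 1
  ring

lemma IsLaplaceDiff.scale {f : ℝ → ℝ} {μ ν : Measure ℝ≥0} (h : IsLaplaceDiff f μ ν) {t : ℝ≥0}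
    (ht : 0 < t) : IsLaplaceDiff (fun z => f (t * z)) (μ.map (fun s => t * s))
      (ν.map (fun s => t * s)) := by
  have := h.finite_left
  have := h.finite_right
  refine ⟨inferInstance, inferInstance, fun z hz => ?_⟩
  rw [laplace_map_mul_left, laplace_map_mul_left]
  exact h.eq _ (mul_pos (by exact_mod_cast ht) hz)

lemma IsLaplaceDiff.congr {f g : ℝ → ℝ} {μ ν : Measure ℝ≥0} (h : IsLaplaceDiff f μ ν)
    (hfg : ∀ z, 0 < z → f z = g z) : IsLaplaceDiff g μ ν :=
  ⟨h.finite_left, h.finite_right, fun z hz => (hfg z hz).symm.trans (h.eq z hz)⟩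

/-! ### The operators of the Hille-Phillips calculus -/

section Calculus

variable {X : Type*} [NormedAddCommGroup X] [NormedSpace ℂ X]

/-- `T` is a bounded `C₀`-semigroup with bound `K`. -/
structure IsBoundedC0Semigroup (T : ℝ≥0 → X →L[ℂ] X) (K : ℝ) : Prop extends IsC0Semigroup T where
  norm_le : ∀ s, ‖T s‖ ≤ K

variable {T : ℝ≥0 → X →L[ℂ] X} {K : ℝ}

lemma IsBoundedC0Semigroup.nonneg (hT : IsBoundedC0Semigroup T K) : 0 ≤ K :=
  (norm_nonneg _).trans (hT.norm_le 0)

lemma IsBoundedC0Semigroup.norm_apply_le (hT : IsBoundedC0Semigroup T K) (x : X) (s : ℝ≥0) :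
    ‖T s x‖ ≤ K * ‖x‖ := (T s).le_of_opNorm_le (hT.norm_le s) x

lemma IsBoundedC0Semigroup.integrable (hT : IsBoundedC0Semigroup T K) (x : X) (μ : Measure ℝ≥0)
    [IsFiniteMeasure μ] : Integrable (fun s => T s x) μ :=
  integrable_of_continuous_of_bound μ (hT.strong_cont x) (hT.norm_apply_le x)

lemma IsBoundedC0Semigroup.scale (hT : IsBoundedC0Semigroup T K) (t : ℝ≥0) :
    IsBoundedC0Semigroup (scaleSemigroup T t) K where
  map_zero := by simp [scaleSemigroup, hT.map_zero]
  map_add s r := by simp [scaleSemigroup, mul_add, hT.map_add]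
  strong_cont x := (hT.strong_cont x).comp (continuous_const.mul continuous_id)
  norm_le s := hT.norm_le _

lemma IsBoundedC0Semigroup.commute (hT : IsBoundedC0Semigroup T K) (s t : ℝ≥0) :
    Commute (T s) (T t) := by
  rw [Commute, SemiconjBy, ← hT.map_add, ← hT.map_add, add_comm]

/-- `P = f(A)` in the Hille-Phillips calculus of `T`, for `f` the Laplace transform of a real
measure. -/
def IsCalc (T : ℝ≥0 → X →L[ℂ] X) (f : ℝ → ℝ) (P : X →L[ℂ] X) : Prop :=
  ∃ μ ν : Measure ℝ≥0, IsLaplaceDiff f μ ν ∧ ∀ x, P x = ∫ s, T s x ∂μ - ∫ s, T s x ∂ν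

lemma IsCalc.congr {f g : ℝ → ℝ} {P : X →L[ℂ] X} (h : IsCalc T f P)
    (hfg : ∀ z, 0 < z → f z = g z) : IsCalc T g P := by
  obtain ⟨μ, ν, h, hP⟩ := h
  exact ⟨μ, ν, h.congr hfg, hP⟩

lemma IsCalc.hpCalc_eq (hT : IsBoundedC0Semigroup T K) {f : ℝ → ℝ} {P : X →L[ℂ] X}
    (h : IsCalc T f P) (x : X) : hpCalc T (fun z => (f z : ℂ)) x = P x := by
  obtain ⟨μ, ν, h, hP⟩ := h
  rw [hP, h.hpCalc_eq hT.norm_le hT.strong_cont]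

lemma IsCalc.unique (hT : IsBoundedC0Semigroup T K) {f : ℝ → ℝ} {P Q : X →L[ℂ] X}
    (hP : IsCalc T f P) (hQ : IsCalc T f Q) : P = Q := by
  ext x
  rw [← hP.hpCalc_eq hT, ← hQ.hpCalc_eq hT]

lemma IsLaplaceDiff.exists_isCalc (hT : IsBoundedC0Semigroup T K) {f : ℝ → ℝ} {μ ν : Measure ℝ≥0}
    (h : IsLaplaceDiff f μ ν) :
    ∃ P : X →L[ℂ] X, IsCalc T f P ∧ ‖P‖ ≤ K * (μ.real univ + ν.real univ) := by
  have := h.finite_left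
  have := h.finite_right
  let P : X →ₗ[ℂ] X :=
    { toFun := fun x => ∫ s, T s x ∂μ - ∫ s, T s x ∂ν
      map_add' := fun x y => by
        simp only [map_add]
        rw [integral_add (hT.integrable x μ) (hT.integrable y μ),
          integral_add (hT.integrable x ν) (hT.integrable y ν)]
        abel
      map_smul' := fun c x => by
        simp only [map_smul, RingHom.id_apply]
        rw [integral_smul, integral_smul, smul_sub] }
  have hP : ∀ x, ‖P x‖ ≤ K * (μ.real univ + ν.real univ) * ‖x‖ := by
    intro x
    have h1 : ∀ (m : Measure ℝ≥0) [IsFiniteMeasure m], ‖∫ s, T s x ∂m‖ ≤ K * ‖x‖ * m.real univ :=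
      fun m _ => norm_integral_le_of_norm_le_const (Eventually.of_forall (hT.norm_apply_le x))
    calc ‖P x‖ ≤ ‖∫ s, T s x ∂μ‖ + ‖∫ s, T s x ∂ν‖ := norm_sub_le _ _
      _ ≤ _ := by linarith [h1 μ, h1 ν]
  refine ⟨P.mkContinuous _ hP, ⟨μ, ν, h, fun x => rfl⟩, ?_⟩
  exact LinearMap.mkContinuous_norm_le _
    (mul_nonneg hT.nonneg (add_nonneg measureReal_nonneg measureReal_nonneg)) _

lemma IsCalc.commute (hT : IsBoundedC0Semigroup T K) [CompleteSpace X] {f : ℝ → ℝ} {P B : X →L[ℂ] X}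
    (h : IsCalc T f P) (hB : ∀ s, Commute (T s) B) : Commute P B := by
  obtain ⟨μ, ν, h, hP⟩ := h
  have := h.finite_left
  have := h.finite_right
  ext x
  have hB' : ∀ s, T s (B x) = B (T s x) := fun s => DFunLike.congr_fun (hB s).eq x
  simp only [mul_apply_eq_comp, hP, hB', map_sub]
  rw [B.integral_comp_comm (hT.integrable x μ), B.integral_comp_comm (hT.integrable x ν)]

lemma IsCalc.mul (hT : IsBoundedC0Semigroup T K) [CompleteSpace X] {f g : ℝ → ℝ}
    {P Q : X →L[ℂ] X} (hP : IsCalc T f P) (hQ : IsCalc T g Q) :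
    IsCalc T (fun z => f z * g z) (P * Q) := by
  obtain ⟨μ, ν, h, hP⟩ := hP
  obtain ⟨μ', ν', h', hQ⟩ := hQ
  refine ⟨_, _, h.mul h', fun x => ?_⟩
  have := h.finite_left
  have := h.finite_right
  have := h'.finite_left
  have := h'.finite_right
  have hc : ∀ (m m' : Measure ℝ≥0) [IsFiniteMeasure m] [IsFiniteMeasure m'],
      ∫ s, T s x ∂(Measure.conv m m') = ∫ s, T s (∫ t, T t x ∂m') ∂m := by
    intro m m' _ _
    rw [integral_conv_eq m m' (hT.strong_cont x) (hT.norm_apply_le x)]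
    refine integral_congr_ae (Eventually.of_forall fun s => ?_)
    simp only [hT.map_add, mul_apply_eq_comp]
    exact (T s).integral_comp_comm (hT.integrable x m')
  rw [integral_add_measure (hT.integrable x _) (hT.integrable x _),
    integral_add_measure (hT.integrable x _) (hT.integrable x _), hc, hc, hc, hc,
    mul_apply_eq_comp, hP, hQ]
  simp only [map_sub]
  rw [integral_sub (hT.integrable _ _) (hT.integrable _ _),
    integral_sub (hT.integrable _ _) (hT.integrable _ _)]
  abel

lemma IsCalc.of_scale (hT : IsBoundedC0Semigroup T K) {f : ℝ → ℝ} {P : X →L[ℂ] X} {t : ℝ≥0}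
    (ht : 0 < t) (h : IsCalc (scaleSemigroup T t) f P) : IsCalc T (fun z => f (t * z)) P := by
  obtain ⟨μ, ν, h, hP⟩ := h
  refine ⟨_, _, h.scale ht, fun x => ?_⟩
  rw [integral_map_mul_left μ t (hT.strong_cont x), integral_map_mul_left ν t (hT.strong_cont x), hP]
  rfl

lemma IsCalc.const_mul {f : ℝ → ℝ} {P : X →L[ℂ] X} (h : IsCalc T f P) (c : ℝ≥0) :
    IsCalc T (fun z => c * f z) ((c : ℂ) • P) := by
  obtain ⟨μ, ν, h, hP⟩ := h
  have := h.finite_left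
  have := h.finite_right
  refine ⟨c • μ, c • ν, ⟨inferInstance, inferInstance, fun z hz => ?_⟩, fun x => ?_⟩
  · simp only [laplace, h.eq z hz, integral_smul_nnreal_measure, NNReal.smul_def, smul_eq_mul]
    ring
  · simp only [integral_smul_nnreal_measure, hP, smul_apply, smul_sub,
      NNReal.smul_def, Complex.coe_smul]

lemma isLaplaceDiff_one : IsLaplaceDiff (fun _ => 1) (Measure.dirac 0) 0 :=
  ⟨inferInstance, inferInstance, fun z _ => by simp [laplace]⟩

lemma IsCalc.one_sub (hT : IsBoundedC0Semigroup T K) [CompleteSpace X] {f : ℝ → ℝ} {P : X →L[ℂ] X}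
    (h : IsCalc T f P) : IsCalc T (fun z => 1 - f z) (1 - P) := by
  obtain ⟨μ, ν, h, hP⟩ := h
  have := h.finite_left
  have := h.finite_right
  refine ⟨Measure.dirac 0 + ν, μ, ⟨inferInstance, inferInstance, fun z hz => ?_⟩, fun x => ?_⟩
  · rw [laplace_add _ _ hz.le, h.eq z hz]
    simp [laplace]
    ring
  · rw [integral_add_measure (hT.integrable x _) (hT.integrable x _)]
    simp [hP, hT.map_zero]
    abel

/-! ### The regularized fractional powers -/

/-- `e_β(z) = (1 + z)^{-β}`. -/
def regFun (β z : ℝ) : ℝ := (1 + z) ^ (-β)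

/-- `h_β(z) = (1 + z)^{-β} z^β`. -/
def regPowFun (β z : ℝ) : ℝ := (1 + z) ^ (-β) * z ^ β

lemma regFun_add {β γ z : ℝ} (hz : 0 < z) : regFun β z * regFun γ z = regFun (β + γ) z := by
  rw [regFun, regFun, regFun, ← Real.rpow_add (by linarith)]; congr 1; ring

lemma regPowFun_add {β γ z : ℝ} (hz : 0 < z) :
    regPowFun β z * regPowFun γ z = regPowFun (β + γ) z := by
  have h := regFun_add (β := β) (γ := γ) hz
  rw [regFun, regFun, regFun] at h
  rw [regPowFun, regPowFun, regPowFun, ← h, Real.rpow_add hz]; ring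

lemma regFun_mul_regPowFun {β z : ℝ} {t : ℝ≥0} (hz : 0 < z) :
    regFun β z * regPowFun β (t * z) = ((t : ℝ) ^ β) * (regPowFun β z * regFun β (t * z)) := by
  simp only [regFun, regPowFun]
  rw [Real.mul_rpow t.coe_nonneg hz.le]; ring

lemma exists_isLaplaceDiff_regFun {β : ℝ} (hβ : 0 ≤ β) : ∃ μ ν, IsLaplaceDiff (regFun β) μ ν := by
  rcases hβ.eq_or_lt with rfl | hβ
  · exact ⟨_, _, isLaplaceDiff_one.congr fun z _ => by simp [regFun]⟩
  have hlim : Tendsto (regFun β) (𝓝[>] 0) (𝓝 1) := by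
    have : ContinuousAt (regFun β) 0 :=
      ContinuousAt.rpow_const (by fun_prop) (Or.inl (by norm_num))
    simpa [regFun] using this.tendsto.mono_left nhdsWithin_le_nhds
  obtain ⟨ν, hν, h⟩ := IsCM.exists_laplace (isCM_rpow zero_le_one (neg_lt_zero.2 hβ)) hlim
  exact ⟨ν, 0, inferInstance, inferInstance, fun z hz => by
    simpa [laplace, regFun] using h z hz⟩

lemma exists_isLaplaceDiff_regPowFun_aux {β : ℝ} (h0 : 0 ≤ β) (h1 : β < 1) :
    ∃ μ ν, IsLaplaceDiff (regPowFun β) μ ν := by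
  rcases h0.eq_or_lt with rfl | h0
  · exact ⟨_, _, isLaplaceDiff_one.congr fun z _ => by simp [regPowFun]⟩
  have hlim : Tendsto (fun z => 1 - (1 + z) ^ (-β) * z ^ β) (𝓝[>] (0 : ℝ)) (𝓝 1) := by
    have : ContinuousAt (fun z : ℝ => 1 - (1 + z) ^ (-β) * z ^ β) 0 :=
      continuousAt_const.sub ((ContinuousAt.rpow_const (by fun_prop) (Or.inl (by norm_num))).mul
        (ContinuousAt.rpow_const (by fun_prop) (Or.inr h0.le)))
    simpa [Real.zero_rpow h0.ne'] using this.tendsto.mono_left nhdsWithin_le_nhds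
  obtain ⟨ν, hν, h⟩ := IsCM.exists_laplace (isCM_one_sub_rpow h0 h1) hlim
  refine ⟨Measure.dirac 0, ν, inferInstance, inferInstance, fun z hz => ?_⟩
  have := h z hz
  simp only [laplace, regPowFun, integral_dirac, NNReal.coe_zero, mul_zero, neg_zero, Real.exp_zero]
  linarith

lemma regPowFun_one {z : ℝ} (hz : 0 < z) : regPowFun 1 z = 1 - regFun 1 z := by
  have : (1 + z) ≠ 0 := by linarith
  rw [regPowFun, regFun, Real.rpow_neg_one, Real.rpow_one]
  field_simp
  ring

lemma exists_isLaplaceDiff_regPowFun {β : ℝ} (h0 : 0 ≤ β) (h2 : β ≤ 2) :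
    ∃ μ ν, IsLaplaceDiff (regPowFun β) μ ν := by
  have h1 : ∃ μ ν, IsLaplaceDiff (regPowFun 1) μ ν := by
    obtain ⟨μ, ν, h⟩ := exists_isLaplaceDiff_regFun zero_le_one
    have := h.finite_left
    have := h.finite_right
    refine ⟨Measure.dirac 0 + ν, μ, inferInstance, inferInstance, fun z hz => ?_⟩
    rw [laplace_add _ _ hz.le, regPowFun_one hz, h.eq z hz]
    simp [laplace]
    ring
  have hadd : ∀ {β γ : ℝ}, (∃ μ ν, IsLaplaceDiff (regPowFun β) μ ν) →
      (∃ μ ν, IsLaplaceDiff (regPowFun γ) μ ν) → ∃ μ ν, IsLaplaceDiff (regPowFun (β + γ)) μ ν := by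
    rintro β γ ⟨_, _, h⟩ ⟨_, _, h'⟩
    exact ⟨_, _, (h.mul h').congr fun z hz => regPowFun_add hz⟩
  rcases lt_or_ge β 1 with h | h
  · exact exists_isLaplaceDiff_regPowFun_aux h0 h
  rcases h2.lt_or_eq with h' | rfl
  · have := hadd (exists_isLaplaceDiff_regPowFun_aux (by linarith : 0 ≤ β - 1) (by linarith)) h1
    rwa [sub_add_cancel] at this
  · have := hadd h1 h1
    norm_num at this
    exact this

end Calculus

/-! ### Differentiable bounded semigroups -/

section Analytic

variable {X : Type*} [NormedAddCommGroup X] [NormedSpace ℂ X]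

/-- `T` is a bounded semigroup, twice differentiable on `(0, ∞)` in operator norm with derivatives
`D₁` and `D₂` of order `1 / r` and `1 / r²`. -/
structure IsAnalyticSemigroup (T : ℝ≥0 → X →L[ℂ] X) (K : ℝ) (D₁ D₂ : ℝ → X →L[ℂ] X) : Prop
    extends IsBoundedC0Semigroup T K where
  hasDerivAt₁ : ∀ r : ℝ, 0 < r → HasDerivAt (fun s : ℝ => T s.toNNReal) (D₁ r) r
  hasDerivAt₂ : ∀ r : ℝ, 0 < r → HasDerivAt D₁ (D₂ r) r
  norm_le₁ : ∀ r : ℝ, 0 < r → ‖D₁ r‖ ≤ K / r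
  norm_le₂ : ∀ r : ℝ, 0 < r → ‖D₂ r‖ ≤ K / r ^ 2

variable {T : ℝ≥0 → X →L[ℂ] X} {K : ℝ} {D₁ D₂ : ℝ → X →L[ℂ] X}

lemma exists_ball_arg_lt {ξ : ℝ} (hξ : 0 < ξ) :
    ∃ ρ : ℝ, 0 < ρ ∧ ∀ (r : ℝ) (z : ℂ), 0 < r → ‖z - r‖ < ρ * r → z ∈ openSector ξ := by
  have hc : ContinuousAt (fun z : ℂ => |z.arg|) 1 :=
    (Complex.continuousAt_arg (by simp)).abs
  have h1 : ∀ᶠ z : ℂ in 𝓝 1, |z.arg| < ξ := by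
    exact hc.eventually_lt continuousAt_const (by simpa using hξ)
  have h2 : ∀ᶠ z : ℂ in 𝓝 1, z ≠ 0 := isOpen_ne.mem_nhds one_ne_zero
  obtain ⟨ρ, hρ, hball⟩ := Metric.eventually_nhds_iff.1 (h1.and h2)
  refine ⟨ρ, hρ, fun r z hr hz => ?_⟩
  have hr0 : (r : ℂ) ≠ 0 := Complex.ofReal_ne_zero.2 hr.ne'
  have hz' : z = r * (z / r) := by field_simp
  have h := @hball (z / r) (by
    rw [dist_eq_norm, div_sub_one hr0, norm_div, Complex.norm_real, Real.norm_of_nonneg hr.le,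
      div_lt_iff₀ hr]
    exact hz)
  refine ⟨fun h0 => h.2 (by simp [h0]), ?_⟩
  rw [hz', Complex.arg_real_mul _ hr]
  exact h.1

lemma exists_isAnalyticSemigroup [CompleteSpace X] (hT : IsC0Semigroup T)
    (h : HasSectoriallyBoundedExtension T) : ∃ K D₁ D₂, IsAnalyticSemigroup T K D₁ D₂ := by
  obtain ⟨θ, hθ, -, S, hST, hS, hbd⟩ := h
  obtain ⟨⟨C, hC⟩, -⟩ := hbd (θ / 2) (by linarith) (by linarith)
  obtain ⟨ρ, hρ, hball⟩ := exists_ball_arg_lt (half_pos hθ)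
  have hC' : ∀ (r : ℝ) (z : ℂ), 0 < r → z ∈ Metric.ball (r : ℂ) (ρ * r) → ‖S z‖ ≤ C :=
    fun r z hr hz => hC z (subset_closure (hball r z hr (by rwa [Metric.mem_ball, dist_eq_norm] at hz)))
  have hd : ∀ r : ℝ, 0 < r → DifferentiableOn ℂ S (Metric.ball (r : ℂ) (ρ * r)) := by
    refine fun r hr => hS.mono fun z hz => ?_
    obtain ⟨h0, h1⟩ := hball r z hr (by rwa [Metric.mem_ball, dist_eq_norm] at hz)
    exact ⟨h0, h1.trans (by linarith)⟩
  have hmem : ∀ r : ℝ, 0 < r → Metric.ball (r : ℂ) (ρ * r) ∈ 𝓝 (r : ℂ) :=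
    fun r hr => Metric.ball_mem_nhds _ (by positivity)
  have hC0 : 0 ≤ C := (norm_nonneg _).trans (hC' 1 1 one_pos (by simpa using hρ))
  -- Cauchy estimate on a disc of radius `ρ r / 4`
  have cauchy : ∀ (F : ℂ → X →L[ℂ] X) (z : ℂ) (δ B : ℝ), 0 < δ →
      DifferentiableOn ℂ F (Metric.ball z (2 * δ)) → (∀ w ∈ Metric.ball z (2 * δ), ‖F w‖ ≤ B) →
      ‖deriv F z‖ ≤ B / δ := by
    intro F z δ B hδ hF hB
    have hsub : Metric.closedBall z δ ⊆ Metric.ball z (2 * δ) :=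
      Metric.closedBall_subset_ball (by linarith)
    refine Complex.norm_deriv_le_of_forall_mem_sphere_norm_le hδ ?_
      fun w hw => hB w (hsub (Metric.sphere_subset_closedBall hw))
    exact DifferentiableOn.diffContOnCl (hF.mono (Metric.closure_ball_subset_closedBall.trans hsub))
  have hS1 : ∀ r : ℝ, 0 < r → ∀ z ∈ Metric.ball (r : ℂ) (ρ * r / 2),
      ‖deriv S z‖ ≤ C / (ρ * r / 4) := by
    intro r hr z hz
    have hsub : Metric.ball z (2 * (ρ * r / 4)) ⊆ Metric.ball (r : ℂ) (ρ * r) := by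
      refine Metric.ball_subset_ball' ?_
      have := Metric.mem_ball.1 hz
      linarith
    exact cauchy S z _ _ (by positivity) ((hd r hr).mono hsub) fun w hw => hC' r w hr (hsub hw)
  have hS2 : ∀ r : ℝ, 0 < r → ‖deriv (deriv S) r‖ ≤ C / (ρ * r / 4) / (ρ * r / 4) := by
    intro r hr
    have hsub : Metric.ball (r : ℂ) (2 * (ρ * r / 4)) ⊆ Metric.ball (r : ℂ) (ρ * r / 2) :=
      Metric.ball_subset_ball (by linarith)
    refine cauchy (deriv S) r _ _ (by positivity) ?_ fun w hw => hS1 r hr w (hsub hw)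
    refine ((hd r hr).deriv Metric.isOpen_ball).mono (hsub.trans (Metric.ball_subset_ball ?_))
    have : 0 < ρ * r := by positivity
    linarith
  have hreal : ∀ (F : ℂ → X →L[ℂ] X) (F' : X →L[ℂ] X) (r : ℝ), HasDerivAt F F' (r : ℂ) →
      HasDerivAt (fun s : ℝ => F s) F' r := by
    intro F F' r hF
    have h1 : HasDerivAt (fun s : ℝ => (s : ℂ)) 1 r := Complex.ofRealCLM.hasDerivAt
    have h2 := hF.scomp r h1
    rw [one_smul] at h2
    exact h2
  have hTS : ∀ r : ℝ, 0 ≤ r → T r.toNNReal = S r := by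
    intro r hr
    rw [← hST, Real.coe_toNNReal _ hr]
  set K := max (max C 1) (max (C * 4 / ρ) (C * 16 / ρ ^ 2)) with hK
  have hK1 : C * 4 / ρ ≤ K := (le_max_left _ _).trans (le_max_right _ _)
  have hK2 : C * 16 / ρ ^ 2 ≤ K := (le_max_right _ _).trans (le_max_right _ _)
  refine ⟨K, fun r => deriv S r, fun r => deriv (deriv S) r, ⟨⟨hT, fun s => ?_⟩, fun r hr => ?_,
    fun r hr => ?_, fun r hr => ?_, fun r hr => ?_⟩⟩
  · rcases eq_or_ne s 0 with rfl | hs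
    · rw [hT.map_zero]
      exact ContinuousLinearMap.norm_id_le.trans ((le_max_right C 1).trans (le_max_left _ _))
    · have hs' : (0 : ℝ) < s := by exact_mod_cast pos_iff_ne_zero.2 hs
      rw [← hST]
      exact (hC' s s hs' (Metric.mem_ball_self (by positivity))).trans
        ((le_max_left C 1).trans (le_max_left _ _))
  · have h1 : HasDerivAt S (deriv S r) (r : ℂ) := ((hd r hr).differentiableAt (hmem r hr)).hasDerivAt
    refine (hreal S _ r h1).congr_of_eventuallyEq ?_
    filter_upwards [lt_mem_nhds hr] with s hs using hTS s hs.le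
  · exact hreal _ _ r (((hd r hr).deriv Metric.isOpen_ball).differentiableAt
      (hmem r hr)).hasDerivAt
  · refine (hS1 r hr r (Metric.mem_ball_self (by positivity))).trans ?_
    calc C / (ρ * r / 4) = C * 4 / ρ / r := by field_simp
      _ ≤ K / r := by gcongr
  · refine (hS2 r hr).trans ?_
    calc C / (ρ * r / 4) / (ρ * r / 4) = C * 16 / ρ ^ 2 / r ^ 2 := by field_simp; norm_num
      _ ≤ K / r ^ 2 := by gcongr

namespace IsAnalyticSemigroup

lemma scale (hT : IsAnalyticSemigroup T K D₁ D₂) {t : ℝ≥0} (ht : 0 < t) :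
    IsAnalyticSemigroup (scaleSemigroup T t) K (fun r => (t : ℝ) • D₁ (t * r))
      (fun r => (t : ℝ) ^ 2 • D₂ (t * r)) := by
  have ht' : (0 : ℝ) < t := ht
  have hl : ∀ r : ℝ, HasDerivAt (fun r : ℝ => (t : ℝ) * r) t r := fun r => by
    simpa using (hasDerivAt_id r).const_mul (t : ℝ)
  refine ⟨hT.toIsBoundedC0Semigroup.scale t, fun r hr => ?_, fun r hr => ?_, fun r hr => ?_,
    fun r hr => ?_⟩
  · refine ((hT.hasDerivAt₁ _ (mul_pos ht' hr)).scomp r (hl r)).congr_of_eventuallyEq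
      (Eventually.of_forall fun s => ?_)
    simp only [scaleSemigroup, Function.comp_apply]
    rw [Real.toNNReal_mul t.coe_nonneg, Real.toNNReal_coe]
  · refine (((hT.hasDerivAt₂ _ (mul_pos ht' hr)).scomp r (hl r)).const_smul (t : ℝ)).congr_deriv ?_
    rw [smul_smul, sq]
  · rw [norm_smul, Real.norm_of_nonneg ht'.le]
    calc (t : ℝ) * ‖D₁ (t * r)‖ ≤ t * (K / (t * r)) := by
          gcongr; exact hT.norm_le₁ _ (mul_pos ht' hr)
      _ = K / r := by field_simp
  · rw [norm_smul, Real.norm_of_nonneg (by positivity)]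
    calc (t : ℝ) ^ 2 * ‖D₂ (t * r)‖ ≤ t ^ 2 * (K / (t * r) ^ 2) := by
          gcongr; exact hT.norm_le₂ _ (mul_pos ht' hr)
      _ = K / r ^ 2 := by field_simp

lemma map_add_toNNReal (hT : IsAnalyticSemigroup T K D₁ D₂) {r : ℝ} (hr : 0 ≤ r) (s : ℝ≥0) :
    T (s + r).toNNReal = T s * T r.toNNReal := by
  rw [Real.toNNReal_add s.coe_nonneg hr, Real.toNNReal_coe, hT.map_add]

lemma D₁_add (hT : IsAnalyticSemigroup T K D₁ D₂) {r : ℝ} (hr : 0 < r) (s : ℝ≥0) :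
    D₁ (s + r) = T s * D₁ r := by
  have h1 := (hT.hasDerivAt₁ (s + r) (add_pos_of_nonneg_of_pos s.coe_nonneg hr)).comp_const_add
    (s : ℝ) r
  have h2 := (hT.hasDerivAt₁ r hr).const_mul (T s)
  refine h1.unique (h2.congr_of_eventuallyEq ?_)
  filter_upwards [lt_mem_nhds hr] with q hq using hT.map_add_toNNReal hq.le s

lemma D₂_add (hT : IsAnalyticSemigroup T K D₁ D₂) {r : ℝ} (hr : 0 < r) (s : ℝ≥0) :
    D₂ (s + r) = T s * D₂ r := by
  have h1 := (hT.hasDerivAt₂ (s + r) (add_pos_of_nonneg_of_pos s.coe_nonneg hr)).comp_const_add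
    (s : ℝ) r
  have h2 := (hT.hasDerivAt₂ r hr).const_mul (T s)
  refine h1.unique (h2.congr_of_eventuallyEq ?_)
  filter_upwards [lt_mem_nhds hr] with q hq using hT.D₁_add hq s

lemma commute_D₁ (hT : IsAnalyticSemigroup T K D₁ D₂) {r : ℝ} (hr : 0 < r) (s : ℝ≥0) :
    Commute (T s) (D₁ r) := by
  have h1 := (hT.hasDerivAt₁ r hr).const_mul (T s)
  have h2 := (hT.hasDerivAt₁ r hr).mul_const (T s)
  exact h1.unique (h2.congr_of_eventuallyEq (Eventually.of_forall fun q => hT.commute s _))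

end IsAnalyticSemigroup

/-! ### The resolvent -/

/-- The measure `e^{-s} ds` on `[0, ∞)`. -/
def expMeasureNN : Measure ℝ≥0 :=
  ((volume.restrict (Ioi (0 : ℝ))).withDensity fun s => ENNReal.ofReal (Real.exp (-s))).map
    Real.toNNReal

lemma integrableOn_exp_neg : IntegrableOn (fun s : ℝ => Real.exp (-s)) (Ioi 0) := by
  simpa using integrableOn_exp_mul_Ioi (a := -1) (by norm_num) 0

instance : IsFiniteMeasure expMeasureNN := by
  have := isFiniteMeasure_withDensity_ofReal (μ := volume.restrict (Ioi (0 : ℝ)))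
    integrableOn_exp_neg.2
  exact Measure.isFiniteMeasure_map _ _

lemma integral_expMeasureNN {E : Type*} [NormedAddCommGroup E] [NormedSpace ℝ E] {φ : ℝ≥0 → E}
    (hφ : Continuous φ) :
    ∫ s, φ s ∂expMeasureNN = ∫ s in Ioi (0 : ℝ), Real.exp (-s) • φ s.toNNReal := by
  rw [expMeasureNN, integral_map (by fun_prop) hφ.aestronglyMeasurable,
    integral_withDensity_eq_integral_toReal_smul (by fun_prop)
      (Eventually.of_forall fun _ => ENNReal.ofReal_lt_top)]
  simp only [ENNReal.toReal_ofReal (Real.exp_pos _).le]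

lemma isLaplaceDiff_expMeasureNN : IsLaplaceDiff (regFun 1) expMeasureNN 0 := by
  refine ⟨inferInstance, inferInstance, fun z hz => ?_⟩
  rw [laplace, integral_expMeasureNN (by fun_prop)]
  have h : ∫ s in Ioi (0 : ℝ), Real.exp (-s) • Real.exp (-(z * (s.toNNReal : ℝ)))
      = ∫ s in Ioi (0 : ℝ), Real.exp (-(1 + z) * s) := by
    refine setIntegral_congr_fun measurableSet_Ioi fun s hs => ?_
    rw [Real.coe_toNNReal _ (le_of_lt hs), smul_eq_mul, ← Real.exp_add]
    congr 1
    ring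
  rw [h, integral_exp_mul_Ioi (by linarith)]
  simp only [laplace, regFun, Real.rpow_neg_one, integral_zero_measure, mul_zero, Real.exp_zero,
    neg_div_neg_eq, one_div, sub_zero]

namespace IsAnalyticSemigroup

lemma resolvent_deriv [CompleteSpace X] (hT : IsAnalyticSemigroup T K D₁ D₂) {R : X →L[ℂ] X}
    (hR : IsCalc T (regFun 1) R) {U U' : ℝ → X →L[ℂ] X}
    (hU : ∀ r, 0 < r → HasDerivAt U (U' r) r) (hadd : ∀ r, 0 < r → ∀ s : ℝ≥0, U (s + r) = T s * U r)
    (hadd' : ∀ r, 0 < r → ∀ s : ℝ≥0, U' (s + r) = T s * U' r) {r : ℝ} (hr : 0 < r) :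
    R * U' r = (R - 1) * U r := by
  have hRx : ∀ x, R x = ∫ s in Ioi (0 : ℝ), Real.exp (-s) • T s.toNNReal x := by
    intro x
    rw [← hR.hpCalc_eq hT.toIsBoundedC0Semigroup,
      isLaplaceDiff_expMeasureNN.hpCalc_eq hT.norm_le hT.strong_cont, integral_zero_measure,
      sub_zero, integral_expMeasureNN (hT.strong_cont x)]
  ext x
  have hcont : ∀ x, Continuous fun s : ℝ => T s.toNNReal x := fun x =>
    (hT.strong_cont x).comp continuous_real_toNNReal
  have hint : ∀ x, IntegrableOn (fun s : ℝ => Real.exp (-s) • T s.toNNReal x) (Ioi 0) := fun x =>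
    integrableOn_exp_neg.smul_bdd (K * ‖x‖) (hcont x).aestronglyMeasurable
      (Eventually.of_forall fun s => hT.norm_apply_le x _)
  have hF : ∀ s ∈ Ioi (0 : ℝ), HasDerivAt (fun s : ℝ => Real.exp (-s) • T s.toNNReal (U r x))
      (Real.exp (-s) • T s.toNNReal (U' r x) - Real.exp (-s) • T s.toNNReal (U r x)) s := by
    intro s hs
    have hs0 : (0 : ℝ) < s := hs
    have h1 : HasDerivAt (fun q => U (q + r) x) (U' (s + r) x) s := by
      have := (hU (s + r) (by linarith)).comp_add_const s r
      exact ((ContinuousLinearMap.apply ℂ X x).restrictScalars ℝ).hasFDerivAt.comp_hasDerivAt s this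
    have h2 : HasDerivAt (fun q : ℝ => T q.toNNReal (U r x)) (T s.toNNReal (U' r x)) s := by
      have e : U' (s + r) x = T s.toNNReal (U' r x) := by
        have := hadd' r hr s.toNNReal
        rw [Real.coe_toNNReal _ hs0.le] at this
        rw [this]; rfl
      rw [← e]
      refine h1.congr_of_eventuallyEq ?_
      filter_upwards [lt_mem_nhds hs0] with q hq
      have := hadd r hr q.toNNReal
      rw [Real.coe_toNNReal _ hq.le] at this
      rw [this]; rfl
    have h3 : HasDerivAt (fun q : ℝ => Real.exp (-q)) (-Real.exp (-s)) s := by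
      simpa using (hasDerivAt_neg s).exp
    refine (h3.smul h2).congr_deriv ?_
    rw [neg_smul, sub_eq_add_neg]
  have hlim : Tendsto (fun s : ℝ => Real.exp (-s) • T s.toNNReal (U r x)) atTop (𝓝 0) := by
    have h0 : Tendsto (fun s : ℝ => Real.exp (-s) * (K * ‖U r x‖)) atTop (𝓝 0) := by
      simpa using (Real.tendsto_exp_neg_atTop_nhds_zero).mul_const (K * ‖U r x‖)
    refine squeeze_zero_norm (fun s => ?_) h0
    rw [norm_smul, Real.norm_of_nonneg (Real.exp_pos _).le]
    exact mul_le_mul_of_nonneg_left (hT.norm_apply_le _ _) (Real.exp_pos _).le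
  have hFcont : Continuous fun s : ℝ => Real.exp (-s) • T s.toNNReal (U r x) :=
    (Real.continuous_exp.comp continuous_neg).smul (hcont (U r x))
  have hmain := integral_Ioi_of_hasDerivAt_of_tendsto hFcont.continuousWithinAt hF
    ((hint (U' r x)).sub (hint (U r x))) hlim
  rw [integral_sub (hint _) (hint _), ← hRx, ← hRx] at hmain
  simp only [neg_zero, Real.exp_zero, Real.toNNReal_zero, hT.map_zero, one_smul, zero_sub,
    one_apply_eq_self] at hmain
  simp only [mul_apply_eq_comp, sub_apply, one_apply_eq_self]
  rw [sub_eq_iff_eq_add] at hmain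
  rw [hmain]
  abel

lemma resolvent_D₁ [CompleteSpace X] (hT : IsAnalyticSemigroup T K D₁ D₂) {R : X →L[ℂ] X}
    (hR : IsCalc T (regFun 1) R) {r : ℝ} (hr : 0 < r) : R * D₁ r = (R - 1) * T r.toNNReal :=
  hT.resolvent_deriv hR hT.hasDerivAt₁ (fun _ hr s => hT.map_add_toNNReal hr.le s)
    (fun _ hr s => hT.D₁_add hr s) hr

lemma resolvent_D₂ [CompleteSpace X] (hT : IsAnalyticSemigroup T K D₁ D₂) {R : X →L[ℂ] X}
    (hR : IsCalc T (regFun 1) R) {r : ℝ} (hr : 0 < r) : R * D₂ r = (R - 1) * D₁ r :=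
  hT.resolvent_deriv hR hT.hasDerivAt₂ (fun _ hr s => hT.D₁_add hr s)
    (fun _ hr s => hT.D₂_add hr s) hr

end IsAnalyticSemigroup

end Analytic

/-! ### Fractional powers -/

section FracPow

variable {X : Type*} [NormedAddCommGroup X] [NormedSpace ℂ X]
variable {T : ℝ≥0 → X →L[ℂ] X} {K : ℝ} {D₁ D₂ : ℝ → X →L[ℂ] X} {β : ℝ}

lemma exists_isCalc_regFun (hT : IsBoundedC0Semigroup T K) (h0 : 0 ≤ β) :
    ∃ P, IsCalc T (regFun β) P := by
  obtain ⟨μ, ν, h⟩ := exists_isLaplaceDiff_regFun h0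
  obtain ⟨P, hP, -⟩ := h.exists_isCalc hT
  exact ⟨P, hP⟩

lemma exists_isCalc_regPowFun (hT : IsBoundedC0Semigroup T K) (h0 : 0 ≤ β) (h2 : β ≤ 2) :
    ∃ P, IsCalc T (regPowFun β) P := by
  obtain ⟨μ, ν, h⟩ := exists_isLaplaceDiff_regPowFun h0 h2
  obtain ⟨P, hP, -⟩ := h.exists_isCalc hT
  exact ⟨P, hP⟩

lemma isFracPow_iff (hT : IsBoundedC0Semigroup T K) {P H : X →L[ℂ] X}
    (hP : IsCalc T (regFun β) P) (hH : IsCalc T (regPowFun β) H) {x y : X} :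
    IsFracPow T β x y ↔ P y = H x := by
  rw [← hP.hpCalc_eq hT, ← hH.hpCalc_eq hT]
  rfl

namespace IsAnalyticSemigroup

lemma isFracPow_smul (hT : IsAnalyticSemigroup T K D₁ D₂) (h0 : 0 ≤ β) (h2 : β ≤ 2) {x y : X}
    (h : IsFracPow T β x y) (c : ℂ) : IsFracPow T β (c • x) (c • y) := by
  have hB := hT.toIsBoundedC0Semigroup
  obtain ⟨P, hP⟩ := exists_isCalc_regFun hB h0
  obtain ⟨H, hH⟩ := exists_isCalc_regPowFun hB h0 h2
  rw [isFracPow_iff hB hP hH] at h ⊢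
  rw [map_smul, map_smul, h]

variable [CompleteSpace X]

lemma resolvent_injective (hT : IsAnalyticSemigroup T K D₁ D₂) {R : X →L[ℂ] X}
    (hR : IsCalc T (regFun 1) R) {x : X} (hx : R x = 0) : x = 0 := by
  have h0 : ∀ r : ℝ≥0, 0 < r → T r x = 0 := by
    intro r hr
    have hr' : (0 : ℝ) < r := hr
    have h1 := DFunLike.congr_fun (hT.resolvent_D₁ hR hr') x
    have h2 := DFunLike.congr_fun (hR.commute hT.toIsBoundedC0Semigroup
      (fun s => hT.commute_D₁ hr' s)).eq x
    have h3 := DFunLike.congr_fun (hR.commute hT.toIsBoundedC0Semigroup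
      (fun s => hT.commute s r)).eq x
    simp only [mul_apply_eq_comp, sub_apply, one_apply_eq_self, Real.toNNReal_coe, hx,
      map_zero] at h1 h2 h3
    rw [h2, h3, zero_sub] at h1
    exact neg_eq_zero.1 h1.symm
  have hlim := ((hT.strong_cont x).tendsto 0).mono_left (nhdsWithin_le_nhds (s := Ioi 0))
  rw [hT.map_zero] at hlim
  exact tendsto_nhds_unique hlim (tendsto_const_nhds.congr'
    (eventually_nhdsWithin_of_forall fun r hr => (h0 r hr).symm))

lemma regFun_two (hT : IsAnalyticSemigroup T K D₁ D₂) {P Q R : X →L[ℂ] X}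
    (hP : IsCalc T (regFun β) P) (hQ : IsCalc T (regFun (2 - β)) Q)
    (hR : IsCalc T (regFun 1) R) : P * Q = R * R := by
  have hB := hT.toIsBoundedC0Semigroup
  refine (hP.mul hB hQ).unique hB ((hR.mul hB hR).congr fun z hz => ?_)
  rw [regFun_add hz, regFun_add hz]
  congr 1
  ring

lemma regFun_injective (hT : IsAnalyticSemigroup T K D₁ D₂) (h2 : β ≤ 2) {P : X →L[ℂ] X}
    (hP : IsCalc T (regFun β) P) {x : X} (hx : P x = 0) : x = 0 := by
  have hB := hT.toIsBoundedC0Semigroup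
  obtain ⟨R, hR⟩ := exists_isCalc_regFun hB zero_le_one
  obtain ⟨Q, hQ⟩ := exists_isCalc_regFun hB (sub_nonneg.2 h2)
  have h1 : Q * P = R * R :=
    hT.regFun_two (β := 2 - β) hQ (by rwa [sub_sub_cancel]) hR
  have h3 := DFunLike.congr_fun h1 x
  simp only [mul_apply_eq_comp, hx, map_zero] at h3
  exact hT.resolvent_injective hR (hT.resolvent_injective hR h3.symm)

lemma isFracPow_unique (hT : IsAnalyticSemigroup T K D₁ D₂) (h0 : 0 ≤ β) (h2 : β ≤ 2) {x y y' : X}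
    (h : IsFracPow T β x y) (h' : IsFracPow T β x y') : y = y' := by
  have hB := hT.toIsBoundedC0Semigroup
  obtain ⟨P, hP⟩ := exists_isCalc_regFun hB h0
  obtain ⟨H, hH⟩ := exists_isCalc_regPowFun hB h0 h2
  rw [isFracPow_iff hB hP hH] at h h'
  refine sub_eq_zero.1 (hT.regFun_injective h2 hP ?_)
  rw [map_sub, h, h', sub_self]

/-- `A^β` and `(tA)^β` differ by the factor `t^β`. -/
lemma isFracPow_of_scale (hT : IsAnalyticSemigroup T K D₁ D₂) (h0 : 0 ≤ β) (h2 : β ≤ 2) {t : ℝ≥0}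
    (ht : 0 < t) {x y : X} (h : IsFracPow (scaleSemigroup T t) β x y) :
    IsFracPow T β x ((((t : ℝ) ^ (-β) : ℝ) : ℂ) • y) := by
  have hB := hT.toIsBoundedC0Semigroup
  have hBt := hB.scale t
  obtain ⟨P, hP⟩ := exists_isCalc_regFun hB h0
  obtain ⟨H, hH⟩ := exists_isCalc_regPowFun hB h0 h2
  obtain ⟨Pt, hPt⟩ := exists_isCalc_regFun hBt h0
  obtain ⟨Ht, hHt⟩ := exists_isCalc_regPowFun hBt h0 h2
  rw [isFracPow_iff hB hP hH]
  rw [isFracPow_iff hBt hPt hHt] at h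
  have hPt' := hPt.of_scale hB ht
  have hHt' := hHt.of_scale hB ht
  have e1 : P * Ht = ((t ^ β : ℝ≥0) : ℂ) • (H * Pt) := by
    refine (hP.mul hB hHt').unique hB (((hH.mul hB hPt').const_mul (t ^ β)).congr fun z hz => ?_)
    rw [regFun_mul_regPowFun hz, NNReal.coe_rpow]
  have comm : ∀ {f : ℝ → ℝ} {Q : X →L[ℂ] X}, IsCalc T f Q → Commute Q Pt := fun {f Q} hQ =>
    hQ.commute hB fun s => (hPt'.commute hB fun r => hB.commute r s).symm
  refine sub_eq_zero.1 ((hT.scale ht).regFun_injective h2 hPt ?_)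
  have e2 : Pt (P y) = P (Pt y) := (DFunLike.congr_fun (comm hP).eq y).symm
  have e3 : Pt (H x) = H (Pt x) := (DFunLike.congr_fun (comm hH).eq x).symm
  have e4 : P (Ht x) = ((t ^ β : ℝ≥0) : ℂ) • H (Pt x) := DFunLike.congr_fun e1 x
  rw [map_sub, map_smul, map_smul, e2, e3, h, e4, smul_smul, ← Complex.ofReal_mul,
    NNReal.coe_rpow, ← Real.rpow_add (by exact_mod_cast ht), neg_add_cancel, Real.rpow_zero,
    Complex.ofReal_one, one_smul, sub_self]

lemma exists_isFracPow_one (h0 : 0 ≤ β) (h2 : β ≤ 2) (K : ℝ) : ∃ C : ℝ, 0 ≤ C ∧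
    ∀ (T : ℝ≥0 → X →L[ℂ] X) (D₁ D₂ : ℝ → X →L[ℂ] X), IsAnalyticSemigroup T K D₁ D₂ →
      ∀ x : X, ∃ y : X, IsFracPow T β (T 1 x) y ∧ ‖y‖ ≤ C * ‖x‖ := by
  rcases lt_or_ge K 0 with hK | hK
  · exact ⟨0, le_rfl, fun T D₁ D₂ hT => absurd hT.nonneg hK.not_ge⟩
  obtain ⟨μ, ν, hH⟩ := exists_isLaplaceDiff_regPowFun h0 h2
  obtain ⟨μ', ν', hQ⟩ := exists_isLaplaceDiff_regFun (sub_nonneg.2 h2)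
  have hμ : ∀ m m' : Measure ℝ≥0, 0 ≤ K * (m.real univ + m'.real univ) := fun m m' =>
    mul_nonneg hK (add_nonneg measureReal_nonneg measureReal_nonneg)
  refine ⟨(K * (μ.real univ + ν.real univ)) * ((K * (μ'.real univ + ν'.real univ)) *
    (K + 2 * K + K)), mul_nonneg (hμ _ _) (mul_nonneg (hμ _ _) (by linarith)),
    fun T D₁ D₂ hT x => ?_⟩
  have hB := hT.toIsBoundedC0Semigroup
  obtain ⟨H, hH, hHn⟩ := hH.exists_isCalc hB
  obtain ⟨Q, hQ, hQn⟩ := hQ.exists_isCalc hB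
  obtain ⟨P, hP⟩ := exists_isCalc_regFun hB h0
  obtain ⟨R, hR⟩ := exists_isCalc_regFun hB zero_le_one
  have hR1 : ∀ x, R (D₁ 1 x) = R (T 1 x) - T 1 x := fun x => by
    simpa using DFunLike.congr_fun (hT.resolvent_D₁ hR one_pos) x
  have hR2 : ∀ x, R (D₂ 1 x) = R (D₁ 1 x) - D₁ 1 x := fun x => by
    simpa using DFunLike.congr_fun (hT.resolvent_D₂ hR one_pos) x
  set w := T 1 x - (2 : ℂ) • D₁ 1 x + D₂ 1 x with hw
  have hRw : R (R w) = T 1 x := by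
    rw [hw]
    simp only [map_add, map_sub, hR1, hR2, two_smul]
    abel
  refine ⟨H (Q w), ?_, ?_⟩
  · rw [isFracPow_iff hB hP hH]
    have e1 : P (H (Q w)) = H (P (Q w)) := DFunLike.congr_fun (hP.commute hB fun s =>
      (hH.commute hB fun r => hB.commute r s).symm).eq (Q w)
    have e2 : P (Q w) = R (R w) := DFunLike.congr_fun (hT.regFun_two hP hQ hR) w
    rw [e1, e2, hRw]
  · have hw' : ‖w‖ ≤ (K + 2 * K + K) * ‖x‖ := by
      have b1 : ‖D₁ 1 x‖ ≤ K * ‖x‖ :=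
        (D₁ 1).le_of_opNorm_le (by simpa using hT.norm_le₁ 1 one_pos) x
      have b2 : ‖D₂ 1 x‖ ≤ K * ‖x‖ :=
        (D₂ 1).le_of_opNorm_le (by simpa using hT.norm_le₂ 1 one_pos) x
      have b3 : ‖(2 : ℂ) • D₁ 1 x‖ = 2 * ‖D₁ 1 x‖ := by rw [norm_smul]; norm_num
      calc ‖w‖ ≤ ‖T 1 x‖ + ‖(2 : ℂ) • D₁ 1 x‖ + ‖D₂ 1 x‖ :=
            (norm_add_le _ _).trans (add_le_add_left (norm_sub_le _ _) _)
        _ ≤ _ := by linarith [hT.norm_apply_le x 1]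
    refine ((H.le_of_opNorm_le hHn _).trans (mul_le_mul_of_nonneg_left
      ((Q.le_of_opNorm_le hQn _).trans (mul_le_mul_of_nonneg_left hw' (hμ _ _)))
      (hμ _ _))).trans_eq ?_
    ring

lemma exists_isFracPow (hT : IsAnalyticSemigroup T K D₁ D₂) (h0 : 0 ≤ β) (h2 : β ≤ 2) :
    ∃ C : ℝ, 0 ≤ C ∧ ∀ (t : ℝ≥0) (x : X), 0 < t →
      ∃ y : X, IsFracPow T β (T t x) y ∧ (t : ℝ) ^ β * ‖y‖ ≤ C * ‖x‖ := by
  obtain ⟨C, hC, h⟩ := exists_isFracPow_one (X := X) h0 h2 K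
  refine ⟨C, hC, fun t x ht => ?_⟩
  obtain ⟨y, hy, hyn⟩ := h _ _ _ (hT.scale ht) x
  rw [scaleSemigroup, mul_one] at hy
  refine ⟨_, hT.isFracPow_of_scale h0 h2 ht hy, ?_⟩
  have ht' : (0 : ℝ) < t := ht
  rwa [norm_smul, Complex.norm_real, Real.norm_of_nonneg (Real.rpow_nonneg ht'.le _), ← mul_assoc,
    ← Real.rpow_add ht', add_neg_cancel, Real.rpow_zero, one_mul]

lemma fracBoundFinite (hT : IsAnalyticSemigroup T K D₁ D₂) (h0 : 0 ≤ β) (h2 : β ≤ 2) :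
    FracBoundFinite T β := by
  obtain ⟨C, hC, h⟩ := hT.exists_isFracPow h0 h2
  refine ⟨fun t ht x => ?_, C, ?_⟩
  · obtain ⟨y, hy, -⟩ := h t x ht
    exact ⟨y, hy, fun y' hy' => hT.isFracPow_unique h0 h2 hy' hy⟩
  · rintro r ⟨t, x, y, ht, hx, hy, rfl⟩
    obtain ⟨y', hy', hn⟩ := h t x ht
    rw [hT.isFracPow_unique h0 h2 hy hy']
    exact hn.trans (mul_le_of_le_one_right hC hx)

lemma fracBound_nonneg (hT : IsAnalyticSemigroup T K D₁ D₂) (h0 : 0 ≤ β) (h2 : β ≤ 2) :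
    0 ≤ fracBound T β := by
  obtain ⟨h, hb⟩ := hT.fracBoundFinite h0 h2
  obtain ⟨y, hy, -⟩ := h 1 one_pos 0
  refine le_csSup_of_le hb ⟨1, 0, y, one_pos, by simp, hy, rfl⟩ (by positivity)

lemma norm_le_fracBound (hT : IsAnalyticSemigroup T K D₁ D₂) (h0 : 0 ≤ β) (h2 : β ≤ 2) {t : ℝ≥0}
    (ht : 0 < t) {x y : X} (h : IsFracPow T β (T t x) y) :
    (t : ℝ) ^ β * ‖y‖ ≤ fracBound T β * ‖x‖ := by
  rcases eq_or_ne x 0 with rfl | hx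
  · have h' := hT.isFracPow_smul h0 h2 h 0
    rw [map_zero, smul_zero, zero_smul] at h'
    rw [map_zero] at h
    rw [hT.isFracPow_unique h0 h2 h h']
    simp
  have hx0 : 0 < ‖x‖ := norm_pos_iff.2 hx
  have h' := hT.isFracPow_smul h0 h2 h ((‖x‖⁻¹ : ℝ) : ℂ)
  rw [← map_smul] at h'
  have hle : (t : ℝ) ^ β * ‖((‖x‖⁻¹ : ℝ) : ℂ) • y‖ ≤ fracBound T β :=
    le_csSup (hT.fracBoundFinite h0 h2).2 ⟨t, _, _, ht, by
      rw [norm_smul, Complex.norm_real, norm_inv, norm_norm, inv_mul_cancel₀ hx0.ne'], h', rfl⟩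
  rw [norm_smul, Complex.norm_real, norm_inv, norm_norm] at hle
  rw [← div_le_iff₀ hx0]
  calc (t : ℝ) ^ β * ‖y‖ / ‖x‖ = (t : ℝ) ^ β * (‖x‖⁻¹ * ‖y‖) := by
        rw [div_eq_mul_inv]; ring
    _ ≤ _ := hle

/-- `A^{2-α} e^{-rA} A^α x = A² e^{-rA} x`. -/
lemma isFracPow_D₂ (hT : IsAnalyticSemigroup T K D₁ D₂) {α : ℝ} (h0 : 0 ≤ α) (h2 : α ≤ 2)
    {x y : X} (h : IsFracPow T α x y) {r : ℝ≥0} (hr : 0 < r) :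
    IsFracPow T (2 - α) (T r y) (D₂ r x) := by
  have hB := hT.toIsBoundedC0Semigroup
  have hr' : (0 : ℝ) < r := hr
  obtain ⟨P, hP⟩ := exists_isCalc_regFun hB h0
  obtain ⟨H, hH⟩ := exists_isCalc_regPowFun hB h0 h2
  obtain ⟨Q, hQ⟩ := exists_isCalc_regFun hB (sub_nonneg.2 h2)
  obtain ⟨G, hG⟩ := exists_isCalc_regPowFun hB (sub_nonneg.2 h2) (by linarith : 2 - α ≤ 2)
  obtain ⟨R, hR⟩ := exists_isCalc_regFun hB zero_le_one
  rw [isFracPow_iff hB hP hH] at h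
  rw [isFracPow_iff hB hQ hG]
  have hcomm : ∀ {f : ℝ → ℝ} {S : X →L[ℂ] X}, IsCalc T f S → ∀ v, S (T r v) = T r (S v) :=
    fun hS v => DFunLike.congr_fun (hS.commute hB fun s => hB.commute s r).eq v
  have hGH : G * H = (1 - R) * (1 - R) := by
    refine (hG.mul hB hH).unique hB (((hR.one_sub hB).mul hB (hR.one_sub hB)).congr fun z hz => ?_)
    rw [← regPowFun_one hz, regPowFun_add hz, regPowFun_add hz]
    congr 1
    ring
  have hPG : ∀ v, P (G v) = G (P v) := fun v => DFunLike.congr_fun (hP.commute hB fun s =>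
    (hG.commute hB fun r => hB.commute r s).symm).eq v
  refine sub_eq_zero.1 (hT.regFun_injective h2 hP ?_)
  have e1 : P (Q (D₂ r x)) = R (R (D₂ r x)) := DFunLike.congr_fun (hT.regFun_two hP hQ hR) _
  have e2 : G (H x) = x - R x - R (x - R x) := by
    simpa using DFunLike.congr_fun hGH x
  have hR1 : R (D₁ r x) = R (T r x) - T r x := by
    simpa using DFunLike.congr_fun (hT.resolvent_D₁ hR hr') x
  have hR2 : R (D₂ r x) = R (D₁ r x) - D₁ r x := by
    simpa using DFunLike.congr_fun (hT.resolvent_D₂ hR hr') x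
  rw [map_sub, e1, hR2, hR1, hPG, hcomm hP, h, hcomm hG, e2]
  simp only [map_sub, hR1, ← hcomm hR]
  abel

lemma norm_D₂_le (hT : IsAnalyticSemigroup T K D₁ D₂) {α : ℝ} (h0 : 0 ≤ α) (h2 : α ≤ 2)
    {x y : X} (h : IsFracPow T α x y) {r : ℝ} (hr : 0 < r) :
    ‖D₂ r x‖ ≤ fracBound T (2 - α) * ‖y‖ * r ^ (α - 2) := by
  lift r to ℝ≥0 using hr.le
  have hr' : (0 : ℝ) < (r : ℝ) ^ (2 - α) := Real.rpow_pos_of_pos hr _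
  have h1 := hT.norm_le_fracBound (sub_nonneg.2 h2) (by linarith) (by exact_mod_cast hr)
    (hT.isFracPow_D₂ h0 h2 h (by exact_mod_cast hr))
  rw [show α - 2 = -(2 - α) by ring, Real.rpow_neg hr.le, ← div_eq_mul_inv, le_div_iff₀ hr']
  linarith

end IsAnalyticSemigroup

end FracPow

/-! ### The Taylor kernel -/

/-- Taylor's formula of order two at `1`, on the segment from `1` to `s`. -/
lemma taylor_two_at_one {E : Type*} [NormedAddCommGroup E] [NormedSpace ℝ E] [CompleteSpace E]
    {f f' f'' : ℝ → E} {s : ℝ} (h1 : ∀ r ∈ uIcc 1 s, HasDerivAt f (f' r) r)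
    (h2 : ∀ r ∈ uIcc 1 s, HasDerivAt f' (f'' r) r) (hc : ContinuousOn f'' (uIcc 1 s)) :
    f s - f 1 - (s - 1) • f' 1
      = ∫ θ in (0 : ℝ)..1, ((s - 1) ^ 2 * (1 - θ)) • f'' (1 + θ * (s - 1)) := by
  have hmem : ∀ θ ∈ uIcc (0 : ℝ) 1, 1 + θ * (s - 1) ∈ uIcc 1 s := by
    intro θ hθ
    rw [uIcc_of_le zero_le_one] at hθ
    have := (convex_uIcc (1 : ℝ) s) left_mem_uIcc right_mem_uIcc (sub_nonneg.2 hθ.2) hθ.1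
      (sub_add_cancel 1 θ)
    convert this using 1
    simp only [smul_eq_mul]
    ring
  have hd : ∀ θ ∈ uIcc (0 : ℝ) 1, HasDerivAt (fun θ : ℝ => f (1 + θ * (s - 1))
      + ((1 - θ) * (s - 1)) • f' (1 + θ * (s - 1)))
      (((s - 1) ^ 2 * (1 - θ)) • f'' (1 + θ * (s - 1))) θ := by
    intro θ hθ
    have hl : HasDerivAt (fun θ : ℝ => 1 + θ * (s - 1)) (s - 1) θ := by
      simpa using ((hasDerivAt_id θ).mul_const (s - 1)).const_add 1
    have hm : HasDerivAt (fun θ : ℝ => (1 - θ) * (s - 1)) (-(s - 1)) θ := by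
      simpa using ((hasDerivAt_id θ).const_sub 1).mul_const (s - 1)
    have e1 := (h1 _ (hmem θ hθ)).scomp θ hl
    have e2 := hm.smul ((h2 _ (hmem θ hθ)).scomp θ hl)
    refine (e1.add e2).congr_deriv ?_
    simp only [Function.comp_apply, smul_smul, neg_smul]
    rw [add_comm, add_assoc, neg_add_cancel, add_zero]
    congr 1
    ring
  have hci : ContinuousOn (fun θ : ℝ => ((s - 1) ^ 2 * (1 - θ)) • f'' (1 + θ * (s - 1)))
      (uIcc (0 : ℝ) 1) :=
    ContinuousOn.smul (by fun_prop) (hc.comp (by fun_prop) hmem)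
  rw [intervalIntegral.integral_eq_sub_of_hasDerivAt hd hci.intervalIntegrable]
  simp only [one_mul, sub_self, zero_mul, zero_smul, add_zero, sub_zero, add_sub_cancel]
  abel

/-- `∫₀¹ (s - 1)² (1 - θ) (1 + θ (s - 1))^{α - 2} dθ`. -/
def taylorKernel (α : ℝ) (s : ℝ≥0) : ℝ≥0∞ :=
  ∫⁻ θ in Ioo (0 : ℝ) 1,
    ENNReal.ofReal (((s : ℝ) - 1) ^ 2 * (1 - θ) * (1 + θ * (s - 1)) ^ (α - 2))

/-- The second order Taylor remainder at `1` of `s ↦ e^{-zs}`. -/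
def expRemainder (z s : ℝ) : ℝ := Real.exp (-(z * s)) - Real.exp (-z) + z * (s - 1) * Real.exp (-z)

lemma expRemainder_eq (z s : ℝ) : expRemainder z s = ∫ θ in (0 : ℝ)..1,
    (s - 1) ^ 2 * (1 - θ) * (z ^ 2 * Real.exp (-(z * (1 + θ * (s - 1))))) := by
  have h1 : ∀ r : ℝ, HasDerivAt (fun r => Real.exp (-(z * r))) (-z * Real.exp (-(z * r))) r := by
    intro r
    have : HasDerivAt (fun r => -(z * r)) (-z) r := by
      simpa using ((hasDerivAt_id r).const_mul z).fun_neg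
    simpa [mul_comm] using this.exp
  have h2 : ∀ r : ℝ, HasDerivAt (fun r => -z * Real.exp (-(z * r)))
      (z ^ 2 * Real.exp (-(z * r))) r := by
    intro r
    refine ((h1 r).const_mul (-z)).congr_deriv ?_
    ring
  have := taylor_two_at_one (s := s) (fun r _ => h1 r) (fun r _ => h2 r) (by fun_prop)
  simp only [smul_eq_mul] at this
  rw [← this, expRemainder, mul_one]
  ring

lemma ofReal_expRemainder_div {α z : ℝ} (hz : 0 < z) (s : ℝ) :
    ENNReal.ofReal (expRemainder z s / z ^ (1 + α)) = ∫⁻ θ in Ioo (0 : ℝ) 1, ENNReal.ofReal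
      ((s - 1) ^ 2 * (1 - θ) * (z ^ (2 - α - 1) * Real.exp (-((1 + θ * (s - 1)) * z)))) := by
  have hpow : z ^ 2 / z ^ (1 + α) = z ^ (2 - α - 1) := by
    rw [← Real.rpow_natCast, ← Real.rpow_sub hz]
    congr 1
    push_cast
    ring
  have hcont : Continuous fun θ : ℝ => (s - 1) ^ 2 * (1 - θ) *
      (z ^ (2 - α - 1) * Real.exp (-((1 + θ * (s - 1)) * z))) := by fun_prop
  have h1 : expRemainder z s / z ^ (1 + α) = ∫ θ in Ioo (0 : ℝ) 1, (s - 1) ^ 2 * (1 - θ) *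
      (z ^ (2 - α - 1) * Real.exp (-((1 + θ * (s - 1)) * z))) := by
    rw [expRemainder_eq, intervalIntegral.integral_of_le zero_le_one, integral_Ioc_eq_integral_Ioo,
      ← integral_div]
    refine integral_congr_ae (Eventually.of_forall fun θ => ?_)
    simp only
    rw [← hpow, mul_comm z (1 + θ * (s - 1))]
    ring
  rw [h1, ofReal_integral_eq_lintegral_ofReal]
  · exact (hcont.integrableOn_Icc (a := 0) (b := 1)).mono_set Ioo_subset_Icc_self
  · refine (ae_restrict_iff' measurableSet_Ioo).2 (Eventually.of_forall fun θ hθ => ?_)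
    have := sub_nonneg.2 hθ.2.le
    have := Real.rpow_nonneg hz.le (2 - α - 1)
    positivity

lemma expRemainder_nonneg (z s : ℝ) : 0 ≤ expRemainder z s := by
  rw [expRemainder_eq]
  refine intervalIntegral.integral_nonneg zero_le_one fun θ hθ => ?_
  have := sub_nonneg.2 hθ.2
  positivity

lemma lintegral_rpow_mul_exp {a r c : ℝ} (ha : 0 < a) (hr : 0 < r) (hc : 0 ≤ c) :
    ∫⁻ z in Ioi (0 : ℝ), ENNReal.ofReal (c * (z ^ (a - 1) * Real.exp (-(r * z))))
      = ENNReal.ofReal (Real.Gamma a) * ENNReal.ofReal (c * r ^ (-a)) := by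
  have h1 := Real.integral_rpow_mul_exp_neg_mul_Ioi ha hr
  have hne : (1 / r) ^ a * Real.Gamma a ≠ 0 :=
    (mul_pos (Real.rpow_pos_of_pos (by positivity) _) (Real.Gamma_pos_of_pos ha)).ne'
  have hint : IntegrableOn (fun z : ℝ => z ^ (a - 1) * Real.exp (-(r * z))) (Ioi 0) :=
    Integrable.of_integral_ne_zero (by rw [h1]; exact hne)
  rw [← ofReal_integral_eq_lintegral_ofReal (hint.const_mul c), integral_const_mul, h1,
    ← ENNReal.ofReal_mul (Real.Gamma_pos_of_pos ha).le, one_div, Real.inv_rpow hr.le,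
    Real.rpow_neg hr.le]
  · congr 1
    ring
  · refine (ae_restrict_iff' measurableSet_Ioi).2 (Eventually.of_forall fun z hz => ?_)
    have := Real.rpow_nonneg (le_of_lt hz) (a - 1)
    positivity

lemma lintegral_expRemainder {α : ℝ} (hα : α < 2) (s : ℝ≥0) :
    ∫⁻ z in Ioi (0 : ℝ), ENNReal.ofReal (expRemainder z s / z ^ (1 + α))
      = ENNReal.ofReal (Real.Gamma (2 - α)) * taylorKernel α s := by
  rw [setLIntegral_congr_fun measurableSet_Ioi fun z hz => ofReal_expRemainder_div hz s,
    lintegral_lintegral_swap, taylorKernel, ← lintegral_const_mul']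
  · refine setLIntegral_congr_fun measurableSet_Ioo fun θ hθ => ?_
    have hr : 0 < 1 + θ * ((s : ℝ) - 1) := by
      have := mul_nonneg hθ.1.le s.coe_nonneg
      linarith [hθ.2]
    have hc : 0 ≤ ((s : ℝ) - 1) ^ 2 * (1 - θ) := mul_nonneg (sq_nonneg _) (sub_nonneg.2 hθ.2.le)
    have h := lintegral_rpow_mul_exp (sub_pos.2 hα) hr hc
    rw [neg_sub] at h
    exact h
  · exact ENNReal.ofReal_ne_top
  · exact Measurable.aemeasurable (by fun_prop)

/-! ### Laws with mean one -/

/-- `g` is on `(0, ∞)` the Laplace transform of a probability measure of mean one and finite second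
moment, and `g(s) / s` is integrable at infinity. -/
structure IsUnitMeanLaw (g : ℝ → ℝ) (ν : Measure ℝ≥0) : Prop where
  prob : IsProbabilityMeasure ν
  eq : ∀ z : ℝ, 0 < z → g z = laplace ν z
  memLp : MemLp (fun s : ℝ≥0 => (s : ℝ)) 2 ν
  mean : ∫ s : ℝ≥0, (s : ℝ) ∂ν = 1
  integrableOn : IntegrableOn (fun s : ℝ => g s / s) (Ioi 1)

lemma continuousOn_laplace (ν : Measure ℝ≥0) [IsFiniteMeasure ν] :
    ContinuousOn (laplace ν) (Ici 0) := by
  refine continuousOn_of_dominated (bound := fun _ => 1) (fun z _ => by fun_prop) ?_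
    (integrable_const _) ?_
  · exact fun z hz => Eventually.of_forall fun s => norm_exp_neg_mul_le hz s
  · exact Eventually.of_forall fun s => by fun_prop

lemma antitoneOn_laplace (ν : Measure ℝ≥0) [IsFiniteMeasure ν] :
    AntitoneOn (laplace ν) (Ioi 0) := by
  intro z hz w hw hzw
  refine integral_mono (integrable_exp_neg_mul ν (le_of_lt hw))
    (integrable_exp_neg_mul ν (le_of_lt hz)) fun s => Real.exp_le_exp.2 ?_
  have := mul_le_mul_of_nonneg_right hzw s.coe_nonneg
  linarith

lemma laplace_nonneg (ν : Measure ℝ≥0) (z : ℝ) : 0 ≤ laplace ν z :=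
  integral_nonneg fun _ => (Real.exp_pos _).le

namespace IsUnitMeanLaw

variable {g : ℝ → ℝ} {ν : Measure ℝ≥0}

lemma integrable_coe (h : IsUnitMeanLaw g ν) : Integrable (fun s : ℝ≥0 => (s : ℝ)) ν := by
  have := h.prob
  exact h.memLp.integrable (by norm_num)

lemma nonneg (h : IsUnitMeanLaw g ν) {z : ℝ} (hz : 0 < z) : 0 ≤ g z :=
  h.eq z hz ▸ laplace_nonneg ν z

lemma continuousOn (h : IsUnitMeanLaw g ν) : ContinuousOn g (Ioi 0) := by
  have := h.prob
  exact ((continuousOn_laplace ν).mono Ioi_subset_Ici_self).congr fun z hz => h.eq z hz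

lemma antitoneOn (h : IsUnitMeanLaw g ν) : AntitoneOn g (Ioi 0) := by
  have := h.prob
  exact (antitoneOn_laplace ν).congr fun z hz => (h.eq z hz).symm

lemma le_one (h : IsUnitMeanLaw g ν) {z : ℝ} (hz : 0 < z) : g z ≤ 1 := by
  have := h.prob
  rw [h.eq z hz]
  calc laplace ν z ≤ ∫ _, (1 : ℝ) ∂ν := integral_mono (integrable_exp_neg_mul ν hz.le)
        (integrable_const _) fun s => (le_abs_self _).trans (norm_exp_neg_mul_le hz.le s)
    _ = 1 := by simp

lemma integrableOn_Ioi (h : IsUnitMeanLaw g ν) {δ : ℝ} (hδ : 0 < δ) :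
    IntegrableOn (fun s : ℝ => g s / s) (Ioi δ) := by
  have h1 : IntegrableOn (fun s : ℝ => g s / s) (Icc δ 1) := by
    refine ContinuousOn.integrableOn_Icc (ContinuousOn.div (h.continuousOn.mono fun z hz => ?_)
      continuousOn_id fun z hz => ?_)
    · exact hδ.trans_le hz.1
    · exact (hδ.trans_le hz.1).ne'
  refine (h1.union h.integrableOn).mono_set fun z hz => ?_
  rcases le_or_gt z 1 with hz1 | hz1
  · exact Or.inl ⟨le_of_lt hz, hz1⟩
  · exact Or.inr hz1

lemma integrable_expRemainder (h : IsUnitMeanLaw g ν) {z : ℝ} (hz : 0 < z) :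
    Integrable (fun s : ℝ≥0 => expRemainder z s) ν := by
  have := h.prob
  exact ((integrable_exp_neg_mul ν hz.le).sub (integrable_const _)).add
    (((h.integrable_coe.sub (integrable_const 1)).const_mul z).mul_const _)

lemma sub_exp_eq (h : IsUnitMeanLaw g ν) {z : ℝ} (hz : 0 < z) :
    g z - Real.exp (-z) = ∫ s : ℝ≥0, expRemainder z s ∂ν := by
  have := h.prob
  have hi := integrable_exp_neg_mul ν hz.le
  have h1 : Integrable (fun s : ℝ≥0 => (s : ℝ) - 1) ν := h.integrable_coe.sub (integrable_const 1)
  have h2 : ∫ s : ℝ≥0, ((s : ℝ) - 1) ∂ν = 0 := by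
    rw [integral_sub h.integrable_coe (integrable_const 1), h.mean]; simp
  have h3 : Integrable (fun s : ℝ≥0 => Real.exp (-(z * s)) - Real.exp (-z)) ν :=
    hi.sub (integrable_const _)
  simp only [expRemainder]
  rw [integral_add h3 ((h1.const_mul z).mul_const _),
    integral_sub hi (integrable_const _), integral_mul_const, integral_const_mul, h2, h.eq z hz]
  simp [laplace]

lemma exp_le (h : IsUnitMeanLaw g ν) {z : ℝ} (hz : 0 < z) : Real.exp (-z) ≤ g z := by
  have := h.sub_exp_eq hz
  have : 0 ≤ ∫ s : ℝ≥0, expRemainder z s ∂ν := integral_nonneg fun s => expRemainder_nonneg z s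
  linarith

lemma deltaFun_nonneg (h : IsUnitMeanLaw g ν) {α z : ℝ} (hz : 0 < z) :
    0 ≤ deltaFun (1 + α) g z :=
  div_nonneg (sub_nonneg.2 (h.exp_le hz)) (Real.rpow_nonneg hz.le _)

lemma lintegral_deltaFun (h : IsUnitMeanLaw g ν) {α : ℝ} (hα : α < 2) :
    ∫⁻ z in Ioi (0 : ℝ), ENNReal.ofReal (deltaFun (1 + α) g z)
      = ENNReal.ofReal (Real.Gamma (2 - α)) * ∫⁻ s, taylorKernel α s ∂ν := by
  have := h.prob
  have h1 : ∀ z ∈ Ioi (0 : ℝ), ENNReal.ofReal (deltaFun (1 + α) g z)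
      = ∫⁻ s : ℝ≥0, ENNReal.ofReal (expRemainder z s / z ^ (1 + α)) ∂ν := by
    intro z hz
    rw [deltaFun, h.sub_exp_eq hz, ← integral_div, ofReal_integral_eq_lintegral_ofReal
      ((h.integrable_expRemainder hz).div_const _)]
    exact Eventually.of_forall fun s =>
      div_nonneg (expRemainder_nonneg z s) (Real.rpow_nonneg (le_of_lt hz) _)
  rw [setLIntegral_congr_fun measurableSet_Ioi h1, lintegral_lintegral_swap,
    ← lintegral_const_mul' _ _ ENNReal.ofReal_ne_top]
  · exact lintegral_congr fun s => lintegral_expRemainder hα s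
  · unfold expRemainder
    exact Measurable.aemeasurable (by fun_prop)

/-- The second moment bounds the distance of `g` from `e^{-z}` near `0`. -/
lemma le_quadratic (h : IsUnitMeanLaw g ν) {z : ℝ} (hz : 0 < z) :
    g z ≤ 1 - z + (∫ s : ℝ≥0, (s : ℝ) ^ 2 ∂ν) * z ^ 2 / 2 := by
  have := h.prob
  have hsq : Integrable (fun s : ℝ≥0 => (s : ℝ) ^ 2) ν := h.memLp.integrable_sq
  have hexp : ∀ u : ℝ, 0 ≤ u → Real.exp (-u) ≤ 1 - u + u ^ 2 / 2 := by
    intro u hu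
    have := Real.quadratic_le_exp_of_nonneg hu
    rw [Real.exp_neg, inv_le_comm₀ (Real.exp_pos u) (by nlinarith [sq_nonneg (u - 1)])]
    refine le_trans ?_ this
    rw [inv_le_iff_one_le_mul₀ (by nlinarith [sq_nonneg (u - 1)])]
    nlinarith [sq_nonneg (u ^ 2)]
  rw [h.eq z hz]
  have hi' : Integrable (fun s : ℝ≥0 => (1 : ℝ) - z * s) ν :=
    (integrable_const (1 : ℝ)).sub (h.integrable_coe.const_mul z)
  have hi : Integrable (fun s : ℝ≥0 => (1 : ℝ) - z * s + z ^ 2 / 2 * (s : ℝ) ^ 2) ν :=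
    hi'.add (hsq.const_mul _)
  calc laplace ν z ≤ ∫ s : ℝ≥0, ((1 : ℝ) - z * s + z ^ 2 / 2 * (s : ℝ) ^ 2) ∂ν := by
        refine integral_mono (integrable_exp_neg_mul ν hz.le) hi fun s => ?_
        refine (hexp (z * s) (by positivity)).trans_eq ?_
        ring
    _ = _ := by
        rw [integral_add hi' (hsq.const_mul _), integral_sub (integrable_const (1 : ℝ)) (h.integrable_coe.const_mul z),
          integral_const_mul, integral_const_mul, h.mean]
        simp
        ring

lemma measurable_deltaFun (h : IsUnitMeanLaw g ν) (α : ℝ) :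
    AEStronglyMeasurable (deltaFun (1 + α) g) (volume.restrict (Ioi 0)) := by
  refine ContinuousOn.aestronglyMeasurable (ContinuousOn.div (h.continuousOn.sub (by fun_prop))
    ?_ fun z hz => (Real.rpow_pos_of_pos hz _).ne') measurableSet_Ioi
  exact fun z hz => (Real.continuousAt_rpow_const z _ (Or.inl (ne_of_gt hz))).continuousWithinAt

lemma integrableOn_deltaFun (h : IsUnitMeanLaw g ν) {α : ℝ} (hα : α ∈ Icc (0 : ℝ) 1) :
    IntegrableOn (deltaFun (1 + α) g) (Ioi 0) := by
  have hm := h.measurable_deltaFun α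
  have h0 : IntegrableOn (deltaFun (1 + α) g) (Ioc 0 1) := by
    refine IntegrableOn.of_bound (by simp) (hm.mono_set Ioc_subset_Ioi_self)
      ((∫ s : ℝ≥0, (s : ℝ) ^ 2 ∂ν) / 2) ?_
    refine (ae_restrict_iff' measurableSet_Ioc).2 (Eventually.of_forall fun z hz => ?_)
    have hz0 : 0 < z := hz.1
    rw [Real.norm_of_nonneg (h.deltaFun_nonneg hz0), deltaFun,
      div_le_iff₀ (Real.rpow_pos_of_pos hz0 _)]
    have h1 := h.le_quadratic hz0
    have h2 := Real.add_one_le_exp (-z)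
    have h3 : z ^ 2 ≤ z ^ (1 + α) := by
      rw [← Real.rpow_natCast]
      exact Real.rpow_le_rpow_of_exponent_ge hz0 hz.2 (by push_cast; linarith [hα.2])
    have h4 : 0 ≤ ∫ s : ℝ≥0, (s : ℝ) ^ 2 ∂ν := integral_nonneg fun s => sq_nonneg _
    nlinarith
  have h1 : IntegrableOn (deltaFun (1 + α) g) (Ioi 1) := by
    refine h.integrableOn.mono' (hm.mono_set (Ioi_subset_Ioi zero_le_one)) ?_
    refine (ae_restrict_iff' measurableSet_Ioi).2 (Eventually.of_forall fun z hz => ?_)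
    have hz0 : 0 < z := zero_lt_one.trans hz
    rw [Real.norm_of_nonneg (h.deltaFun_nonneg hz0), deltaFun]
    refine div_le_div₀ (h.nonneg hz0) ?_ hz0 ?_
    · linarith [Real.exp_pos (-z)]
    · simpa using Real.rpow_le_rpow_of_exponent_le (le_of_lt hz) (by linarith [hα.1] : 1 ≤ 1 + α)
  have := h0.union h1
  rwa [Ioc_union_Ioi_eq_Ioi zero_le_one] at this

lemma cFun_nonneg (h : IsUnitMeanLaw g ν) {α : ℝ} (hα : α < 2) : 0 ≤ cFun α g :=
  mul_nonneg (inv_nonneg.2 (Real.Gamma_pos_of_pos (by linarith)).le)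
    (setIntegral_nonneg measurableSet_Ioi fun _ hz => h.deltaFun_nonneg hz)

lemma lintegral_taylorKernel (h : IsUnitMeanLaw g ν) {α : ℝ} (hα : α ∈ Icc (0 : ℝ) 1) :
    ∫⁻ s, taylorKernel α s ∂ν = ENNReal.ofReal (cFun α g) := by
  have hα2 : α < 2 := by linarith [hα.2]
  have hΓ : 0 < Real.Gamma (2 - α) := Real.Gamma_pos_of_pos (by linarith)
  have h1 := h.lintegral_deltaFun hα2
  rw [← ofReal_integral_eq_lintegral_ofReal (h.integrableOn_deltaFun hα)
    ((ae_restrict_iff' measurableSet_Ioi).2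
      (Eventually.of_forall fun z hz => h.deltaFun_nonneg hz))] at h1
  rw [cFun, ENNReal.ofReal_mul (inv_nonneg.2 hΓ.le), h1, ← mul_assoc,
    ← ENNReal.ofReal_mul (inv_nonneg.2 hΓ.le), inv_mul_cancel₀ hΓ.ne', ENNReal.ofReal_one, one_mul]

lemma ae_pos (h : IsUnitMeanLaw g ν) : ∀ᵐ s ∂ν, 0 < s := by
  have := h.prob
  have hle : ∀ z : ℝ, 0 < z → ν.real {0} ≤ g z := by
    intro z hz
    rw [h.eq z hz, ← integral_indicator_one (measurableSet_singleton (0 : ℝ≥0))]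
    refine integral_mono ((integrable_const (1 : ℝ)).indicator (measurableSet_singleton _))
      (integrable_exp_neg_mul ν hz.le) fun s => ?_
    by_cases hs : s = 0
    · simp [hs]
    · simpa [hs] using (Real.exp_pos _).le
  have h0 : ν.real {0} = 0 := by
    by_contra hne
    have hpos : 0 < ν.real {0} := lt_of_le_of_ne measureReal_nonneg (Ne.symm hne)
    refine not_integrableOn_Ioi_inv (a := 1) ?_
    have h1 : IntegrableOn (fun s : ℝ => ν.real {0} / s) (Ioi 1) := by
      refine h.integrableOn.mono' (by fun_prop) ?_
      refine (ae_restrict_iff' measurableSet_Ioi).2 (Eventually.of_forall fun z hz => ?_)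
      have hz0 : 0 < z := zero_lt_one.trans hz
      rw [Real.norm_of_nonneg (by positivity)]
      exact div_le_div_of_nonneg_right (hle z hz0) hz0.le
    refine (h1.const_mul (ν.real {0})⁻¹).congr (Eventually.of_forall fun z => ?_)
    simp only
    field_simp
  have h1 : ν {0} = 0 := by
    rwa [measureReal_def, ENNReal.toReal_eq_zero_iff, or_iff_left (measure_ne_top _ _)] at h0
  filter_upwards [measure_eq_zero_iff_ae_notMem.1 h1] with s hs using pos_iff_ne_zero.2 hs

end IsUnitMeanLaw

/-! ### The error estimate -/

section Estimate

variable {X : Type*} [NormedAddCommGroup X] [NormedSpace ℂ X]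
variable {T : ℝ≥0 → X →L[ℂ] X} {K : ℝ} {D₁ D₂ : ℝ → X →L[ℂ] X}

lemma IsAnalyticSemigroup.continuousOn_D₂ (hT : IsAnalyticSemigroup T K D₁ D₂) (x : X) :
    ContinuousOn (fun r => D₂ r x) (Ioi 0) := by
  intro r hr
  have hr' : (0 : ℝ) < r := hr
  refine ContinuousAt.continuousWithinAt ?_
  have h1 : ContinuousAt (fun q : ℝ => T (q - r / 2).toNNReal (D₂ (r / 2) x)) r :=
    ((hT.strong_cont _).comp (continuous_real_toNNReal.comp
      (continuous_id.sub continuous_const))).continuousAt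
  refine h1.congr ?_
  filter_upwards [lt_mem_nhds (half_lt_self hr')] with q hq
  have h2 := hT.D₂_add (half_pos hr') (q - r / 2).toNNReal
  rw [Real.coe_toNNReal _ (sub_nonneg.2 (le_of_lt hq)), sub_add_cancel] at h2
  rw [h2]
  rfl

lemma IsAnalyticSemigroup.enorm_taylor_le [CompleteSpace X] (hT : IsAnalyticSemigroup T K D₁ D₂) {α : ℝ}
    (hα : α ∈ Icc (0 : ℝ) 1) {t : ℝ≥0} (ht : 0 < t) {x y : X} (h : IsFracPow T α x y) {s : ℝ≥0}
    (hs : 0 < s) :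
    ‖T (t * s) x - T t x - ((s : ℝ) - 1) • (t : ℝ) • D₁ t x‖ₑ
      ≤ ENNReal.ofReal (fracBound T (2 - α) * (t : ℝ) ^ α * ‖y‖) * taylorKernel α s := by
  have hU := hT.scale ht
  have hs' : (0 : ℝ) < s := hs
  have ht' : (0 : ℝ) < t := ht
  have hpos : ∀ r ∈ uIcc (1 : ℝ) s, 0 < r := fun r hr =>
    lt_of_lt_of_le (lt_min one_pos hs') hr.1
  have happ : ∀ {F : ℝ → X →L[ℂ] X} {F' : X →L[ℂ] X} {r : ℝ}, HasDerivAt F F' r →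
      HasDerivAt (fun q => F q x) (F' x) r := fun hF =>
    ((ContinuousLinearMap.apply ℂ X x).restrictScalars ℝ).hasFDerivAt.comp_hasDerivAt _ hF
  have htay := taylor_two_at_one (s := (s : ℝ))
    (f := fun r : ℝ => scaleSemigroup T t r.toNNReal x)
    (fun r hr => happ (hU.hasDerivAt₁ r (hpos r hr)))
    (fun r hr => happ (hU.hasDerivAt₂ r (hpos r hr)))
    ((hU.continuousOn_D₂ x).mono hpos)
  simp only [scaleSemigroup, Real.toNNReal_coe, Real.toNNReal_one, mul_one, smul_apply] at htay
  have hM : 0 ≤ fracBound T (2 - α) :=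
    hT.fracBound_nonneg (by linarith [hα.2]) (by linarith [hα.1])
  rw [htay, intervalIntegral.integral_of_le zero_le_one, integral_Ioc_eq_integral_Ioo, taylorKernel,
    ← lintegral_const_mul' _ _ ENNReal.ofReal_ne_top]
  refine (enorm_integral_le_lintegral_enorm _).trans
    (setLIntegral_mono' measurableSet_Ioo fun θ hθ => ?_)
  have hr : 0 < 1 + θ * ((s : ℝ) - 1) := by
    have := mul_pos hθ.1 hs'
    linarith [hθ.2]
  have hc : 0 ≤ ((s : ℝ) - 1) ^ 2 * (1 - θ) := mul_nonneg (sq_nonneg _) (sub_nonneg.2 hθ.2.le)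
  rw [← ofReal_norm, ← ENNReal.ofReal_mul (by positivity)]
  refine ENNReal.ofReal_le_ofReal ?_
  rw [norm_smul, norm_smul, Real.norm_of_nonneg hc, Real.norm_of_nonneg (by positivity)]
  have hD := hT.norm_D₂_le hα.1 (by linarith [hα.2]) h (mul_pos ht' hr)
  have hpow : (t : ℝ) ^ 2 * ((t : ℝ) * (1 + θ * ((s : ℝ) - 1))) ^ (α - 2)
      = (t : ℝ) ^ α * (1 + θ * ((s : ℝ) - 1)) ^ (α - 2) := by
    rw [Real.mul_rpow ht'.le hr.le, ← mul_assoc, ← Real.rpow_natCast, ← Real.rpow_add ht']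
    congr 2
    push_cast
    ring
  calc ((s : ℝ) - 1) ^ 2 * (1 - θ) * ((t : ℝ) ^ 2 * ‖D₂ (t * (1 + θ * ((s : ℝ) - 1))) x‖)
      ≤ ((s : ℝ) - 1) ^ 2 * (1 - θ) * ((t : ℝ) ^ 2 * (fracBound T (2 - α) * ‖y‖ *
          ((t : ℝ) * (1 + θ * ((s : ℝ) - 1))) ^ (α - 2))) := by gcongr
    _ = ((s : ℝ) - 1) ^ 2 * (1 - θ) * (fracBound T (2 - α) * ‖y‖ * ((t : ℝ) ^ 2 *
          ((t : ℝ) * (1 + θ * ((s : ℝ) - 1))) ^ (α - 2))) := by ring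
    _ = _ := by rw [hpow]; ring

/-- The error estimate for the function `g` of `tA`. -/
theorem IsUnitMeanLaw.norm_hpCalc_sub_le [CompleteSpace X] {g : ℝ → ℝ} {ν : Measure ℝ≥0} (h : IsUnitMeanLaw g ν)
    (hT : IsAnalyticSemigroup T K D₁ D₂) {α : ℝ} (hα : α ∈ Icc (0 : ℝ) 1) {t : ℝ≥0} (ht : 0 < t)
    {x y : X} (hxy : IsFracPow T α x y) :
    ‖hpCalc (scaleSemigroup T t) (fun z => (g z : ℂ)) x - T t x‖
      ≤ fracBound T (2 - α) * cFun α g * (t : ℝ) ^ α * ‖y‖ := by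
  have := h.prob
  have hU := (hT.scale ht).toIsBoundedC0Semigroup
  have hd : IsLaplaceDiff g ν 0 :=
    ⟨inferInstance, inferInstance, fun z hz => by simpa [laplace] using h.eq z hz⟩
  have hM : 0 ≤ fracBound T (2 - α) :=
    hT.fracBound_nonneg (by linarith [hα.2]) (by linarith [hα.1])
  have hc := h.cFun_nonneg (α := α) (by linarith [hα.2])
  have hi : Integrable (fun s => T (t * s) x) ν := hU.integrable x ν
  have hi1 : Integrable (fun s : ℝ≥0 => ((s : ℝ) - 1)) ν := h.integrable_coe.sub (integrable_const 1)
  have hi2 : Integrable (fun s => T (t * s) x - T t x) ν := hi.sub (integrable_const _)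
  have hmean : ∫ s : ℝ≥0, ((s : ℝ) - 1) ∂ν = 0 := by
    rw [integral_sub h.integrable_coe (integrable_const 1), h.mean]; simp
  have heq : hpCalc (scaleSemigroup T t) (fun z => (g z : ℂ)) x - T t x
      = ∫ s, (T (t * s) x - T t x - ((s : ℝ) - 1) • (t : ℝ) • D₁ t x) ∂ν := by
    rw [hd.hpCalc_eq hU.norm_le hU.strong_cont, integral_zero_measure, sub_zero,
      integral_sub hi2 (hi1.smul_const _), integral_smul_const, hmean,
      zero_smul, sub_zero, integral_sub hi (integrable_const _)]
    simp [scaleSemigroup]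
  have hle : ‖hpCalc (scaleSemigroup T t) (fun z => (g z : ℂ)) x - T t x‖ₑ
      ≤ ENNReal.ofReal (fracBound T (2 - α) * (t : ℝ) ^ α * ‖y‖) * ENNReal.ofReal (cFun α g) := by
    rw [heq, ← h.lintegral_taylorKernel hα, ← lintegral_const_mul' _ _ ENNReal.ofReal_ne_top]
    refine (enorm_integral_le_lintegral_enorm _).trans (lintegral_mono_ae ?_)
    filter_upwards [h.ae_pos] with s hs using hT.enorm_taylor_le hα ht hxy hs
  rw [← ENNReal.ofReal_mul (by positivity), ← ofReal_norm,
    ENNReal.ofReal_le_ofReal_iff (by positivity)] at hle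
  linarith

end Estimate

/-! ### The law of a function in `B₂` -/

lemma neg_mem_interior_integrableExpSet (ν : Measure ℝ≥0) [IsFiniteMeasure ν] {z : ℝ}
    (hz : 0 < z) :
    -z ∈ interior (ProbabilityTheory.integrableExpSet (fun s : ℝ≥0 => (s : ℝ)) ν) := by
  refine mem_interior.2 ⟨Iio 0, fun w hw => ?_, isOpen_Iio, neg_lt_zero.2 hz⟩
  have h := integrable_exp_neg_mul ν (z := -w) (neg_nonneg.2 (le_of_lt hw))
  simpa [ProbabilityTheory.integrableExpSet] using h

lemma integrable_pow_mul_exp (ν : Measure ℝ≥0) [IsFiniteMeasure ν] {z : ℝ} (hz : 0 < z) (n : ℕ) :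
    Integrable (fun s : ℝ≥0 => (s : ℝ) ^ n * Real.exp (-(z * s))) ν := by
  have h := ProbabilityTheory.integrable_pow_mul_exp_of_mem_interior_integrableExpSet
    (neg_mem_interior_integrableExpSet ν hz) n
  simpa only [neg_mul] using h

lemma iteratedDeriv_laplace (ν : Measure ℝ≥0) [IsFiniteMeasure ν] {z : ℝ} (hz : 0 < z) (n : ℕ) :
    iteratedDeriv n (laplace ν) z
      = (-1) ^ n * ∫ s : ℝ≥0, (s : ℝ) ^ n * Real.exp (-(z * s)) ∂ν := by
  have h1 : laplace ν = fun z => ProbabilityTheory.mgf (fun s : ℝ≥0 => (s : ℝ)) ν (-z) := by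
    funext z
    simp only [laplace, ProbabilityTheory.mgf, neg_mul]
  rw [h1, iteratedDeriv_comp_neg, ProbabilityTheory.iteratedDeriv_mgf
    (neg_mem_interior_integrableExpSet ν hz), smul_eq_mul]
  simp only [neg_mul]

lemma moment_of_tendsto (ν : Measure ℝ≥0) [IsFiniteMeasure ν] (n : ℕ) {L : ℝ}
    (h : Tendsto (fun z : ℝ => ∫ s : ℝ≥0, (s : ℝ) ^ n * Real.exp (-(z * s)) ∂ν) (𝓝[>] 0) (𝓝 L)) :
    Integrable (fun s : ℝ≥0 => (s : ℝ) ^ n) ν ∧ ∫ s : ℝ≥0, (s : ℝ) ^ n ∂ν = L := by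
  have hz : ∀ k : ℕ, (0 : ℝ) < 1 / ((k : ℝ) + 1) := fun k => by positivity
  have hzt : Tendsto (fun k : ℕ => 1 / ((k : ℝ) + 1)) atTop (𝓝 0) :=
    tendsto_one_div_add_atTop_nhds_zero_nat
  have hzt' : Tendsto (fun k : ℕ => 1 / ((k : ℝ) + 1)) atTop (𝓝[>] 0) :=
    tendsto_nhdsWithin_iff.2 ⟨hzt, Eventually.of_forall hz⟩
  have h1 := (ENNReal.continuous_ofReal.tendsto L).comp (h.comp hzt')
  have hnn : ∀ (z : ℝ) (s : ℝ≥0), 0 ≤ (s : ℝ) ^ n * Real.exp (-(z * s)) := fun z s => by positivity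
  have h2 : Tendsto (fun k : ℕ => ∫⁻ s : ℝ≥0, ENNReal.ofReal
      ((s : ℝ) ^ n * Real.exp (-(1 / ((k : ℝ) + 1) * s))) ∂ν) atTop
      (𝓝 (∫⁻ s : ℝ≥0, ENNReal.ofReal ((s : ℝ) ^ n) ∂ν)) := by
    refine lintegral_tendsto_of_tendsto_of_monotone (fun k => by fun_prop)
      (Eventually.of_forall fun s => ?_) (Eventually.of_forall fun s => ?_)
    · intro k m hkm
      refine ENNReal.ofReal_le_ofReal (mul_le_mul_of_nonneg_left (Real.exp_le_exp.2 ?_) (by positivity))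
      have : (k : ℝ) ≤ m := Nat.cast_le.2 hkm
      gcongr
    · refine (ENNReal.continuous_ofReal.tendsto _).comp ?_
      have hc : Continuous fun z : ℝ => (s : ℝ) ^ n * Real.exp (-(z * s)) := by fun_prop
      have h := (hc.tendsto 0).comp hzt
      simp only [zero_mul, neg_zero, Real.exp_zero, mul_one] at h
      exact h
  have h3 : ∫⁻ s : ℝ≥0, ENNReal.ofReal ((s : ℝ) ^ n) ∂ν = ENNReal.ofReal L := by
    refine tendsto_nhds_unique h2 (h1.congr fun k => ?_)
    exact ofReal_integral_eq_lintegral_ofReal (integrable_pow_mul_exp ν (hz k) n)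
      (Eventually.of_forall fun s => hnn _ s)
  have hL : 0 ≤ L := ge_of_tendsto' h fun z => integral_nonneg fun s => hnn z s
  have hi : Integrable (fun s : ℝ≥0 => (s : ℝ) ^ n) ν := by
    refine (lintegral_ofReal_ne_top_iff_integrable (by fun_prop)
      (Eventually.of_forall fun s => by positivity)).1 ?_
    rw [h3]
    exact ENNReal.ofReal_ne_top
  refine ⟨hi, ?_⟩
  rw [← ofReal_integral_eq_lintegral_ofReal hi (Eventually.of_forall fun s => by positivity)] at h3
  exact (ENNReal.ofReal_eq_ofReal_iff (integral_nonneg fun s => by positivity) hL).1 h3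

lemma ClassB2.exists_law {g : ℝ → ℝ} (hg : ClassB2 g) : ∃ ν : Measure ℝ≥0,
    IsProbabilityMeasure ν ∧ (∀ z : ℝ, 0 < z → g z = laplace ν z) ∧
      MemLp (fun s : ℝ≥0 => (s : ℝ)) 2 ν ∧ ∫ s : ℝ≥0, (s : ℝ) ∂ν = 1 ∧
      ∫ s : ℝ≥0, (s : ℝ) ^ 2 ∂ν = secondDerivZero g := by
  obtain ⟨⟨⟨hcm, -⟩, h0, h1⟩, c, hc⟩ := hg
  obtain ⟨ν, hν, heq⟩ := hcm.exists_laplace h0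
  have hd : ∀ (n : ℕ) (z : ℝ), 0 < z → (-1) ^ n * iteratedDeriv n g z
      = ∫ s : ℝ≥0, (s : ℝ) ^ n * Real.exp (-(z * s)) ∂ν := by
    intro n z hz
    rw [Set.EqOn.iteratedDeriv_of_isOpen (g := laplace ν) (fun z hz => heq z hz) isOpen_Ioi n hz,
      iteratedDeriv_laplace ν hz, ← mul_assoc, ← mul_pow]
    simp
  have m1 := moment_of_tendsto ν 1 (L := 1) <| by
    refine Tendsto.congr' (eventually_nhdsWithin_of_forall fun z hz => hd 1 z hz) ?_
    simpa [iteratedDeriv_one] using h1.neg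
  have m2 := moment_of_tendsto ν 2 (L := c) <| by
    refine Tendsto.congr' (eventually_nhdsWithin_of_forall fun z hz => hd 2 z hz) ?_
    simpa using hc
  simp only [pow_one] at m1
  refine ⟨ν, hν, heq, (memLp_two_iff_integrable_sq (by fun_prop)).2 m2.1, m1.2, ?_⟩
  rw [m2.2, secondDerivZero, hc.limUnder_eq]

lemma ClassB2Inf.exists_law {g : ℝ → ℝ} (hg : ClassB2Inf g) : ∃ ν : Measure ℝ≥0,
    IsUnitMeanLaw g ν := by
  obtain ⟨ν, h1, h2, h3, h4, -⟩ := hg.1.exists_law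
  exact ⟨ν, h1, h2, h3, h4, hg.2⟩

/-- The law of `g(z / n)^n` is that of the mean of `n` independent variables. -/
lemma IsUnitMeanLaw.exists_scaledPow {g : ℝ → ℝ} {ν : Measure ℝ≥0} (h : IsUnitMeanLaw g ν) {n : ℕ}
    (hn : 1 ≤ n) : ∃ ν', IsUnitMeanLaw (scaledPow g n) ν' := by
  have := h.prob
  have hn0 : (0 : ℝ) < n := by exact_mod_cast hn
  let S : (Fin n → ℝ≥0) → ℝ≥0 := fun s => (∑ i, s i) / n
  have hS : Measurable S := by fun_prop
  have hcoe : ∀ s, (S s : ℝ) = (∑ i, (s i : ℝ)) / n := fun s => by simp [S]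
  have hLp : ∀ i : Fin n, MemLp (fun s : Fin n → ℝ≥0 => (s i : ℝ)) 2 (Measure.pi fun _ => ν) :=
    fun i => h.memLp.comp_measurePreserving (measurePreserving_eval (fun _ => ν) i)
  refine ⟨(Measure.pi fun _ => ν).map S, Measure.isProbabilityMeasure_map hS.aemeasurable,
    fun z hz => ?_, ?_, ?_, ?_⟩
  · rw [scaledPow, h.eq _ (by positivity), laplace, laplace, integral_map hS.aemeasurable
      (by fun_prop)]
    have := integral_fintype_prod_eq_pow (ι := Fin n) (μ := ν)
      (fun s : ℝ≥0 => Real.exp (-(z / n * s)))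
    rw [Fintype.card_fin] at this
    rw [← this]
    refine integral_congr_ae (Eventually.of_forall fun s => ?_)
    simp only [hcoe]
    rw [← Real.exp_sum]
    congr 1
    rw [Finset.sum_neg_distrib, ← Finset.mul_sum]
    ring
  · rw [memLp_map_measure_iff (by fun_prop) hS.aemeasurable]
    have := (memLp_finsetSum Finset.univ fun i _ => hLp i).mul_const ((n : ℝ)⁻¹)
    refine this.ae_eq (Eventually.of_forall fun s => ?_)
    simp only [Function.comp_apply, hcoe, div_eq_mul_inv]
  · rw [integral_map hS.aemeasurable (by fun_prop)]
    simp only [hcoe]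
    rw [integral_div, integral_finsetSum _ fun i _ => (hLp i).integrable (by norm_num)]
    have : ∀ i : Fin n, ∫ s : Fin n → ℝ≥0, (s i : ℝ) ∂(Measure.pi fun _ => ν) = 1 := fun i =>
      (integral_comp_eval (μ := fun _ : Fin n => ν) (i := i) (f := fun s : ℝ≥0 => (s : ℝ))
        (by fun_prop)).trans h.mean
    simp [this, hn0.ne']
  · have h1 : IntegrableOn (fun z : ℝ => g ((n : ℝ)⁻¹ * z) / ((n : ℝ)⁻¹ * z)) (Ioi 1) := by
      rw [integrableOn_Ioi_comp_mul_left_iff (fun s => g s / s) 1 (inv_pos.2 hn0), mul_one]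
      exact h.integrableOn_Ioi (inv_pos.2 hn0)
    have hpos : ∀ z ∈ Ioi (1 : ℝ), 0 < z / n := fun z hz => div_pos (zero_lt_one.trans hz) hn0
    refine (h1.const_mul (n : ℝ)⁻¹).mono' ?_ ((ae_restrict_iff' measurableSet_Ioi).2
      (Eventually.of_forall fun z hz => ?_))
    · refine ContinuousOn.aestronglyMeasurable (ContinuousOn.div (ContinuousOn.pow
        (h.continuousOn.comp (by fun_prop) hpos) n) continuousOn_id
        fun z hz => (zero_lt_one.trans hz).ne') measurableSet_Ioi
    · have hz0 : 0 < z := zero_lt_one.trans hz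
      have hg0 := h.nonneg (hpos z hz)
      rw [scaledPow, Real.norm_of_nonneg (by positivity), ← div_eq_inv_mul z]
      have : g (z / n) ^ n ≤ g (z / n) := pow_le_of_le_one hg0 (h.le_one (hpos z hz)) (by omega)
      calc g (z / n) ^ n / z ≤ g (z / n) / z := by gcongr
        _ = (n : ℝ)⁻¹ * (g (z / n) / (z / n)) := by field_simp

lemma integrableOn_div_of_memLp {g : ℝ → ℝ} {k : ℕ} (hk : 1 ≤ k)
    (h0 : ∀ z, 0 < z → 0 ≤ g z) (hanti : AntitoneOn g (Ioi 0))
    (hLp : MemLp g (k : ℝ≥0∞) (volume.restrict (Ioi (0 : ℝ)))) :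
    IntegrableOn (fun s => g s / s) (Ioi 1) := by
  have hk0 : (0 : ℝ) < k := by exact_mod_cast hk
  have hint : IntegrableOn (fun s => g s ^ k) (Ioi 0) := by
    refine (hLp.integrable_norm_pow (by omega)).congr ((ae_restrict_iff' measurableSet_Ioi).2
      (Eventually.of_forall fun z hz => ?_))
    simp only [Real.norm_of_nonneg (h0 z hz)]
  set I := ∫ s in Ioi (0 : ℝ), g s ^ k with hI
  have hI0 : 0 ≤ I := setIntegral_nonneg measurableSet_Ioi fun s hs => pow_nonneg (h0 s hs) k
  have hz : ∀ z, 0 < z → z * g z ^ k ≤ I := by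
    intro z hz
    calc z * g z ^ k = ∫ _ in Ioc (0 : ℝ) z, g z ^ k := by simp [hz.le]
      _ ≤ ∫ s in Ioc (0 : ℝ) z, g s ^ k := by
          refine setIntegral_mono_on (by simp) (hint.mono_set Ioc_subset_Ioi_self)
            measurableSet_Ioc fun s hs => ?_
          exact pow_le_pow_left₀ (h0 z hz) (hanti hs.1 hz hs.2) k
      _ ≤ I := by
          refine setIntegral_mono_set hint ?_ Ioc_subset_Ioi_self.eventuallyLE
          exact (ae_restrict_iff' measurableSet_Ioi).2
            (Eventually.of_forall fun s hs => pow_nonneg (h0 s hs) k)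
  have hb : IntegrableOn (fun z : ℝ => I ^ (k : ℝ)⁻¹ * z ^ (-1 - (k : ℝ)⁻¹)) (Ioi 1) :=
    (integrableOn_Ioi_rpow_of_lt (by have := inv_pos.2 hk0; linarith) one_pos).const_mul _
  refine hb.mono' ?_ ((ae_restrict_iff' measurableSet_Ioi).2 (Eventually.of_forall fun z hz1 => ?_))
  · exact ((hLp.1.mono_set (Ioi_subset_Ioi zero_le_one)).aemeasurable.div
      measurable_id.aemeasurable).aestronglyMeasurable
  · have hz0 : 0 < z := zero_lt_one.trans hz1
    have hg := h0 z hz0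
    rw [Real.norm_of_nonneg (by positivity)]
    have h1 : g z ≤ (I / z) ^ (k : ℝ)⁻¹ := by
      rw [Real.le_rpow_inv_iff_of_pos hg (by positivity) hk0, Real.rpow_natCast, le_div_iff₀ hz0]
      linarith [hz z hz0]
    calc g z / z ≤ (I / z) ^ (k : ℝ)⁻¹ / z := by gcongr
      _ = _ := by
        rw [Real.div_rpow hI0 hz0.le, sub_eq_add_neg, Real.rpow_add hz0, Real.rpow_neg_one,
          Real.rpow_neg hz0.le]
        field_simp

/-! ### The asymptotics of `c_α[g_n]` -/

lemma one_sub_add_le_exp {b C u : ℝ} (hb : 0 ≤ b) (hC : C = b + 1 / 2) (hu : 0 < u)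
    (hu1 : u ≤ 1 / (2 * b + 2)) :
    b * u ^ 2 / 2 + C * u ^ 3 ≤ u / 2 ∧
      1 - u + (1 + b) * u ^ 2 / 2 ≤ Real.exp (-u + (b * u ^ 2 / 2 + C * u ^ 3)) := by
  rw [le_div_iff₀ (by linarith)] at hu1
  have hu2 : u ≤ 1 / 2 := by nlinarith
  have hC0 : 0 ≤ C := by linarith
  set y := b * u ^ 2 / 2 + C * u ^ 3 with hy
  have hy0 : 0 ≤ y := by positivity
  have hyu : y ≤ u / 2 := by
    have h1 : b * u / 2 + C * u ^ 2 ≤ 1 / 2 := by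
      have : C * u ^ 2 ≤ C * (u * (1 / 2)) := by
        rw [sq]; gcongr
      subst hC
      nlinarith
    calc y = u * (b * u / 2 + C * u ^ 2) := by rw [hy]; ring
      _ ≤ u * (1 / 2) := by gcongr
      _ = u / 2 := by ring
  refine ⟨hyu, ?_⟩
  have hx : |-u + y| ≤ u := abs_le.2 ⟨by linarith, by linarith⟩
  have hexp := Real.exp_bound (x := -u + y) (hx.trans (by linarith)) (n := 3) (by norm_num)
  norm_num [Finset.sum_range_succ, Nat.factorial] at hexp
  have h3 : |-u + y| ^ 3 ≤ u ^ 3 := pow_le_pow_left₀ (abs_nonneg _) hx 3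
  have h4 := (abs_le.1 hexp).1
  have h5 : u * y ≤ b * u ^ 3 / 2 + C * u ^ 3 / 2 := by
    have : C * u ^ 4 ≤ C * u ^ 3 / 2 := by
      have : C * u ^ 3 * u ≤ C * u ^ 3 * (1 / 2) := by gcongr
      linarith
    rw [hy]; linarith
  have h6 : 0 < u ^ 3 := by positivity
  have h7 : C * u ^ 3 = b * u ^ 3 + 1 / 2 * u ^ 3 := by rw [hC]; ring
  nlinarith [sq_nonneg y]

lemma exp_le_one_add_add_sq {Y : ℝ} (hY : 0 ≤ Y) : Real.exp Y ≤ 1 + Y + Y ^ 2 * Real.exp Y := by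
  have h1 : Real.exp Y - 1 ≤ Y * Real.exp Y := by
    have := Real.add_one_le_exp (-Y)
    have h2 : Real.exp (-Y) * Real.exp Y = 1 := by rw [← Real.exp_add]; simp
    nlinarith [Real.exp_pos Y]
  nlinarith

lemma integrableOn_pow_mul_exp (m : ℕ) :
    IntegrableOn (fun z : ℝ => z ^ m * Real.exp (-(1 / 2 * z))) (Ioi 0) := by
  have h1 := Real.integral_rpow_mul_exp_neg_mul_Ioi (a := m + 1) (r := 1 / 2) (by positivity)
    (by norm_num)
  have h2 : Integrable (fun z : ℝ => z ^ ((m : ℝ) + 1 - 1) * Real.exp (-(1 / 2 * z)))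
      (volume.restrict (Ioi 0)) := by
    refine Integrable.of_integral_ne_zero ?_
    rw [h1]
    exact (mul_pos (by positivity) (Real.Gamma_pos_of_pos (by positivity))).ne'
  simp only [add_sub_cancel_right, Real.rpow_natCast] at h2
  exact h2

lemma exists_le_Gamma : ∃ c : ℝ, 0 < c ∧ ∀ a ∈ Icc (1 : ℝ) 2, c ≤ Real.Gamma a := by
  have hc : ContinuousOn Real.Gamma (Icc 1 2) := fun a ha =>
    (Real.differentiableAt_Gamma fun m => by
      have := ha.1; have : (0 : ℝ) ≤ m := m.cast_nonneg; linarith).continuousAt.continuousWithinAt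
  obtain ⟨a, ha, hmin⟩ := isCompact_Icc.exists_isMinOn ⟨1, by norm_num⟩ hc
  exact ⟨_, Real.Gamma_pos_of_pos (by linarith [ha.1]), fun x hx => hmin hx⟩

lemma inv_rpow_one_add_le {α z : ℝ} (hα : α ∈ Icc (0 : ℝ) 1) (hz : 0 < z) :
    (z ^ (1 + α))⁻¹ ≤ z⁻¹ + (z ^ 2)⁻¹ := by
  rcases le_total z 1 with h | h
  · have : z ^ (2 : ℕ) ≤ z ^ (1 + α) := by
      rw [← Real.rpow_natCast]
      exact Real.rpow_le_rpow_of_exponent_ge hz h (by push_cast; linarith [hα.2])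
    have := inv_anti₀ (by positivity) this
    have : 0 ≤ z⁻¹ := by positivity
    linarith
  · have : z ^ (1 : ℝ) ≤ z ^ (1 + α) := Real.rpow_le_rpow_of_exponent_le h (by linarith [hα.1])
    rw [Real.rpow_one] at this
    have := inv_anti₀ hz this
    have : 0 ≤ (z ^ 2)⁻¹ := by positivity
    linarith

namespace IsUnitMeanLaw

variable {g : ℝ → ℝ} {ν : Measure ℝ≥0}

/-- The variance of the law. -/
lemma variance_eq (h : IsUnitMeanLaw g ν) : Integrable (fun s : ℝ≥0 => ((s : ℝ) - 1) ^ 2) ν ∧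
    ∫ s : ℝ≥0, ((s : ℝ) - 1) ^ 2 ∂ν = ∫ s : ℝ≥0, (s : ℝ) ^ 2 ∂ν - 1 := by
  have := h.prob
  have hsq : Integrable (fun s : ℝ≥0 => (s : ℝ) ^ 2) ν := h.memLp.integrable_sq
  have hl : Integrable (fun s : ℝ≥0 => 2 * (s : ℝ) - 1) ν :=
    (h.integrable_coe.const_mul 2).sub (integrable_const 1)
  have he : ∀ s : ℝ≥0, ((s : ℝ) - 1) ^ 2 = (s : ℝ) ^ 2 - (2 * s - 1) := fun s => by ring
  simp only [he]
  refine ⟨hsq.sub hl, ?_⟩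
  rw [integral_sub hsq hl, integral_sub (h.integrable_coe.const_mul 2) (integrable_const 1),
    integral_const_mul, h.mean]
  norm_num

lemma one_le_secondMoment (h : IsUnitMeanLaw g ν) : 1 ≤ ∫ s : ℝ≥0, (s : ℝ) ^ 2 ∂ν := by
  have h1 : 0 ≤ ∫ s : ℝ≥0, ((s : ℝ) - 1) ^ 2 ∂ν := integral_nonneg fun s => sq_nonneg _
  rw [h.variance_eq.2] at h1
  linarith

lemma eq_exp_of_secondMoment (h : IsUnitMeanLaw g ν) (h1 : ∫ s : ℝ≥0, (s : ℝ) ^ 2 ∂ν = 1) {z : ℝ}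
    (hz : 0 < z) : g z = Real.exp (-z) := by
  have := h.prob
  have h0 : ∫ s : ℝ≥0, ((s : ℝ) - 1) ^ 2 ∂ν = 0 := by rw [h.variance_eq.2, h1, sub_self]
  have hae := (integral_eq_zero_iff_of_nonneg (fun s => sq_nonneg _) h.variance_eq.1).1 h0
  have hl : laplace ν z = ∫ _ : ℝ≥0, Real.exp (-z) ∂ν := by
    refine integral_congr_ae (hae.mono fun s hs => ?_)
    have : (s : ℝ) = 1 := sub_eq_zero.1 (pow_eq_zero_iff two_ne_zero |>.1 hs)
    simp [this]
  rw [h.eq z hz, hl]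
  simp

/-- Pointwise bound of the error near `0`. -/
lemma deltaFun_scaledPow_le_of_le (h : IsUnitMeanLaw g ν) {b C : ℝ}
    (hb : b = ∫ s : ℝ≥0, (s : ℝ) ^ 2 ∂ν - 1) (hC : C = b + 1 / 2) {n : ℕ} (hn : 1 ≤ n) {α z : ℝ}
    (hα : α ∈ Icc (0 : ℝ) 1) (hz : 0 < z) (hzn : z / n ≤ 1 / (2 * b + 2)) :
    deltaFun (1 + α) (scaledPow g n) z ≤ b / (2 * n) * (Real.exp (-z) * z ^ (2 - α - 1))
      + (C + (b + C) ^ 2) / n ^ 2 *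
        ((z ^ 1 + 2 * z ^ 2 + z ^ 3) * Real.exp (-(1 / 2 * z))) := by
  have hn0 : (0 : ℝ) < n := by exact_mod_cast hn
  have hb0 : 0 ≤ b := by have := h.one_le_secondMoment; linarith
  have hC0 : 0 ≤ C := by linarith
  set u := z / n with hu
  have hu0 : 0 < u := by positivity
  have hu1 : u ≤ 1 := hzn.trans (by rw [div_le_one (by linarith)]; linarith)
  have hzu : z = n * u := by rw [hu]; field_simp
  obtain ⟨hy, hexp⟩ := one_sub_add_le_exp hb0 hC hu0 hzn
  set y := b * u ^ 2 / 2 + C * u ^ 3 with hy'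
  have hy0 : 0 ≤ y := by positivity
  have hg : g u ≤ Real.exp (-u + y) := by
    refine (h.le_quadratic hu0).trans (le_trans (le_of_eq ?_) hexp)
    rw [hb]; ring
  set Y := n * y with hY
  have hY0 : 0 ≤ Y := by positivity
  have hYz : Y ≤ 1 / 2 * z := by
    rw [hY, hzu]
    calc (n : ℝ) * y ≤ n * (u / 2) := by gcongr
      _ = _ := by ring
  have hpow : g u ^ n ≤ Real.exp (-z) * Real.exp Y := by
    calc g u ^ n ≤ Real.exp (-u + y) ^ n := pow_le_pow_left₀ (h.nonneg hu0) hg n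
      _ = _ := by rw [← Real.exp_nat_mul, ← Real.exp_add, hzu, hY]; congr 1; ring
  have hYeq : Y = b * z ^ 2 / (2 * n) + C * z ^ 3 / n ^ 2 := by
    rw [hY, hy', hzu]; field_simp
  have hYle : Y ≤ (b + C) * z ^ 2 / n := by
    have h1 : y ≤ (b + C) * u ^ 2 := by
      have h2 : C * u ^ 3 ≤ C * u ^ 2 := by
        have : u ^ 3 ≤ u ^ 2 := pow_le_pow_of_le_one hu0.le hu1 (by norm_num)
        gcongr
      have : 0 ≤ b * u ^ 2 := by positivity
      rw [hy']; linarith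
    calc Y ≤ n * ((b + C) * u ^ 2) := by rw [hY]; gcongr
      _ = _ := by rw [hzu]; field_simp
  have hY2 : Y ^ 2 ≤ (b + C) ^ 2 * z ^ 4 / n ^ 2 := by
    calc Y ^ 2 ≤ ((b + C) * z ^ 2 / n) ^ 2 := pow_le_pow_left₀ hY0 hYle 2
      _ = _ := by rw [div_pow, mul_pow]; ring
  set E := Real.exp (-(1 / 2 * z)) with hE
  have hE1 : Real.exp (-z) * Real.exp Y ≤ E := by
    rw [← Real.exp_add]
    exact Real.exp_le_exp.2 (by linarith)
  have hE2 : Real.exp (-z) ≤ E := Real.exp_le_exp.2 (by linarith)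
  have hmain : g u ^ n - Real.exp (-z)
      ≤ b / (2 * n) * (Real.exp (-z) * z ^ 2) + (C + (b + C) ^ 2) / n ^ 2 * ((z ^ 3 + z ^ 4) * E) := by
    have h1 := mul_le_mul_of_nonneg_left (exp_le_one_add_add_sq hY0) (Real.exp_pos (-z)).le
    have h2 : Y ^ 2 * (Real.exp (-z) * Real.exp Y) ≤ (b + C) ^ 2 * z ^ 4 / n ^ 2 * E := by gcongr
    have h3 : C * z ^ 3 / n ^ 2 * Real.exp (-z) ≤ C * z ^ 3 / n ^ 2 * E := by gcongr
    have h4 : 0 ≤ C * z ^ 4 / n ^ 2 * E := by positivity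
    have h5 : 0 ≤ (b + C) ^ 2 * z ^ 3 / n ^ 2 * E := by positivity
    calc g u ^ n - Real.exp (-z)
        ≤ Y * Real.exp (-z) + Y ^ 2 * (Real.exp (-z) * Real.exp Y) := by linarith
      _ ≤ Y * Real.exp (-z) + (b + C) ^ 2 * z ^ 4 / n ^ 2 * E := by linarith
      _ = b * z ^ 2 / (2 * n) * Real.exp (-z) + C * z ^ 3 / n ^ 2 * Real.exp (-z)
          + (b + C) ^ 2 * z ^ 4 / n ^ 2 * E := by
          nth_rewrite 1 [hYeq]; ring
      _ ≤ b * z ^ 2 / (2 * n) * Real.exp (-z) + C * z ^ 3 / n ^ 2 * E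
          + (b + C) ^ 2 * z ^ 4 / n ^ 2 * E + C * z ^ 4 / n ^ 2 * E
          + (b + C) ^ 2 * z ^ 3 / n ^ 2 * E := by linarith
      _ = _ := by ring
  have hp0 : 0 < z ^ (1 + α) := Real.rpow_pos_of_pos hz _
  have hpe : z ^ 2 * (z ^ (1 + α))⁻¹ = z ^ (2 - α - 1) := by
    rw [← Real.rpow_natCast, ← div_eq_mul_inv, ← Real.rpow_sub hz]
    congr 1
    push_cast
    ring
  have hpi : (z ^ 3 + z ^ 4) * (z ^ (1 + α))⁻¹ ≤ z ^ 1 + 2 * z ^ 2 + z ^ 3 := by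
    calc (z ^ 3 + z ^ 4) * (z ^ (1 + α))⁻¹ ≤ (z ^ 3 + z ^ 4) * (z⁻¹ + (z ^ 2)⁻¹) := by
          gcongr; exact inv_rpow_one_add_le hα hz
      _ = _ := by field_simp; ring
  rw [deltaFun, scaledPow, ← hu, div_eq_mul_inv]
  calc (g u ^ n - Real.exp (-z)) * (z ^ (1 + α))⁻¹
      ≤ (b / (2 * n) * (Real.exp (-z) * z ^ 2) + (C + (b + C) ^ 2) / n ^ 2 *
          ((z ^ 3 + z ^ 4) * E)) * (z ^ (1 + α))⁻¹ := by gcongr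
    _ = b / (2 * n) * (Real.exp (-z) * (z ^ 2 * (z ^ (1 + α))⁻¹)) + (C + (b + C) ^ 2) / n ^ 2 *
          (((z ^ 3 + z ^ 4) * (z ^ (1 + α))⁻¹) * E) := by ring
    _ ≤ _ := by rw [hpe]; gcongr

/-- Pointwise bound of the error away from `0`. -/
lemma deltaFun_scaledPow_le_of_ge (h : IsUnitMeanLaw g ν) {δ : ℝ} (hδ : 0 < δ) {n : ℕ} (hn : 1 ≤ n)
    {α z : ℝ} (hα : α ∈ Icc (0 : ℝ) 1) (hz : δ ≤ z / n) :
    deltaFun (1 + α) (scaledPow g n) z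
      ≤ g δ ^ (n - 1) * (1 + δ⁻¹) * ((n : ℝ)⁻¹ * (g ((n : ℝ)⁻¹ * z) / ((n : ℝ)⁻¹ * z))) := by
  have hn0 : (0 : ℝ) < n := by exact_mod_cast hn
  have hn1 : (1 : ℝ) ≤ n := by exact_mod_cast hn
  have hδz : δ ≤ z := by
    rw [le_div_iff₀ hn0] at hz
    nlinarith
  have hz0 : 0 < z := hδ.trans_le hδz
  have hu0 : 0 < z / n := by positivity
  have hg := h.nonneg hu0
  have hgδ := h.nonneg hδ
  have h1 : g (z / n) ^ n ≤ g δ ^ (n - 1) * g (z / n) := by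
    obtain ⟨m, rfl⟩ : ∃ m, n = m + 1 := ⟨n - 1, by omega⟩
    rw [pow_succ, Nat.add_sub_cancel]
    gcongr
    exact h.antitoneOn hδ hu0 hz
  have h2 : (z ^ (1 + α))⁻¹ ≤ (1 + δ⁻¹) * z⁻¹ := by
    refine (inv_rpow_one_add_le hα hz0).trans ?_
    have : z⁻¹ ≤ δ⁻¹ := inv_anti₀ hδ hδz
    calc z⁻¹ + (z ^ 2)⁻¹ = (1 + z⁻¹) * z⁻¹ := by rw [sq, mul_inv]; ring
      _ ≤ _ := by gcongr
  rw [deltaFun, scaledPow, div_eq_mul_inv, ← div_eq_inv_mul z]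
  calc (g (z / n) ^ n - Real.exp (-z)) * (z ^ (1 + α))⁻¹
      ≤ (g δ ^ (n - 1) * g (z / n)) * ((1 + δ⁻¹) * z⁻¹) := by
        gcongr
        linarith [Real.exp_pos (-z)]
    _ = _ := by field_simp

lemma exists_cFun_scaledPow_le (h : IsUnitMeanLaw g ν) : ∃ C : ℝ, 0 ≤ C ∧ ∀ n : ℕ, 1 ≤ n →
    ∀ α ∈ Icc (0 : ℝ) 1, cFun α (scaledPow g n)
      ≤ (∫ s : ℝ≥0, (s : ℝ) ^ 2 ∂ν - 1) / (2 * n) + C / n ^ 2 := by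
  set b := ∫ s : ℝ≥0, (s : ℝ) ^ 2 ∂ν - 1 with hb
  have hb0 : 0 ≤ b := by have := h.one_le_secondMoment; linarith
  set C₀ := b + 1 / 2 with hC₀
  set δ := 1 / (2 * b + 2) with hδ
  have hδ0 : 0 < δ := by positivity
  have hq1 : g δ < 1 := by
    obtain ⟨hy, hexp⟩ := one_sub_add_le_exp hb0 hC₀ hδ0 le_rfl
    refine (h.le_quadratic hδ0).trans_lt (lt_of_le_of_lt (le_trans (le_of_eq ?_) hexp) ?_)
    · rw [hb]; ring
    · exact Real.exp_lt_one_iff.2 (by linarith)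
  have hq0 : 0 < g δ := (Real.exp_pos _).trans_le (h.exp_le hδ0)
  obtain ⟨B, hB⟩ := (tendsto_pow_const_mul_const_pow_of_abs_lt_one 2
    (by rwa [abs_of_pos hq0] : |g δ| < 1)).bddAbove_range
  have hB' : ∀ n : ℕ, 1 ≤ n → g δ ^ (n - 1) ≤ B / g δ / n ^ 2 := by
    intro n hn
    have hn0 : (0 : ℝ) < n := by exact_mod_cast hn
    have h1 : (n : ℝ) ^ 2 * g δ ^ n ≤ B := hB ⟨n, rfl⟩
    rw [le_div_iff₀ (by positivity), le_div_iff₀ hq0]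
    calc g δ ^ (n - 1) * (n : ℝ) ^ 2 * g δ = (n : ℝ) ^ 2 * g δ ^ (n - 1 + 1) := by
          rw [pow_succ]; ring
      _ = (n : ℝ) ^ 2 * g δ ^ n := by rw [Nat.sub_add_cancel hn]
      _ ≤ B := h1
  have hB0 : 0 ≤ B := le_trans (by positivity) (hB ⟨0, rfl⟩)
  obtain ⟨c, hc0, hc⟩ := exists_le_Gamma
  set J := ∫ u in Ioi δ, g u / u with hJ
  have hJ0 : 0 ≤ J := setIntegral_nonneg measurableSet_Ioi fun u hu =>
    div_nonneg (h.nonneg (hδ0.trans hu)) (hδ0.trans hu).le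
  have hI2 : IntegrableOn (fun z : ℝ => (z ^ 1 + 2 * z ^ 2 + z ^ 3) * Real.exp (-(1 / 2 * z)))
      (Ioi 0) := by
    refine (((integrableOn_pow_mul_exp 1).add ((integrableOn_pow_mul_exp 2).const_mul 2)).add
      (integrableOn_pow_mul_exp 3)).congr (Eventually.of_forall fun z => ?_)
    simp only [Pi.add_apply]
    ring
  set C₂ := ∫ z in Ioi (0 : ℝ), (z ^ 1 + 2 * z ^ 2 + z ^ 3) * Real.exp (-(1 / 2 * z)) with hC₂
  have hC₂0 : 0 ≤ C₂ := setIntegral_nonneg measurableSet_Ioi fun z hz => by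
    have : (0 : ℝ) < z := hz
    positivity
  have hC₀0 : 0 ≤ C₀ := by positivity
  set D := (C₀ + (b + C₀) ^ 2) * C₂ + B / g δ * ((1 + δ⁻¹) * J) with hD
  have hD0 : 0 ≤ D := by positivity
  refine ⟨D / c, by positivity, fun n hn α hα => ?_⟩
  have hn0 : (0 : ℝ) < n := by exact_mod_cast hn
  have ha : 0 < 2 - α := by linarith [hα.2]
  have hΓ : 0 < Real.Gamma (2 - α) := Real.Gamma_pos_of_pos ha
  obtain ⟨ν', h'⟩ := h.exists_scaledPow hn
  let F₁ : ℝ → ℝ := fun z => b / (2 * n) * (Real.exp (-z) * z ^ (2 - α - 1))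
  let F₂ : ℝ → ℝ := fun z => (C₀ + (b + C₀) ^ 2) / n ^ 2 *
    ((z ^ 1 + 2 * z ^ 2 + z ^ 3) * Real.exp (-(1 / 2 * z)))
  let F₃ : ℝ → ℝ := fun z => g δ ^ (n - 1) * (1 + δ⁻¹) *
    ((n : ℝ)⁻¹ * (g ((n : ℝ)⁻¹ * z) / ((n : ℝ)⁻¹ * z)))
  have i1 : IntegrableOn F₁ (Ioi 0) := (Real.GammaIntegral_convergent ha).const_mul _
  have i2 : IntegrableOn F₂ (Ioi 0) := hI2.const_mul _
  have i3 : IntegrableOn F₃ (Ioi (n * δ)) := by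
    refine Integrable.const_mul (Integrable.const_mul ?_ _) _
    have := (integrableOn_Ioi_comp_mul_left_iff (fun u => g u / u) (n * δ) (inv_pos.2 hn0)).2
    rw [inv_mul_cancel_left₀ hn0.ne'] at this
    exact this (h.integrableOn_Ioi hδ0)
  have i3' : IntegrableOn ((Ioi (n * δ)).indicator F₃) (Ioi 0) :=
    ((integrable_indicator_iff measurableSet_Ioi).2 i3).integrableOn
  have e1 : ∫ z in Ioi (0 : ℝ), F₁ z = b / (2 * n) * Real.Gamma (2 - α) := by
    rw [integral_const_mul, Real.Gamma_eq_integral ha]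
  have e2 : ∫ z in Ioi (0 : ℝ), F₂ z = (C₀ + (b + C₀) ^ 2) / n ^ 2 * C₂ := integral_const_mul _ _
  have e3 : ∫ z in Ioi (0 : ℝ), (Ioi (n * δ)).indicator F₃ z = g δ ^ (n - 1) * (1 + δ⁻¹) * J := by
    rw [setIntegral_indicator measurableSet_Ioi, Ioi_inter_Ioi, sup_eq_right.2 (by positivity),
      integral_const_mul, integral_const_mul,
      integral_comp_mul_left_Ioi (fun u => g u / u) _ (inv_pos.2 hn0),
      inv_mul_cancel_left₀ hn0.ne', inv_inv, smul_eq_mul, inv_mul_cancel_left₀ hn0.ne']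
  have hle : ∫ z in Ioi (0 : ℝ), deltaFun (1 + α) (scaledPow g n) z
      ≤ ∫ z in Ioi (0 : ℝ), (F₁ z + F₂ z + (Ioi (n * δ)).indicator F₃ z) := by
    refine setIntegral_mono_on (h'.integrableOn_deltaFun hα) ((i1.add i2).add i3')
      measurableSet_Ioi fun z hz => ?_
    have hz0 : (0 : ℝ) < z := hz
    have p1 : 0 ≤ F₁ z := by
      have := Real.rpow_nonneg hz0.le (2 - α - 1)
      positivity
    have p2 : 0 ≤ F₂ z := by positivity
    by_cases hzn : z ∈ Ioi (n * δ)
    · rw [indicator_of_mem hzn]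
      have := h.deltaFun_scaledPow_le_of_ge hδ0 hn hα (z := z) (by
        rw [le_div_iff₀ hn0, mul_comm]; exact le_of_lt hzn)
      exact this.trans (by linarith)
    · rw [indicator_of_notMem hzn, add_zero]
      refine h.deltaFun_scaledPow_le_of_le hb hC₀ hn hα hz0 ?_
      rw [div_le_iff₀ hn0, mul_comm]
      exact not_lt.1 hzn
  have i12 : IntegrableOn (fun z => F₁ z + F₂ z) (Ioi 0) := i1.add i2
  rw [integral_add i12 i3', integral_add i1 i2, e1, e2, e3] at hle
  have hrest : (C₀ + (b + C₀) ^ 2) / n ^ 2 * C₂ + g δ ^ (n - 1) * (1 + δ⁻¹) * J ≤ D / n ^ 2 := by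
    have h1 : g δ ^ (n - 1) * ((1 + δ⁻¹) * J) ≤ B / g δ / n ^ 2 * ((1 + δ⁻¹) * J) := by
      gcongr
      exact hB' n hn
    calc (C₀ + (b + C₀) ^ 2) / n ^ 2 * C₂ + g δ ^ (n - 1) * (1 + δ⁻¹) * J
        ≤ (C₀ + (b + C₀) ^ 2) / n ^ 2 * C₂ + B / g δ / n ^ 2 * ((1 + δ⁻¹) * J) := by linarith
      _ = D / n ^ 2 := by rw [hD]; ring
  rw [cFun, inv_mul_le_iff₀ hΓ]
  have hcΓ : D / n ^ 2 ≤ Real.Gamma (2 - α) * (D / c / n ^ 2) := by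
    have h1 : c * (D / c / n ^ 2) ≤ Real.Gamma (2 - α) * (D / c / n ^ 2) := by
      gcongr
      exact hc _ ⟨by linarith [hα.2], by linarith [hα.1]⟩
    refine le_trans (le_of_eq ?_) h1
    field_simp
  linarith

lemma exists_cFun_scaledPow_le_mul (h : IsUnitMeanLaw g ν) : ∃ C : ℝ, 0 < C ∧ ∀ n : ℕ, 1 ≤ n →
    ∀ α ∈ Icc (0 : ℝ) 1, cFun α (scaledPow g n)
      ≤ (∫ s : ℝ≥0, (s : ℝ) ^ 2 ∂ν - 1) / (2 * n) * (1 + C / n) := by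
  rcases h.one_le_secondMoment.eq_or_lt with hb | hb
  · refine ⟨1, one_pos, fun n hn α hα => ?_⟩
    have hn0 : (n : ℝ) ≠ 0 := by exact_mod_cast (by omega : n ≠ 0)
    have h0 : ∫ z in Ioi (0 : ℝ), deltaFun (1 + α) (scaledPow g n) z = 0 := by
      refine setIntegral_eq_zero_of_forall_eq_zero fun z hz => ?_
      have hz0 : (0 : ℝ) < z := hz
      rw [deltaFun, scaledPow, h.eq_exp_of_secondMoment hb.symm (by positivity),
        ← Real.exp_nat_mul, mul_neg, mul_div_cancel₀ _ hn0, sub_self, zero_div]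
    rw [cFun, h0, ← hb]
    simp
  · obtain ⟨C, hC0, hC⟩ := h.exists_cFun_scaledPow_le
    set b := ∫ s : ℝ≥0, (s : ℝ) ^ 2 ∂ν - 1 with hb'
    have hb0 : 0 < b := by linarith
    refine ⟨2 * C / b + 1, by positivity, fun n hn α hα => (hC n hn α hα).trans ?_⟩
    have hn0 : (0 : ℝ) < n := by exact_mod_cast hn
    have h1 : b / (2 * n) * (1 + (2 * C / b + 1) / n) = b / (2 * n) + C / n ^ 2
        + b / (2 * n ^ 2) := by
      field_simp
      ring
    have : 0 ≤ b / (2 * (n : ℝ) ^ 2) := by positivity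
    linarith

end IsUnitMeanLaw

end

theorem mainTheorem5 :
    (∀ (X : Type u) [NormedAddCommGroup X] [NormedSpace ℂ X] [CompleteSpace X]
        (A : X →ₗ.[ℂ] X) (T : ℝ≥0 → X →L[ℂ] X),
        GeneratesSectoriallyBoundedHolomorphic A T →
        ∀ g : ℝ → ℝ, ClassB2Inf g → ∀ α ∈ Icc (0 : ℝ) 1,
          FracBoundFinite T (2 - α) ∧
          IntegrableOn (deltaFun (1 + α) g) (Ioi 0) ∧
          (∀ x y : X, IsFracPow T α x y →
            ‖hpCalc T (fun z => (g z : ℂ)) x - T 1 x‖ ≤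
              fracBound T (2 - α) * cFun α g * ‖y‖) ∧
          ∀ (n : ℕ) (t : ℝ≥0), 1 ≤ n → 0 < t → ∀ x y : X, IsFracPow T α x y →
            ‖hpCalc (scaleSemigroup T t) (fun z => (scaledPow g n z : ℂ)) x - T t x‖ ≤
              fracBound T (2 - α) * cFun α (scaledPow g n) * (t : ℝ) ^ α * ‖y‖) ∧
    (∀ (g : ℝ → ℝ) (k : ℕ), ClassB2 g → 1 ≤ k →
        MemLp g (k : ℝ≥0∞) (volume.restrict (Ioi (0 : ℝ))) →
        ∃ C : ℝ, 0 < C ∧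
          ∀ (X : Type u) [NormedAddCommGroup X] [NormedSpace ℂ X] [CompleteSpace X]
            (A : X →ₗ.[ℂ] X) (T : ℝ≥0 → X →L[ℂ] X),
            GeneratesSectoriallyBoundedHolomorphic A T →
            ∀ α ∈ Icc (0 : ℝ) 1, ∀ (n : ℕ) (t : ℝ≥0), 1 ≤ n → 0 < t →
              ∀ x y : X, IsFracPow T α x y →
                ‖hpCalc (scaleSemigroup T t) (fun z => (scaledPow g n z : ℂ)) x - T t x‖ ≤
                  fracBound T (2 - α) * ((secondDerivZero g - 1) / (2 * n)) * (1 + C / n) *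
                    (t : ℝ) ^ α * ‖y‖) := by
  refine ⟨?_, ?_⟩
  · intro X _ _ _ A T hA g hg α hα
    obtain ⟨K, D₁, D₂, hT⟩ := exists_isAnalyticSemigroup hA.semigroup hA.holomorphic
    obtain ⟨ν, h⟩ := hg.exists_law
    refine ⟨hT.fracBoundFinite (by linarith [hα.2]) (by linarith [hα.1]),
      h.integrableOn_deltaFun hα, fun x y hxy => ?_, fun n t hn ht x y hxy => ?_⟩
    · have hs : scaleSemigroup T 1 = T := by
        funext s
        simp [scaleSemigroup]
      have := h.norm_hpCalc_sub_le hT hα one_pos hxy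
      simpa [hs] using this
    · obtain ⟨ν', h'⟩ := h.exists_scaledPow hn
      exact h'.norm_hpCalc_sub_le hT hα ht hxy
  · intro g k hg hk hLp
    obtain ⟨ν, hν, heq, hmem, hmean, hvar⟩ := hg.exists_law
    have h : IsUnitMeanLaw g ν := ⟨hν, heq, hmem, hmean,
      integrableOn_div_of_memLp hk (fun z hz => heq z hz ▸ laplace_nonneg ν z)
        ((antitoneOn_laplace ν).congr fun z hz => (heq z hz).symm) hLp⟩
    obtain ⟨C, hC, hle⟩ := h.exists_cFun_scaledPow_le_mul
    refine ⟨C, hC, fun X _ _ _ A T hA α hα n t hn ht x y hxy => ?_⟩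
    obtain ⟨K, D₁, D₂, hT⟩ := exists_isAnalyticSemigroup hA.semigroup hA.holomorphic
    obtain ⟨ν', h'⟩ := h.exists_scaledPow hn
    have hM : 0 ≤ fracBound T (2 - α) :=
      hT.fracBound_nonneg (by linarith [hα.2]) (by linarith [hα.1])
    refine (h'.norm_hpCalc_sub_le hT hα ht hxy).trans ?_
    have hc := hle n hn α hα
    rw [hvar] at hc
    have hMc := mul_le_mul_of_nonneg_left hc hM
    rw [← mul_assoc] at hMc
    gcongr
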